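/- **Theorem 5.1.** Define words over $\{0,1\}$ by $B_1=010$ and $B_{n+1}=B_n^{2^n}\,1\,B_n^{2^n}$ for $n\ge 1$, and let $X\subset\{0,1\}^{\mathbb Z}$ be the subshift of all two-sided sequences every finite subword of which occurs in some $B_k$. Let $J_0,J_1\subset\mathbb R$ be compact intervals of positive length such that $|J_0|/|J_1|$ is irrational. For $x\in X$, let $\mathcal T=\mathcal T_x=\{I_i:i\in\mathbb Z\}$ be the tiling of $\mathbb R$ in which $I_i$ is a translate of $J_{x_i}$, the left end point of $I_0$ is $0$, and the right end point of $I_i$ is the left end point of $I_{i+1}$ for every $i$. Here a tiling of $\mathbb R$ is a set of compact intervals (tiles) of positive length, finitely many up to translation, that cover $\mathbb R$ and have pairwise disjoint interiors. Let $X_{\mathcal T}$ be the space of all tilings $\mathcal S$ of $\mathbb R$ such that every finite set of tiles of $\mathcal S$ is a translate of a finite set of tiles of $\mathcal T$. It carries the topology given by $$d(\mathcal S,\mathcal S')=\min\Bigl\{\tfrac1{\sqrt2},\ \inf\{\epsilon>0:\ \mathcal S+t \text{ and } \mathcal S' \text{ have the same tiles meeting } B(0,1/\epsilon) \text{ for some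 } |t|<\epsilon\}\Bigr\},$$ its Borel $\sigma$-algebra $\mathcal D$, and the translation flow $T_t\mathcal S=\mathcal S-t$, $t\in\mathbb R$. Then, for every $x\in X$, there is exactly one Borel probability measure $\nu$ on $X_{\mathcal T}$ that is invariant under $(T_t)_{t\in\mathbb R}$, and the tiling dynamical system $(X_{\mathcal T},\mathcal D,\nu,(T_t)_{t\in\mathbb R})$ is a measure preserving flow, continuous in the sense that $\nu(A\,\triangle\,T_tA)\to0$ as $t\to0$ for every $A\in\mathcal D$, which is 1. rigid: there is a sequence $t_i\in\mathbb R$ that eventually leaves every compact set such that $f\circ T_{t_i}\to f$ in $L^2(\nu)$ for every $f\in L^2(\nu)$; and 2. weakly mixing: the diagonal flow $(T_t\times T_t)_{t\in\mathbb R}$ on $(X_{\mathcal T}\times X_{\mathcal T},\mathcal D\otimes\mathcal D,\nu\otimes\nu)$ is ergodic, i.e. every $A\in\mathcal D\otimes\mathcal D$ with $(\nu\otimes\nu)(A\,\triangle\,(T_t\times T_t)A)=0$ for all $t$ has measure $0$ or $1$. -/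

import Mathlib

open MeasureTheory Filter Topology
open scoped symmDiff

/-- A tile: a closed interval `[left, right]` of positive length. -/
@[ext] structure Tile where
  left : ℝ
  right : ℝ
  left_lt_right : left < right

namespace Tile

/-- The tile as a subset of the line. -/
def toSet (I : Tile) : Set ℝ := Set.Icc I.left I.right

/-- The interior of the tile. -/
def inner (I : Tile) : Set ℝ := Set.Ioo I.left I.right

/-- The length of the tile. -/
def length (I : Tile) : ℝ := I.right - I.left

/-- The translated tile `I + t`. -/
def translate (t : ℝ) (I : Tile) : Tile :=
  ⟨I.left + t, I.right + t, by linarith [I.left_lt_right]⟩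

theorem translate_translate (s t : ℝ) (I : Tile) :
    translate s (translate t I) = translate (t + s) I := by
  ext <;> simp [translate, add_assoc]

theorem translate_zero (I : Tile) : translate 0 I = I := by
  ext <;> simp [translate]

end Tile

/-- The translate `S + t` of a collection of tiles. -/
def translateTiles (S : Set Tile) (t : ℝ) : Set Tile := Tile.translate t '' S

/-- `S` is a tiling of the line: its tiles cover the line, distinct tiles have disjoint interiors,
and there are finitely many tiles up to translation. -/
structure IsTiling (S : Set Tile) : Prop where
  cover : ⋃ I ∈ S, I.toSet = Set.univ
  disjoint : ∀ I ∈ S, ∀ I' ∈ S, I ≠ I' → Disjoint I.inner I'.inner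
  finite_types : ∃ F : Set Tile, F.Finite ∧ ∀ I ∈ S, ∃ K ∈ F, ∃ t : ℝ, I = K.translate t

/-- A patch of `S`: a finite collection of tiles of `S`. -/
def IsPatch (S P : Set Tile) : Prop := P ⊆ S ∧ P.Finite

/-- Two patches are equivalent if they are translates of each other. -/
def PatchEquiv (P Q : Set Tile) : Prop := ∃ t : ℝ, Q = translateTiles P t

/-- The tiling space of `𝒯`: all tilings `S` of the line such that every patch of `S` is
equivalent to a patch of `𝒯`. -/
structure TilingSpace (𝒯 : Set Tile) where
  tiles : Set Tile
  isTiling : IsTiling tiles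
  patch : ∀ P, IsPatch tiles P → ∃ Q, IsPatch 𝒯 Q ∧ PatchEquiv P Q

/-- Two collections of tiles agree on `U` if they have the same tiles meeting `U`. -/
def AgreeOn (S S' : Set Tile) (U : Set ℝ) : Prop :=
  {I ∈ S | (I.toSet ∩ U).Nonempty} = {I ∈ S' | (I.toSet ∩ U).Nonempty}

/-- The tiling distance `min (1/√2) (inf {ε | ...})`, where `ε > 0` belongs to the set if, for some
`|t| < ε`, the collections `S + t` and `S'` agree on the ball `B(0, 1/ε)`.  The value `1/√2` is put
into the set, so that an empty set of `ε`'s gives the distance `1/√2`. -/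
noncomputable def tilingDist (S S' : Set Tile) : ℝ :=
  sInf (insert (1 / √2) {ε : ℝ | 0 < ε ∧ ∃ t : ℝ, |t| < ε ∧
    AgreeOn (translateTiles S t) S' (Metric.ball 0 (1 / ε))})

theorem IsTiling.translate {S : Set Tile} (h : IsTiling S) (t : ℝ) :
    IsTiling (translateTiles S t) := by
  refine ⟨?_, ?_, ?_⟩
  · rw [Set.eq_univ_iff_forall]
    intro y
    have hy : y - t ∈ ⋃ I ∈ S, I.toSet := by rw [h.cover]; trivial
    simp only [Set.mem_iUnion] at hy ⊢
    obtain ⟨I, hI, h1, h2⟩ := hy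
    refine ⟨I.translate t, ⟨I, hI, rfl⟩, ?_, ?_⟩ <;> simp only [Tile.translate] <;> linarith
  · rintro _ ⟨I, hI, rfl⟩ _ ⟨I', hI', rfl⟩ hne
    have hd := h.disjoint I hI I' hI' (fun e => hne (by rw [e]))
    rw [Set.disjoint_left] at hd ⊢
    rintro y ⟨h1, h2⟩ ⟨h3, h4⟩
    simp only [Tile.translate] at h1 h2 h3 h4
    exact hd (a := y - t) ⟨by linarith, by linarith⟩ ⟨by linarith, by linarith⟩
  · obtain ⟨F, hF, hF'⟩ := h.finite_types
    refine ⟨F, hF, ?_⟩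
    rintro _ ⟨I, hI, rfl⟩
    obtain ⟨K, hK, s, rfl⟩ := hF' I hI
    exact ⟨K, hK, s + t, Tile.translate_translate _ _ _⟩

theorem translateTiles_translateTiles (S : Set Tile) (s t : ℝ) :
    translateTiles (translateTiles S s) t = translateTiles S (s + t) := by
  simp only [translateTiles, Set.image_image, Tile.translate_translate]

theorem translateTiles_zero (S : Set Tile) : translateTiles S 0 = S := by
  simp [translateTiles, Tile.translate_zero]

namespace TilingSpace

variable {𝒯 : Set Tile}

/-- The topology of the tiling distance: a set is open if it contains, around each of its points,
a ball of positive radius. -/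
instance : TopologicalSpace (TilingSpace 𝒯) where
  IsOpen U := ∀ S ∈ U, ∃ ε > 0, ∀ S' : TilingSpace 𝒯, tilingDist S.tiles S'.tiles < ε → S' ∈ U
  isOpen_univ := fun _ _ => ⟨1, one_pos, fun _ _ => trivial⟩
  isOpen_inter := by
    rintro U V hU hV S ⟨hSU, hSV⟩
    obtain ⟨ε, hε, h⟩ := hU S hSU
    obtain ⟨δ, hδ, h'⟩ := hV S hSV
    exact ⟨min ε δ, lt_min hε hδ, fun S' hS' =>
      ⟨h S' (hS'.trans_le (min_le_left _ _)), h' S' (hS'.trans_le (min_le_right _ _))⟩⟩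
  isOpen_sUnion := by
    rintro 𝒰 h𝒰 S ⟨U, hU, hSU⟩
    obtain ⟨ε, hε, h⟩ := h𝒰 U hU S hSU
    exact ⟨ε, hε, fun S' hS' => ⟨U, hU, h S' hS'⟩⟩

/-- The Borel σ-algebra of the tiling space. -/
instance : MeasurableSpace (TilingSpace 𝒯) := borel _

instance : BorelSpace (TilingSpace 𝒯) := ⟨rfl⟩

/-- The translation flow `T_t S = S - t` on the tiling space. -/
def flow (t : ℝ) (S : TilingSpace 𝒯) : TilingSpace 𝒯 where
  tiles := translateTiles S.tiles (-t)
  isTiling := S.isTiling.translate (-t)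
  patch := by
    rintro P ⟨hP, hfin⟩
    have hsub : translateTiles P t ⊆ S.tiles := by
      rintro _ ⟨I, hI, rfl⟩
      obtain ⟨K, hK, rfl⟩ := hP hI
      rw [Tile.translate_translate, neg_add_cancel, Tile.translate_zero]
      exact hK
    obtain ⟨Q, hQ, s, rfl⟩ := S.patch (translateTiles P t) ⟨hsub, hfin.image _⟩
    exact ⟨_, hQ, t + s, translateTiles_translateTiles _ _ _⟩

end TilingSpace

/-- A measure preserving flow: a probability measure together with an action of `ℝ` by measure
preserving maps that is continuous in measure.  (As `t` runs over all reals, or over all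
neighbourhoods of `0`, the preimages `T t ⁻¹' A = T (-t) '' A` may replace the images.) -/
structure IsMeasurePreservingFlow {Ω : Type*} [MeasurableSpace Ω] (T : ℝ → Ω → Ω)
    (μ : Measure Ω) : Prop where
  isProbabilityMeasure : IsProbabilityMeasure μ
  map_zero : ∀ ω, T 0 ω = ω
  map_add : ∀ s t ω, T (s + t) ω = T s (T t ω)
  measurePreserving : ∀ t, MeasurePreserving (T t) μ μ
  continuous : ∀ A, MeasurableSet A → ∀ ε > 0, ∀ᶠ t in 𝓝 (0 : ℝ), μ (A ∆ (T t ⁻¹' A)) < ε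

/-- The flow is ergodic: any measurable set that is invariant up to null sets under every `T t`
has measure `0` or `1`. -/
def IsErgodicFlow {Ω : Type*} [MeasurableSpace Ω] (T : ℝ → Ω → Ω) (μ : Measure Ω) : Prop :=
  ∀ A, MeasurableSet A → (∀ t, μ (A ∆ (T t ⁻¹' A)) = 0) → μ A = 0 ∨ μ A = 1

/-- The flow is weakly mixing: the diagonal flow `T t × T t` on the square is ergodic. -/
def IsWeaklyMixingFlow {Ω : Type*} [MeasurableSpace Ω] (T : ℝ → Ω → Ω) (μ : Measure Ω) : Prop :=
  IsErgodicFlow (fun t => Prod.map (T t) (T t)) (μ.prod μ)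

/-- The flow is rigid: for some sequence `t i` that eventually leaves every compact set, `f ∘ T (t i)`
converges to `f` in `L²` for every square-integrable `f`. -/
def IsRigidFlow {Ω : Type*} [MeasurableSpace Ω] (T : ℝ → Ω → Ω) (μ : Measure Ω) : Prop :=
  ∃ t : ℕ → ℝ, Tendsto t atTop (cocompact ℝ) ∧
    ∀ f : Ω → ℂ, MemLp f 2 μ →
      Tendsto (fun i => eLpNorm (fun ω => f (T (t i) ω) - f ω) 2 μ) atTop (𝓝 0)

/-- The del Junco–Rudolph blocks, with the index shifted by one: `jrBlock n` is `B_{n+1}`, where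
`B_1 = 010` and `B_{n+1} = B_n^{2^n} 1 B_n^{2^n}`. -/
def jrBlock : ℕ → List (Fin 2)
  | 0 => [0, 1, 0]
  | n + 1 => (List.replicate (2 ^ (n + 1)) (jrBlock n)).flatten ++ [1] ++
      (List.replicate (2 ^ (n + 1)) (jrBlock n)).flatten

/-- The del Junco–Rudolph subshift: the two-sided sequences all of whose finite words
`x_i x_{i+1} ⋯ x_{i+m-1}` occur in some block. -/
def jrSubshift : Set (ℤ → Fin 2) :=
  {x | ∀ (i : ℤ) (m : ℕ), ∃ n, List.ofFn (fun k : Fin m => x (i + (k : ℕ))) <:+: jrBlock n}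

/-- The left end point of the tile number `i` in the tiling of a sequence `x` by translates of the
tiles `J 0` and `J 1`, with the tile number `0` starting at the origin. -/
noncomputable def tilePos (J : Fin 2 → Tile) (x : ℤ → Fin 2) : ℤ → ℝ
  | Int.ofNat n => ∑ k ∈ Finset.range n, (J (x k)).length
  | Int.negSucc n => -∑ k ∈ Finset.range (n + 1), (J (x (-(k + 1 : ℤ)))).length

/-- The tile number `i` of that tiling: the translate of `J (x i)` with the prescribed left end
point. -/
noncomputable def seqTile (J : Fin 2 → Tile) (x : ℤ → Fin 2) (i : ℤ) : Tile :=
  (J (x i)).translate (tilePos J x i - (J (x i)).left)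

/-- The tiling of the line that a two-sided sequence and two tiles give. -/
def seqTiling (J : Fin 2 → Tile) (x : ℤ → Fin 2) : Set Tile := Set.range (seqTile J x)

/-! Write `h n` for the length of the block `jrBlock n` as a patch and `s` for the length of `J 1`.
Every long stretch of every tiling in the hull is, up to its ends, a chain of copies of `jrBlock n`
separated by nothing or by one spacer `1`. A continuous function that almost depends only on a
bounded part of the tiling (`IsLocal`) has almost the same integral along any two copies of a long
block. Hence orbit averages converge uniformly, which gives uniqueness (`invariant_unique`).
Existence is a Krylov–Bogolyubov argument on a compact suspension (`exists_invariant`). Uniqueness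
yields ergodicity: conditioning on an invariant set of positive measure gives an invariant
probability measure.

Rigidity: within `jrBlock (n + 1)` all but two copies of `jrBlock n` are followed directly by
another one, so the translation by `h n` moves local functions little in `L¹`
(`tendsto_rigid_local`). Density passes this to sets and then to `L²`.

Weak mixing rests on two facts. The first is that translation by `s` is ergodic
(`measure_of_spacer_invariant`). For `k ≤ 2 ^ (n + 2)` the block `k` places further on lies at
distance `k * h n` or `k * h n + s`. For a set `A` invariant under `s` both translations act alike,
so the displacement `p t = ν (A ∆ T_t⁻¹ A)` is uniformly small at these multiples. The zeros of `p`
form a closed subgroup. If it were cyclic, the distance of `h n` from it would be multiplied at each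
level yet stay bounded, so it would vanish, contradicting that `h n / s` is irrational
(`subadditive_eq_zero`).

The second is the weak limit of the translations by `2 ^ (n + 1) * h n`, half a block of level `n +
1` up to the spacer. This is the mean of the identity and the translation by `-s`, according to
whether a spacer is crossed (`tendsto_correlation`). In the square the limit is the mean of four
products. A set `A` invariant under the diagonal flow must be invariant under each of them, in
particular under the identity times the translation by `-s` (`prod_spacer_invariant`). By the first
fact almost every section of `A` is null or full, so `A` is a cylinder over a flow invariant set,
and ergodicity of the flow finishes the proof. -/

/-- The translate of the tile `J a` with left end point `d`. -/
def tileAt (J : Fin 2 → Tile) (a : Fin 2) (d : ℝ) : Tile := (J a).translate (d - (J a).left)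

/-- The tiles that spell the word `w` from the position `d` on. -/
def wordTiles (J : Fin 2 → Tile) : List (Fin 2) → ℝ → Set Tile
  | [], _ => ∅
  | a :: w, d => insert (tileAt J a d) (wordTiles J w (d + (J a).length))

/-- The total length of the tiles of a word. -/
def wordLength (J : Fin 2 → Tile) (w : List (Fin 2)) : ℝ := (w.map fun a => (J a).length).sum

/-- Distinct tiles of the collection have disjoint interiors. -/
def InnerDisjoint (S : Set Tile) : Prop :=
  ∀ I ∈ S, ∀ I' ∈ S, I ≠ I' → Disjoint I.inner I'.inner

/-- The word `y i, …, y (i + m - 1)`. -/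
def factor (y : ℤ → Fin 2) (i : ℤ) (m : ℕ) : List (Fin 2) := List.ofFn fun k : Fin m => y (i + (k : ℕ))

/-! ### Patches spelled by finite words -/

section Words

variable {J : Fin 2 → Tile}

theorem Tile.length_pos (I : Tile) : 0 < I.length := sub_pos.2 I.left_lt_right

@[simp] theorem tileAt_left (a : Fin 2) (d : ℝ) : (tileAt J a d).left = d := by
  simp [tileAt, Tile.translate]

@[simp] theorem tileAt_right (a : Fin 2) (d : ℝ) : (tileAt J a d).right = d + (J a).length := by
  simp [tileAt, Tile.translate, Tile.length]; ring

theorem tileAt_translate (a : Fin 2) (d t : ℝ) :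
    (tileAt J a d).translate t = tileAt J a (d + t) := by
  ext <;> simp [Tile.translate, tileAt]
  ring

@[simp] theorem wordLength_nil : wordLength J [] = 0 := rfl

@[simp] theorem wordLength_cons (a : Fin 2) (w : List (Fin 2)) :
    wordLength J (a :: w) = (J a).length + wordLength J w := by simp [wordLength]

@[simp] theorem wordLength_append (v w : List (Fin 2)) :
    wordLength J (v ++ w) = wordLength J v + wordLength J w := by simp [wordLength]

theorem wordLength_nonneg (w : List (Fin 2)) : 0 ≤ wordLength J w := by
  induction w with
  | nil => simp
  | cons a w ih => have := (J a).length_pos; simp; linarith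

theorem wordTiles_append (v w : List (Fin 2)) (d : ℝ) :
    wordTiles J (v ++ w) d = wordTiles J v d ∪ wordTiles J w (d + wordLength J v) := by
  induction v generalizing d with
  | nil => simp [wordTiles]
  | cons a v ih => simp [wordTiles, ih, Set.insert_union, add_assoc]

theorem translateTiles_wordTiles (w : List (Fin 2)) (d t : ℝ) :
    translateTiles (wordTiles J w d) t = wordTiles J w (d + t) := by
  induction w generalizing d with
  | nil => simp [wordTiles, translateTiles]
  | cons a w ih =>
    have := ih (d + (J a).length)
    simp only [translateTiles] at this
    simp only [wordTiles, translateTiles, Set.image_insert_eq, this, tileAt_translate]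
    congr 2; ring

theorem finite_wordTiles (w : List (Fin 2)) (d : ℝ) : (wordTiles J w d).Finite := by
  induction w generalizing d with
  | nil => exact Set.finite_empty
  | cons a w ih => exact (ih _).insert _

theorem wordTiles_bounds {w : List (Fin 2)} {d : ℝ} {I : Tile} (h : I ∈ wordTiles J w d) :
    d ≤ I.left ∧ I.right ≤ d + wordLength J w := by
  induction w generalizing d with
  | nil => exact h.elim
  | cons a w ih =>
    have := (J a).length_pos
    have hw := wordLength_nonneg (J := J) w
    rcases h with rfl | h
    · simp; linarith
    · have := ih h; simp; constructor <;> linarith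

theorem Tile.not_disjoint_inner {I K : Tile} (h1 : I.left < K.right) (h2 : K.left < I.right) :
    ¬ Disjoint I.inner K.inner := by
  have := I.left_lt_right
  have := K.left_lt_right
  obtain ⟨z, hz, hz'⟩ := exists_between (show max I.left K.left < min I.right K.right by
    simp only [max_lt_iff, lt_min_iff]; refine ⟨⟨?_, ?_⟩, ?_, ?_⟩ <;> assumption)
  simp only [max_lt_iff, lt_min_iff] at hz hz'
  exact fun hd => Set.disjoint_left.1 hd ⟨hz.1, hz'.1⟩ ⟨hz.2, hz'.2⟩

theorem Tile.disjoint_inner {I K : Tile} (h : I.right ≤ K.left) : Disjoint I.inner K.inner :=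
  Set.disjoint_left.2 fun _ h1 h2 => lt_irrefl _ (h1.2.trans_le (h.trans h2.1.le))

theorem InnerDisjoint.eq {S : Set Tile} (hS : InnerDisjoint S) {I K : Tile} (hI : I ∈ S)
    (hK : K ∈ S) (h1 : I.left < K.right) (h2 : K.left < I.right) : I = K := by
  by_contra h
  exact Tile.not_disjoint_inner h1 h2 (hS I hI K hK h)

theorem innerDisjoint_wordTiles (w : List (Fin 2)) (d : ℝ) : InnerDisjoint (wordTiles J w d) := by
  induction w generalizing d with
  | nil => exact fun I hI => hI.elim
  | cons a w ih =>
    rintro I (rfl | hI) K (rfl | hK) hne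
    · exact (hne rfl).elim
    · exact Tile.disjoint_inner (by simpa using (wordTiles_bounds hK).1)
    · exact (Tile.disjoint_inner (by simpa using (wordTiles_bounds hI).1)).symm
    · exact ih _ I hI K hK hne

/-- A tile that meets the open interval occupied by a word is one of the tiles of the word. -/
theorem InnerDisjoint.mem_wordTiles {S : Set Tile} (hS : InnerDisjoint S) {w : List (Fin 2)} {d : ℝ}
    (hw : wordTiles J w d ⊆ S) {I : Tile} (hI : I ∈ S) (h0 : 0 < wordLength J w)
    (h1 : d < I.right) (h2 : I.left < d + wordLength J w) : I ∈ wordTiles J w d := by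
  induction w generalizing d with
  | nil => simp at h0
  | cons a w ih =>
    by_cases h : I.left < d + (J a).length
    · left
      exact hS.eq hI (hw (Or.inl rfl)) (by simpa using h) (by simpa using h1)
    · right
      simp only [wordLength_cons] at h2
      have := I.left_lt_right
      exact ih (fun K hK => hw (Or.inr hK)) (by linarith) (by linarith) (by linarith)

/-- Two collections that contain translates of the same word agree in the range of that word. -/
theorem agreeOn_of_wordTiles {S S' : Set Tile} (hS : InnerDisjoint S) (hS' : InnerDisjoint S')
    {w : List (Fin 2)} {d R : ℝ} (hw : wordTiles J w d ⊆ S) (hw' : wordTiles J w d ⊆ S')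
    (h1 : d ≤ -R) (h2 : R ≤ d + wordLength J w) : AgreeOn S S' (Metric.ball 0 R) := by
  have key : ∀ {S : Set Tile}, InnerDisjoint S → wordTiles J w d ⊆ S → ∀ I ∈ S,
      (I.toSet ∩ Metric.ball 0 R).Nonempty → I ∈ wordTiles J w d := by
    rintro S hS hw I hI ⟨y, ⟨hy1, hy2⟩, hy⟩
    rw [Metric.mem_ball, dist_zero_right, Real.norm_eq_abs, abs_lt] at hy
    exact hS.mem_wordTiles hw hI (by linarith) (by linarith) (by linarith)
  ext I
  exact ⟨fun h => ⟨hw' (key hS hw I h.1 h.2), h.2⟩, fun h => ⟨hw (key hS' hw' I h.1 h.2), h.2⟩⟩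

theorem translateTiles_mono {S S' : Set Tile} (h : S ⊆ S') (t : ℝ) :
    translateTiles S t ⊆ translateTiles S' t := Set.image_mono h

theorem wordTiles_subset_translate {S : Set Tile} {w : List (Fin 2)} {d t : ℝ}
    (h : wordTiles J w d ⊆ S) : wordTiles J w (d + t) ⊆ translateTiles S t :=
  translateTiles_wordTiles (J := J) w d t ▸ translateTiles_mono h t

theorem wordTiles_subset_of_infix {v l r : List (Fin 2)} {d : ℝ} :
    wordTiles J v (d + wordLength J l) ⊆ wordTiles J (l ++ v ++ r) d := by
  simp only [wordTiles_append]
  exact fun I hI => Or.inl (Or.inr hI)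

end Words

/-! ### Tilings of two-sided sequences -/

section Sequences

variable {J : Fin 2 → Tile}

theorem tilePos_zero (y : ℤ → Fin 2) : tilePos J y 0 = 0 := by
  show tilePos J y (Int.ofNat 0) = 0
  simp [tilePos]

theorem tilePos_add_one (y : ℤ → Fin 2) (i : ℤ) :
    tilePos J y (i + 1) = tilePos J y i + (J (y i)).length := by
  rcases i with n | n
  · show tilePos J y (Int.ofNat (n + 1)) = _
    simp [tilePos, Finset.sum_range_succ]
  · rcases n with _ | n
    · show tilePos J y (Int.ofNat 0) = _
      simp [tilePos]
    · show tilePos J y (Int.negSucc n) = _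
      simp only [tilePos]
      rw [Finset.sum_range_succ _ (n + 1)]
      have : (-((n + 1 : ℕ) + 1 : ℤ)) = Int.negSucc (n + 1) := by
        simp [Int.negSucc_eq]
      rw [this]; ring

theorem tilePos_strictMono (y : ℤ → Fin 2) : StrictMono (tilePos J y) :=
  strictMono_int_of_lt_succ fun i => by
    rw [tilePos_add_one]; linarith [(J (y i)).length_pos]

theorem seqTile_eq (y : ℤ → Fin 2) (i : ℤ) : seqTile J y i = tileAt J (y i) (tilePos J y i) := rfl

theorem factor_succ (y : ℤ → Fin 2) (i : ℤ) (m : ℕ) :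
    factor y i (m + 1) = y i :: factor y (i + 1) m := by
  simp only [factor, List.ofFn_succ, Fin.val_zero, Nat.cast_zero, add_zero, Fin.val_succ,
    Nat.cast_add, Nat.cast_one]
  congr 2
  ext k; congr 2; ring

theorem wordLength_factor (y : ℤ → Fin 2) (i : ℤ) (m : ℕ) :
    tilePos J y i + wordLength J (factor y i m) = tilePos J y (i + m) := by
  induction m generalizing i with
  | zero => simp [factor]
  | succ m ih =>
    rw [factor_succ, wordLength_cons, ← add_assoc, ← tilePos_add_one, ih]
    congr 1; push_cast; ring

theorem mem_wordTiles_factor {y : ℤ → Fin 2} {i : ℤ} {m : ℕ} {I : Tile} :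
    I ∈ wordTiles J (factor y i m) (tilePos J y i) ↔ ∃ j, i ≤ j ∧ j < i + m ∧ seqTile J y j = I := by
  induction m generalizing i with
  | zero =>
    simp only [factor, List.ofFn_zero, wordTiles, Set.mem_empty_iff_false, false_iff]
    rintro ⟨j, h1, h2, -⟩
    simp at h2; omega
  | succ m ih =>
    rw [factor_succ, wordTiles, Set.mem_insert_iff, ← tilePos_add_one, ih, ← seqTile_eq]
    constructor
    · rintro (rfl | ⟨j, h1, h2, rfl⟩)
      · exact ⟨i, le_rfl, by push_cast; omega, rfl⟩
      · exact ⟨j, by omega, by push_cast; omega, rfl⟩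
    · rintro ⟨j, h1, h2, rfl⟩
      rcases h1.eq_or_lt with rfl | h1
      · exact Or.inl rfl
      · exact Or.inr ⟨j, by omega, by push_cast at h2; omega, rfl⟩

theorem wordTiles_factor_subset (y : ℤ → Fin 2) (i : ℤ) (m : ℕ) :
    wordTiles J (factor y i m) (tilePos J y i) ⊆ seqTiling J y := fun _ hI =>
  let ⟨j, _, _, hj⟩ := mem_wordTiles_factor.1 hI
  ⟨j, hj⟩

theorem tileAt_eq_iff (hJ : Function.Injective fun a => (J a).length) {a b : Fin 2} {d e : ℝ} :
    tileAt J a d = tileAt J b e ↔ a = b ∧ d = e := by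
  refine ⟨fun h => ?_, fun h => by rw [h.1, h.2]⟩
  have h1 := congrArg Tile.left h
  have h2 := congrArg Tile.right h
  simp only [tileAt_left, tileAt_right] at h1 h2
  exact ⟨hJ (by simp only; linarith), h1⟩

/-- Since the two tiles differ in length, a tile determines its letter, so tiles can be read back as
words. -/
theorem eq_factor_of_wordTiles_subset (hJ : Function.Injective fun a => (J a).length)
    {y : ℤ → Fin 2} {w : List (Fin 2)} {i : ℤ} (h : wordTiles J w (tilePos J y i) ⊆ seqTiling J y) :
    w = factor y i w.length := by
  induction w generalizing i with
  | nil => simp [factor]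
  | cons a w ih =>
    obtain ⟨j, hj⟩ := h (Or.inl rfl)
    rw [seqTile_eq, tileAt_eq_iff hJ] at hj
    obtain rfl := (tilePos_strictMono y).injective hj.2
    obtain ⟨rfl, -⟩ := hj
    rw [List.length_cons, factor_succ, ← ih]
    rw [tilePos_add_one]
    exact fun I hI => h (Or.inr hI)

theorem exists_factor_of_wordTiles_subset (hJ : Function.Injective fun a => (J a).length)
    {y : ℤ → Fin 2} {w : List (Fin 2)} {d : ℝ} (h : wordTiles J w d ⊆ seqTiling J y) :
    ∃ i m, w = factor y i m := by
  rcases w with _ | ⟨a, w⟩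
  · exact ⟨0, 0, by simp [factor]⟩
  · obtain ⟨i, hi⟩ := h (Or.inl rfl)
    rw [seqTile_eq, tileAt_eq_iff hJ] at hi
    rw [← hi.2] at h
    exact ⟨i, _, eq_factor_of_wordTiles_subset hJ h⟩

/-- The length of the shorter of the two tiles. -/
noncomputable def minLength (J : Fin 2 → Tile) : ℝ := min (J 0).length (J 1).length

theorem minLength_pos : 0 < minLength J := lt_min (J 0).length_pos (J 1).length_pos

theorem minLength_le (a : Fin 2) : minLength J ≤ (J a).length := by
  fin_cases a
  · exact min_le_left _ _
  · exact min_le_right _ _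

theorem tilePos_natCast_add (y : ℤ → Fin 2) (i : ℤ) (m : ℕ) :
    tilePos J y i + m * minLength J ≤ tilePos J y (i + m) := by
  induction m with
  | zero => simp
  | succ m ih =>
    have := tilePos_add_one (J := J) y (i + m)
    have h2 := minLength_le (J := J) (y (i + m))
    push_cast
    rw [← add_assoc, this]; linarith

theorem exists_lt_tilePos (y : ℤ → Fin 2) (b : ℝ) : ∃ m : ℕ, b < tilePos J y m := by
  obtain ⟨m, hm⟩ := exists_nat_gt (b / minLength J)
  refine ⟨m, ?_⟩
  have := tilePos_natCast_add (J := J) y 0 m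
  rw [div_lt_iff₀ minLength_pos] at hm
  rw [tilePos_zero, zero_add, zero_add] at this
  linarith

theorem exists_tilePos_lt (y : ℤ → Fin 2) (b : ℝ) : ∃ m : ℕ, tilePos J y (-m) < b := by
  obtain ⟨m, hm⟩ := exists_nat_gt (-b / minLength J)
  refine ⟨m, ?_⟩
  have := tilePos_natCast_add (J := J) y (-m) m
  rw [div_lt_iff₀ minLength_pos] at hm
  rw [neg_add_cancel, tilePos_zero] at this
  linarith

theorem exists_tilePos_le_lt (y : ℤ → Fin 2) (b : ℝ) :
    ∃ i, tilePos J y i ≤ b ∧ b < tilePos J y (i + 1) := by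
  obtain ⟨m, hm⟩ := exists_lt_tilePos (J := J) y b
  obtain ⟨k, hk⟩ := exists_tilePos_lt (J := J) y b
  obtain ⟨i, hi, hi'⟩ := Int.exists_greatest_of_bdd (P := fun i => tilePos J y i ≤ b)
    ⟨m, fun z hz => (tilePos_strictMono y).le_iff_le.1 (hz.trans hm.le)⟩ ⟨-k, hk.le⟩
  exact ⟨i, hi, not_le.1 fun h => by have := hi' _ h; omega⟩

theorem innerDisjoint_seqTiling (y : ℤ → Fin 2) : InnerDisjoint (seqTiling J y) := by
  have key : ∀ i j, i < j → Disjoint (seqTile J y i).inner (seqTile J y j).inner := by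
    intro i j hij
    refine Tile.disjoint_inner ?_
    rw [seqTile_eq, seqTile_eq, tileAt_right, tileAt_left, ← tilePos_add_one]
    exact (tilePos_strictMono y).monotone hij
  rintro _ ⟨i, rfl⟩ _ ⟨j, rfl⟩ hne
  rcases lt_trichotomy i j with h | rfl | h
  · exact key i j h
  · exact (hne rfl).elim
  · exact (key j i h).symm

theorem isTiling_seqTiling (y : ℤ → Fin 2) : IsTiling (seqTiling J y) := by
  refine ⟨?_, innerDisjoint_seqTiling y, Set.range J, Set.finite_range J, ?_⟩
  · refine Set.eq_univ_of_forall fun b => ?_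
    obtain ⟨i, h1, h2⟩ := exists_tilePos_le_lt (J := J) y b
    rw [tilePos_add_one] at h2
    simp only [Set.mem_iUnion]
    refine ⟨_, ⟨i, rfl⟩, ?_⟩
    rw [seqTile_eq]
    exact ⟨by simpa using h1, by simpa using h2.le⟩
  · rintro _ ⟨i, rfl⟩
    exact ⟨_, ⟨y i, rfl⟩, _, rfl⟩

/-- Every finite part of the tiling of a sequence is contained in the tiles of a factor. -/
theorem exists_factor_cover (y : ℤ → Fin 2) {P : Set Tile} (hP : P ⊆ seqTiling J y)
    (hfin : P.Finite) : ∃ i m, P ⊆ wordTiles J (factor y i m) (tilePos J y i) := by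
  have hP' : ∀ I ∈ P, ∃ i, seqTile J y i = I := fun I h => hP h
  choose! f hf using hP'
  have hb := hfin.image f
  obtain ⟨b, hb'⟩ := hb.bddAbove
  obtain ⟨a, ha'⟩ := hb.bddBelow
  refine ⟨a, (b + 1 - a).toNat, fun I hI => mem_wordTiles_factor.2 ⟨f I, ?_, ?_, hf I hI⟩⟩
  · exact ha' ⟨I, hI, rfl⟩
  · have := hb' ⟨I, hI, rfl⟩
    omega

end Sequences

/-! ### Reading words off the tilings of the hull -/

section TilingSpace

variable {J : Fin 2 → Tile} {x : ℤ → Fin 2}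

theorem TilingSpace.innerDisjoint {𝒯 : Set Tile} (S : TilingSpace 𝒯) : InnerDisjoint S.tiles :=
  S.isTiling.disjoint

theorem TilingSpace.exists_eq_tileAt (S : TilingSpace (seqTiling J x)) {I : Tile}
    (hI : I ∈ S.tiles) : ∃ a, I = tileAt J a I.left := by
  obtain ⟨Q, hQ, t, rfl⟩ := S.patch {I} ⟨Set.singleton_subset_iff.2 hI, Set.finite_singleton I⟩
  obtain ⟨i, hi⟩ := hQ.1 ⟨I, rfl, rfl⟩
  refine ⟨x i, ?_⟩
  have h : I = (seqTile J x i).translate (-t) := by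
    rw [hi, Tile.translate_translate, add_neg_cancel, Tile.translate_zero]
  rw [h, seqTile_eq, tileAt_translate, tileAt_left]

theorem TilingSpace.exists_mem (S : TilingSpace (seqTiling J x)) (b : ℝ) :
    ∃ I ∈ S.tiles, I.left ≤ b ∧ b ≤ I.right := by
  have : b ∈ ⋃ I ∈ S.tiles, I.toSet := by rw [S.isTiling.cover]; trivial
  simp only [Set.mem_iUnion] at this
  obtain ⟨I, hI, h⟩ := this
  exact ⟨I, hI, h.1, h.2⟩

theorem TilingSpace.minLength_le (S : TilingSpace (seqTiling J x)) {I : Tile} (hI : I ∈ S.tiles) :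
    I.left + minLength J ≤ I.right := by
  obtain ⟨a, ha⟩ := S.exists_eq_tileAt hI
  rw [ha, tileAt_right, tileAt_left]
  linarith [_root_.minLength_le (J := J) a]

/-- The tile next to a tile. -/
theorem TilingSpace.exists_next (S : TilingSpace (seqTiling J x)) {I : Tile} (hI : I ∈ S.tiles) :
    ∃ a, tileAt J a I.right ∈ S.tiles := by
  have hδ := minLength_pos (J := J)
  have key : ∀ η, 0 < η → η < minLength J → ∃ K ∈ S.tiles, I.right ≤ K.left ∧
      K.left ≤ I.right + η ∧ I.right + η ≤ K.right := by
    intro η h0 h1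
    obtain ⟨K, hK, h2, h3⟩ := S.exists_mem (I.right + η)
    refine ⟨K, hK, ?_, h2, h3⟩
    by_contra! h
    have := S.innerDisjoint.eq hI hK (by have := I.left_lt_right; linarith) h
    subst this
    linarith
  obtain ⟨K, hK, h1, h2, h3⟩ := key (minLength J / 2) (by linarith) (by linarith)
  -- A gap before `K` is impossible: the tile over its midpoint starts no earlier than the end of
  -- `I`, has length at least `minLength J`, and so overlaps `K`.
  rcases h1.eq_or_lt with h | h
  · obtain ⟨a, ha⟩ := S.exists_eq_tileAt hK
    exact ⟨a, by rw [h, ← ha]; exact hK⟩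
  · obtain ⟨K', hK', h1', h2', h3'⟩ := key ((K.left - I.right) / 2) (by linarith) (by linarith)
    have hl := S.minLength_le hK'
    have := S.innerDisjoint.eq hK hK' (by linarith) (by have := K.left_lt_right; linarith)
    subst this
    linarith

theorem TilingSpace.exists_word (S : TilingSpace (seqTiling J x)) {I : Tile} (hI : I ∈ S.tiles)
    (m : ℕ) : ∃ w : List (Fin 2), w.length = m ∧ wordTiles J w I.right ⊆ S.tiles := by
  induction m generalizing I with
  | zero => exact ⟨[], rfl, Set.empty_subset _⟩
  | succ m ih =>
    obtain ⟨a, ha⟩ := S.exists_next hI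
    obtain ⟨w, hw, hw'⟩ := ih ha
    refine ⟨a :: w, by simp [hw], ?_⟩
    rw [tileAt_right] at hw'
    exact Set.insert_subset ha hw'

theorem length_mul_minLength_le (w : List (Fin 2)) : w.length * minLength J ≤ wordLength J w := by
  induction w with
  | nil => simp
  | cons a w ih =>
    have := minLength_le (J := J) a
    simp; linarith

/-- Every bounded range of a tiling in the tiling space is covered by the tiles of a factor. -/
theorem TilingSpace.exists_window (hJ : Function.Injective fun a => (J a).length)
    (S : TilingSpace (seqTiling J x)) (a b : ℝ) : ∃ i m p,
      wordTiles J (factor x i m) p ⊆ S.tiles ∧ p ≤ a ∧ b ≤ p + wordLength J (factor x i m) := by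
  -- Stepping back by the longer tile length makes the tile found here end at or before `a`; the
  -- word starts at that end.
  obtain ⟨I, hI, h1, h2⟩ := S.exists_mem (a - max (J 0).length (J 1).length)
  have h3 : I.right ≤ a := by
    obtain ⟨c, hc⟩ := S.exists_eq_tileAt hI
    have hr : I.right = I.left + (J c).length := by rw [hc, tileAt_right, tileAt_left]
    have : (J c).length ≤ max (J 0).length (J 1).length := by
      fin_cases c
      · exact le_max_left _ _
      · exact le_max_right _ _
    linarith
  obtain ⟨m, hm⟩ := exists_nat_gt ((b - I.right) / minLength J)
  rw [div_lt_iff₀ minLength_pos] at hm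
  obtain ⟨w, rfl, hw⟩ := S.exists_word hI m
  obtain ⟨Q, hQ, t, rfl⟩ := S.patch _ ⟨hw, finite_wordTiles _ _⟩
  rw [translateTiles_wordTiles] at hQ
  obtain ⟨i, m, rfl⟩ := exists_factor_of_wordTiles_subset hJ hQ.1
  have := length_mul_minLength_le (J := J) (factor x i m)
  exact ⟨i, m, _, hw, h3, by linarith⟩

end TilingSpace

/-! ### The block structure of the tilings -/

section Blocks

variable {J : Fin 2 → Tile} {x : ℤ → Fin 2}

/-- The length of the block `jrBlock n` as a patch of tiles. -/
def blockLength (J : Fin 2 → Tile) (n : ℕ) : ℝ := wordLength J (jrBlock n)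

theorem wordLength_flatten_replicate (m : ℕ) (w : List (Fin 2)) :
    wordLength J (List.replicate m w).flatten = m * wordLength J w := by
  induction m with
  | zero => simp
  | succ m ih => simp [List.replicate_succ, ih]; ring

theorem blockLength_succ (n : ℕ) :
    blockLength J (n + 1) = 2 ^ (n + 2) * blockLength J n + (J 1).length := by
  simp only [blockLength, jrBlock, wordLength_append, wordLength_flatten_replicate, wordLength_cons,
    wordLength_nil]
  push_cast; ring

theorem blockLength_pos (n : ℕ) : 0 < blockLength J n := by
  induction n with
  | zero =>
    have := (J 0).length_pos
    have := (J 1).length_pos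
    simp [blockLength, jrBlock]; linarith
  | succ n ih => rw [blockLength_succ]; have := (J 1).length_pos; positivity

theorem two_mul_blockLength_le (n : ℕ) : 2 * blockLength J n ≤ blockLength J (n + 1) := by
  rw [blockLength_succ]
  have h := blockLength_pos (J := J) n
  have := (J 1).length_pos
  have h1 : (2 : ℝ) ≤ 2 ^ (n + 2) := by
    calc (2 : ℝ) = 2 ^ 1 := by norm_num
      _ ≤ _ := pow_le_pow_right₀ (by norm_num) (by omega)
  nlinarith

theorem tendsto_blockLength : Tendsto (blockLength J) atTop atTop := by
  have h : ∀ n, 2 ^ n * blockLength J 0 ≤ blockLength J n := by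
    intro n
    induction n with
    | zero => simp
    | succ n ih => rw [pow_succ]; linarith [two_mul_blockLength_le (J := J) n]
  refine tendsto_atTop_mono h ?_
  exact (tendsto_pow_atTop_atTop_of_one_lt (by norm_num)).atTop_mul_const (blockLength_pos 0)

/-- The consecutive blocks of level `n` in `V` lead from `d` to `e`, with at most one tile `1`
after each block. -/
inductive BlockChain (J : Fin 2 → Tile) (n : ℕ) (V : Set Tile) (d : ℝ) : ℝ → Prop
  | refl : BlockChain J n V d d
  | step {e c : ℝ} : BlockChain J n V d e → wordTiles J (jrBlock n) e ⊆ V →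
      c = 0 ∨ c = (J 1).length → BlockChain J n V d (e + blockLength J n + c)

namespace BlockChain

variable {n : ℕ} {V : Set Tile} {d e f : ℝ}

theorem trans (h1 : BlockChain J n V d e) (h2 : BlockChain J n V e f) : BlockChain J n V d f := by
  induction h2 with
  | refl => exact h1
  | step _ hb hc ih => exact ih.step hb hc

theorem le (h : BlockChain J n V d e) : d ≤ e := by
  induction h with
  | refl => exact le_rfl
  | step _ _ hc ih =>
    have := blockLength_pos (J := J) n
    have := (J 1).length_pos
    rcases hc with rfl | rfl <;> linarith

theorem replicate {k : ℕ} (hk : ∀ d, wordTiles J (jrBlock k) d ⊆ V → ∀ c,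
      c = 0 ∨ c = (J 1).length → BlockChain J n V d (d + blockLength J k + c)) (m : ℕ) (d : ℝ)
    (h : wordTiles J (List.replicate (m + 1) (jrBlock k)).flatten d ⊆ V) (c : ℝ)
    (hc : c = 0 ∨ c = (J 1).length) :
    BlockChain J n V d (d + (m + 1 : ℕ) * blockLength J k + c) := by
  induction m generalizing d with
  | zero => simpa using hk d (by simpa using h) c hc
  | succ m ih =>
    rw [List.replicate_succ, List.flatten_cons, wordTiles_append, Set.union_subset_iff] at h
    have h1 := hk d h.1 0 (Or.inl rfl)
    rw [add_zero] at h1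
    refine h1.trans ?_
    convert ih _ h.2 using 1
    · simp only [blockLength]
    · simp only [blockLength]; push_cast; ring

/-- Allowing a trailing gap `c` makes the induction close: the spacer in the middle of a block
becomes the gap after the last subblock of the first half. -/
theorem of_block {k : ℕ} (hnk : n ≤ k) (h : wordTiles J (jrBlock k) d ⊆ V) {c : ℝ}
    (hc : c = 0 ∨ c = (J 1).length) : BlockChain J n V d (d + blockLength J k + c) := by
  induction k, hnk using Nat.le_induction generalizing d c with
  | base => exact refl.step h hc
  | succ k _ ih =>
    simp only [jrBlock, wordTiles_append, Set.union_subset_iff, wordLength_append,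
      wordLength_flatten_replicate, wordLength_cons, wordLength_nil, add_zero] at h
    obtain ⟨m, hm⟩ : ∃ m, 2 ^ (k + 1) = m + 1 :=
      Nat.exists_eq_succ_of_ne_zero (by positivity)
    rw [hm] at h
    have h1 := replicate (n := n) (fun d h c hc => ih h hc) m d h.1.1 _ (Or.inr rfl)
    have h2 := replicate (n := n) (fun d h c hc => ih h hc) m _ h.2 _ hc
    have h3 := h1.trans (f := d + (m + 1 : ℕ) * blockLength J k + (J 1).length +
      (m + 1 : ℕ) * blockLength J k + c) (by convert h2 using 1 <;> (simp only [blockLength]; ring))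
    convert h3 using 1
    rw [blockLength_succ]
    have : (2 : ℝ) ^ (k + 2) = 2 * (m + 1 : ℕ) := by rw [← hm]; push_cast; ring
    rw [this]; ring

/-- A chain can be cut near any point in its range. -/
theorem split (h : BlockChain J n V d e) {p : ℝ} (h1 : d ≤ p) (h2 : p ≤ e) :
    ∃ q, BlockChain J n V d q ∧ BlockChain J n V q e ∧ p ≤ q ∧
      q ≤ p + (blockLength J n + (J 1).length) := by
  have hs := (J 1).length_pos
  have hb := blockLength_pos (J := J) n
  induction h with
  | refl => exact ⟨d, refl, refl, h2, by linarith⟩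
  | step h hb hc ih =>
    rename_i e c
    by_cases hp : p ≤ e
    · obtain ⟨q, hq⟩ := ih hp
      exact ⟨q, hq.1, hq.2.1.step hb hc, hq.2.2⟩
    · refine ⟨_, h.step hb hc, refl, h2, ?_⟩
      rcases hc with rfl | rfl <;> linarith

theorem restrict (h : BlockChain J n V d e) {W : Set Tile}
    (hW : ∀ I ∈ V, d < I.right → I.left < e → I ∈ W) : BlockChain J n W d e := by
  induction h with
  | refl => exact refl
  | step h hb hc ih =>
    rename_i e c
    have hpos := blockLength_pos (J := J) n
    have hs := (J 1).length_pos
    have hc0 : 0 ≤ c := by rcases hc with rfl | rfl <;> linarith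
    refine step (ih fun I hI h1 h2 => hW I hI h1 (by linarith)) (fun I hI => ?_) hc
    have := wordTiles_bounds hI
    have := I.left_lt_right
    have := h.le
    refine hW I (hb hI) (by linarith) ?_
    rw [blockLength] at hpos ⊢
    linarith

theorem exists_block (h : BlockChain J n V d e) (hne : d < e) :
    ∃ q, wordTiles J (jrBlock n) q ⊆ V := by
  cases h with
  | refl => exact (lt_irrefl _ hne).elim
  | step _ hb _ => exact ⟨_, hb⟩

/-- A long factor of a block of higher level is up to its ends a chain of blocks. -/
theorem of_infix {k : ℕ} (hnk : n ≤ k) {v : List (Fin 2)} (hv : v <:+: jrBlock k) {p a b : ℝ}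
    (hV : wordTiles J v p ⊆ V) (ha : p ≤ a) (hb : b ≤ p + wordLength J v)
    (hab : a + 2 * (blockLength J n + (J 1).length) ≤ b) :
    ∃ q r, a ≤ q ∧ q ≤ a + (blockLength J n + (J 1).length) ∧
      b - (blockLength J n + (J 1).length) ≤ r ∧ r ≤ b ∧ BlockChain J n V q r := by
  have hs := (J 1).length_pos
  have hpos := blockLength_pos (J := J) n
  obtain ⟨l, r, hlr⟩ := hv
  have hlen : wordLength J l + wordLength J v + wordLength J r = blockLength J k := by
    rw [blockLength, ← hlr]; simp [add_assoc]
  have hl := wordLength_nonneg (J := J) l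
  have hr := wordLength_nonneg (J := J) r
  -- The whole ambient block is a chain in its own tiles. It is cut near `a` and near `b`, and the
  -- tiles in between belong to `v`.
  have h0 := of_block (J := J) (d := p - wordLength J l) hnk subset_rfl (Or.inl rfl)
  obtain ⟨q, -, hq, hq1, hq2⟩ := h0.split (p := a) (by linarith) (by linarith)
  obtain ⟨t, ht, -, ht1, ht2⟩ :=
    hq.split (p := b - (blockLength J n + (J 1).length)) (by linarith) (by linarith)
  refine ⟨q, t, hq1, hq2, ht1, by linarith, ht.restrict fun I hI h1 h2 => hV ?_⟩
  refine (innerDisjoint_wordTiles (J := J) (jrBlock k) (p - wordLength J l)).mem_wordTiles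
    ?_ hI (by linarith) (by linarith) (by linarith)
  rw [← hlr]
  convert wordTiles_subset_of_infix using 2
  ring

end BlockChain

theorem jrBlock_infix {n k : ℕ} (h : n ≤ k) : jrBlock n <:+: jrBlock k := by
  induction k, h using Nat.le_induction with
  | base => exact List.infix_rfl
  | succ k _ ih =>
    refine ih.trans ?_
    obtain ⟨m, hm⟩ : ∃ m, 2 ^ (k + 1) = m + 1 :=
      Nat.exists_eq_succ_of_ne_zero (by positivity)
    rw [jrBlock, hm, List.replicate_succ, List.flatten_cons]
    exact ⟨[], _, by simp only [List.nil_append, List.append_assoc]; rfl⟩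

theorem exists_factor_infix (hx : x ∈ jrSubshift) (n : ℕ) (i : ℤ) (m : ℕ) :
    ∃ k, n ≤ k ∧ factor x i m <:+: jrBlock k := by
  obtain ⟨k, hk⟩ := hx i m
  exact ⟨max n k, le_max_left _ _, hk.trans (jrBlock_infix (le_max_right _ _))⟩

theorem exists_block_seqTiling (hx : x ∈ jrSubshift) (n : ℕ) :
    ∃ d, wordTiles J (jrBlock n) d ⊆ seqTiling J x := by
  have hs := (J 1).length_pos
  have hpos := blockLength_pos (J := J) n
  obtain ⟨m, hm⟩ := exists_lt_tilePos (J := J) x (3 * (blockLength J n + (J 1).length))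
  obtain ⟨k, hk, hv⟩ := exists_factor_infix hx n 0 m
  have hl := wordLength_factor (J := J) x 0 m
  rw [tilePos_zero, zero_add, zero_add] at hl
  obtain ⟨q, r, h1, h2, h3, h4, hc⟩ := BlockChain.of_infix hk hv
    (wordTiles_factor_subset (J := J) x 0 m) (a := 0) (b := 3 * (blockLength J n + (J 1).length))
    (tilePos_zero x).le (by rw [tilePos_zero, zero_add, hl]; exact hm.le) (by linarith)
  exact hc.exists_block (by linarith)

theorem TilingSpace.exists_blockChain (hJ : Function.Injective fun a => (J a).length)
    (hx : x ∈ jrSubshift) (S : TilingSpace (seqTiling J x)) (n : ℕ) {a b : ℝ}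
    (hab : a + 2 * (blockLength J n + (J 1).length) ≤ b) :
    ∃ q r, a ≤ q ∧ q ≤ a + (blockLength J n + (J 1).length) ∧
      b - (blockLength J n + (J 1).length) ≤ r ∧ r ≤ b ∧ BlockChain J n S.tiles q r := by
  obtain ⟨i, m, p, h1, h2, h3⟩ := S.exists_window hJ a b
  obtain ⟨k, hk, hv⟩ := exists_factor_infix hx n i m
  exact BlockChain.of_infix hk hv h1 h2 h3 hab

/-- The tiling of a sequence of the subshift, as a point of the tiling space of another one. -/
noncomputable def tilingOf (hx : x ∈ jrSubshift) (y : ℤ → Fin 2) (hy : y ∈ jrSubshift) :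
    TilingSpace (seqTiling J x) where
  tiles := seqTiling J y
  isTiling := isTiling_seqTiling y
  patch := by
    rintro P ⟨hP, hfin⟩
    obtain ⟨i, m, hm⟩ := exists_factor_cover y hP hfin
    obtain ⟨k, l, r, hlr : l ++ factor y i m ++ r = _⟩ := hy i m
    -- Every factor of `y` sits in some block, and every block occurs in the tiling of `x`.
    obtain ⟨d, hd⟩ := exists_block_seqTiling (J := J) hx k
    rw [← hlr] at hd
    have h2 := wordTiles_subset_of_infix.trans hd
    refine ⟨translateTiles P (d + wordLength J l - tilePos J y i), ⟨?_, hfin.image _⟩, _, rfl⟩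
    refine (translateTiles_mono hm _).trans ?_
    rw [translateTiles_wordTiles]
    convert h2 using 2
    ring

/-- There is a tiling in which a given block starts at the origin. -/
theorem exists_block_at_zero (hx : x ∈ jrSubshift) (n : ℕ) :
    ∃ S : TilingSpace (seqTiling J x), wordTiles J (jrBlock n) 0 ⊆ S.tiles := by
  obtain ⟨d, hd⟩ := exists_block_seqTiling (J := J) hx n
  refine ⟨TilingSpace.flow d (tilingOf hx x hx), ?_⟩
  have := wordTiles_subset_translate (t := -d) hd
  rwa [add_neg_cancel] at this

end Blocks

/-! ### Topology of the tiling space and local functions -/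

section TilingMetric

variable {𝒯 : Set Tile}

theorem mem_translateTiles {S : Set Tile} {t : ℝ} {I : Tile} :
    I ∈ translateTiles S t ↔ I.translate (-t) ∈ S := by
  constructor
  · rintro ⟨K, hK, rfl⟩
    rwa [Tile.translate_translate, add_neg_cancel, Tile.translate_zero]
  · exact fun h => ⟨_, h, by rw [Tile.translate_translate, neg_add_cancel, Tile.translate_zero]⟩

theorem agreeOn_iff {S S' : Set Tile} {U : Set ℝ} :
    AgreeOn S S' U ↔ ∀ I : Tile, (I.toSet ∩ U).Nonempty → (I ∈ S ↔ I ∈ S') := by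
  simp only [AgreeOn, Set.ext_iff, Set.mem_ofPred_eq]
  exact forall_congr' fun I => by tauto

namespace AgreeOn

variable {S S' S'' : Set Tile} {U V : Set ℝ} {R R' t : ℝ}

theorem refl (S : Set Tile) (U : Set ℝ) : AgreeOn S S U := rfl

theorem symm (h : AgreeOn S S' U) : AgreeOn S' S U := Eq.symm h

theorem trans (h : AgreeOn S S' U) (h' : AgreeOn S' S'' U) : AgreeOn S S'' U := Eq.trans h h'

theorem mono (h : AgreeOn S S' U) (hV : V ⊆ U) : AgreeOn S S' V :=
  agreeOn_iff.2 fun I hI => agreeOn_iff.1 h I (hI.mono (Set.inter_subset_inter_right _ hV))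

theorem ball_mono (h : AgreeOn S S' (Metric.ball 0 R)) (hR : R' ≤ R) :
    AgreeOn S S' (Metric.ball 0 R') := h.mono (Metric.ball_subset_ball hR)

theorem translate (h : AgreeOn S S' (Metric.ball 0 R)) (hR : R' + |t| ≤ R) :
    AgreeOn (translateTiles S t) (translateTiles S' t) (Metric.ball 0 R') := by
  refine agreeOn_iff.2 fun I ⟨y, ⟨h1, h2⟩, hy⟩ => ?_
  rw [mem_translateTiles, mem_translateTiles]
  refine agreeOn_iff.1 h _ ⟨y - t, ⟨?_, ?_⟩, ?_⟩
  · simp only [Tile.translate]; linarith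
  · simp only [Tile.translate]; linarith
  · rw [mem_ball_zero_iff] at hy ⊢
    exact (norm_sub_le _ _).trans_lt (by rw [Real.norm_eq_abs t]; linarith)

end AgreeOn

theorem tilingDist_bddBelow (S S' : Set Tile) : BddBelow (insert (1 / √2) {ε : ℝ | 0 < ε ∧
    ∃ t : ℝ, |t| < ε ∧ AgreeOn (translateTiles S t) S' (Metric.ball 0 (1 / ε))}) := by
  refine ⟨0, ?_⟩
  rintro ε (rfl | h)
  · positivity
  · exact h.1.le

theorem tilingDist_nonneg (S S' : Set Tile) : 0 ≤ tilingDist S S' := by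
  refine Real.sInf_nonneg ?_
  rintro ε (rfl | h)
  · positivity
  · exact h.1.le

theorem tilingDist_le_inv_sqrt (S S' : Set Tile) : tilingDist S S' ≤ 1 / √2 :=
  csInf_le (tilingDist_bddBelow S S') (Or.inl rfl)

theorem tilingDist_le {S S' : Set Tile} {ε t : ℝ} (ht : |t| < ε)
    (h : AgreeOn (translateTiles S t) S' (Metric.ball 0 (1 / ε))) : tilingDist S S' ≤ ε :=
  csInf_le (tilingDist_bddBelow S S') (Or.inr ⟨(abs_nonneg t).trans_lt ht, t, ht, h⟩)

theorem exists_of_tilingDist_lt {S S' : Set Tile} {r : ℝ} (h : tilingDist S S' < r)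
    (hr : r ≤ 1 / √2) : ∃ ε t, 0 < ε ∧ ε < r ∧ |t| < ε ∧
      AgreeOn (translateTiles S t) S' (Metric.ball 0 (1 / ε)) := by
  obtain ⟨ε, (rfl | ⟨h0, t, ht, ha⟩), hε⟩ := (csInf_lt_iff (tilingDist_bddBelow S S')
    ⟨_, Or.inl rfl⟩).1 h
  · exact absurd hε (not_lt.2 hr)
  · exact ⟨ε, t, h0, hε, ht, ha⟩

theorem tilingDist_le_of_agreeOn {S S' : Set Tile} {R : ℝ} (hR : 0 < R)
    (h : AgreeOn S S' (Metric.ball 0 R)) : tilingDist S S' ≤ 1 / R :=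
  tilingDist_le (t := 0) (by simpa using hR) (by rwa [translateTiles_zero, one_div_one_div])

theorem tilingDist_self (S : Set Tile) : tilingDist S S = 0 := by
  refine le_antisymm (le_of_forall_pos_le_add fun ε hε => ?_) (tilingDist_nonneg _ _)
  have := tilingDist_le_of_agreeOn (R := 1 / ε) (by positivity) (AgreeOn.refl S _)
  rwa [one_div_one_div, ← zero_add ε] at this

theorem inv_sqrt_two_sq : (1 / √2 : ℝ) ^ 2 = 1 / 2 := by
  rw [div_pow, one_pow, Real.sq_sqrt (by norm_num)]

/-- This depends on the cap `1/√2`: below it `ε * (ε + ε') ≤ 1`, which is what is needed for a ball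
of radius `1/ε`, shrunk by a shift of size at most `ε'`, to contain the ball of radius `1/(ε + ε')`.
-/
theorem tilingDist_triangle (S S' S'' : Set Tile) :
    tilingDist S S'' ≤ tilingDist S S' + tilingDist S' S'' := by
  have hpos : (0 : ℝ) < 1 / √2 := by positivity
  by_cases hc : 1 / √2 ≤ tilingDist S S' + tilingDist S' S''
  · exact (tilingDist_le_inv_sqrt _ _).trans hc
  push Not at hc
  refine le_of_forall_pos_lt_add fun η hη => ?_
  set δ := min (η / 2) ((1 / √2 - (tilingDist S S' + tilingDist S' S'')) / 2) with hδ
  have hδ0 : 0 < δ := lt_min (by linarith) (by linarith)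
  have hδ1 : δ ≤ η / 2 := min_le_left _ _
  have hδ2 : δ ≤ (1 / √2 - (tilingDist S S' + tilingDist S' S'')) / 2 := min_le_right _ _
  have := tilingDist_nonneg S S'
  have := tilingDist_nonneg S' S''
  obtain ⟨ε, t, h0, h1, ht, h⟩ := exists_of_tilingDist_lt
    (show tilingDist S S' < tilingDist S S' + δ by linarith) (by linarith)
  obtain ⟨ε', t', h0', h1', ht', h'⟩ := exists_of_tilingDist_lt
    (show tilingDist S' S'' < tilingDist S' S'' + δ by linarith) (by linarith)
  refine (tilingDist_le (ε := ε + ε') (t := t + t')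
    ((abs_add_le _ _).trans_lt (by linarith)) ?_).trans_lt (by linarith)
  rw [← translateTiles_translateTiles]
  refine (h.translate ?_).trans (h'.ball_mono ?_)
  · have hs : ε + ε' ≤ 1 / √2 := by linarith
    have hsq : (ε + ε') ^ 2 ≤ 1 / 2 := by rw [← inv_sqrt_two_sq]; gcongr
    have : 1 / (ε + ε') + ε' ≤ 1 / ε := by
      have h5 : ε * (ε + ε') ≤ 1 := by nlinarith
      rw [div_add' _ _ _ (by positivity), div_le_div_iff₀ (by positivity) (by positivity)]
      nlinarith [mul_le_mul_of_nonneg_left h5 h0'.le]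
    linarith
  · exact one_div_le_one_div_of_le h0' (by linarith)

/-- The shift acts on the first argument only. Undoing it costs less than `ε` of the radius, and
doubling `ε` pays for this because `ε ^ 2 ≤ 1/2`. -/
theorem tilingDist_comm_le (S S' : Set Tile) : tilingDist S' S ≤ 2 * tilingDist S S' := by
  have hpos : (0 : ℝ) < 1 / √2 := by positivity
  by_cases hc : 1 / √2 ≤ tilingDist S S'
  · have := tilingDist_le_inv_sqrt S' S; linarith
  push Not at hc
  refine le_of_forall_pos_lt_add fun η hη => ?_
  have := tilingDist_nonneg S S'
  obtain ⟨ε, t, h0, h1, ht, h⟩ := exists_of_tilingDist_lt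
    (show tilingDist S S' < min (tilingDist S S' + η / 2) (1 / √2) from
      lt_min (by linarith) hc) (min_le_right _ _)
  have h2 : ε < tilingDist S S' + η / 2 := h1.trans_le (min_le_left _ _)
  have h3 : ε < 1 / √2 := h1.trans_le (min_le_right _ _)
  refine (tilingDist_le (ε := 2 * ε) (t := -t) (by rw [abs_neg]; linarith) ?_).trans_lt
    (by linarith)
  have := h.symm.translate (t := -t) (R' := 1 / (2 * ε)) ?_
  · rwa [translateTiles_translateTiles, add_neg_cancel, translateTiles_zero] at this
  · have hsq : ε ^ 2 ≤ 1 / 2 := by rw [← inv_sqrt_two_sq]; gcongr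
    have : 1 / (2 * ε) + ε ≤ 1 / ε := by
      rw [div_add' _ _ _ (by positivity), div_le_div_iff₀ (by positivity) (by positivity)]
      nlinarith
    rw [abs_neg]; linarith

namespace TilingSpace

/-- The symmetrized tiling distance. -/
noncomputable instance : PseudoMetricSpace (TilingSpace 𝒯) :=
  PseudoMetricSpace.replaceTopology
    { dist := fun S S' => max (tilingDist S.tiles S'.tiles) (tilingDist S'.tiles S.tiles)
      dist_self := fun S => by simp [tilingDist_self]
      dist_comm := fun S S' => max_comm _ _
      dist_triangle := fun S S' S'' => max_le
        ((tilingDist_triangle _ S'.tiles _).trans (add_le_add (le_max_left _ _) (le_max_left _ _)))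
        ((tilingDist_triangle _ S'.tiles _).trans (by
          rw [add_comm]; exact add_le_add (le_max_right _ _) (le_max_right _ _))) } <| by
    refine TopologicalSpace.ext_iff.2 fun U => ?_
    let m : PseudoMetricSpace (TilingSpace 𝒯) :=
      { dist := fun S S' => max (tilingDist S.tiles S'.tiles) (tilingDist S'.tiles S.tiles)
        dist_self := fun S => by simp [tilingDist_self]
        dist_comm := fun S S' => max_comm _ _
        dist_triangle := fun S S' S'' => max_le
          ((tilingDist_triangle _ S'.tiles _).trans
            (add_le_add (le_max_left _ _) (le_max_left _ _)))
          ((tilingDist_triangle _ S'.tiles _).trans (by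
            rw [add_comm]; exact add_le_add (le_max_right _ _) (le_max_right _ _))) }
    change _ ↔ IsOpen[m.toUniformSpace.toTopologicalSpace] U
    rw [Metric.isOpen_iff]
    -- By `tilingDist_comm_le`, one-sided balls and balls of the symmetrized distance contain each
    -- other after halving the radius.
    refine forall₂_congr fun S _ => ⟨?_, ?_⟩
    · rintro ⟨ε, hε, h⟩
      refine ⟨ε, hε, fun S' hS' => h S' ?_⟩
      rw [Metric.mem_ball'] at hS'
      exact (le_max_left _ _).trans_lt hS'
    · rintro ⟨ε, hε, h⟩
      refine ⟨ε / 2, by linarith, fun S' hS' => h ?_⟩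
      rw [Metric.mem_ball']
      exact max_lt (by linarith) ((tilingDist_comm_le _ _).trans_lt (by linarith))

theorem tilingDist_le_dist (S S' : TilingSpace 𝒯) : tilingDist S.tiles S'.tiles ≤ dist S S' :=
  le_max_left _ _

theorem dist_le_of_agreeOn {S S' : TilingSpace 𝒯} {R : ℝ} (hR : 0 < R)
    (h : AgreeOn S.tiles S'.tiles (Metric.ball 0 R)) : dist S S' ≤ 1 / R :=
  max_le (tilingDist_le_of_agreeOn hR h) (tilingDist_le_of_agreeOn hR h.symm)

/-- A criterion for a map into a tiling space to be continuous at a point. -/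
theorem tendsto_of_tilingDist {α : Type*} {l : Filter α} {f : α → TilingSpace 𝒯} {S : TilingSpace 𝒯}
    (h : ∀ r > 0, ∀ᶠ a in l, tilingDist S.tiles (f a).tiles ≤ r) : Tendsto f l (𝓝 S) := by
  refine Metric.tendsto_nhds.2 fun ε hε => ?_
  filter_upwards [h (ε / 3) (by linarith)] with a ha
  rw [dist_comm]
  exact max_lt (by linarith) ((tilingDist_comm_le _ _).trans_lt (by linarith))

theorem ext_tiles {S S' : TilingSpace 𝒯} (h : S.tiles = S'.tiles) : S = S' := by
  cases S; cases S'; cases h; rfl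

theorem flow_zero (S : TilingSpace 𝒯) : flow 0 S = S :=
  ext_tiles (by simp [flow, translateTiles_zero])

theorem flow_add (s t : ℝ) (S : TilingSpace 𝒯) : flow (s + t) S = flow s (flow t S) :=
  ext_tiles (by simp only [flow, translateTiles_translateTiles]; congr 1; ring)

theorem continuous_flow_uncurry : Continuous fun p : TilingSpace 𝒯 × ℝ => flow p.2 p.1 := by
  refine continuous_iff_continuousAt.2 fun ⟨S, t⟩ => tendsto_of_tilingDist fun r hr => ?_
  -- The first term bounds the shift, the second keeps enough radius to translate by `t'`, and the
  -- third is the cap below which `exists_of_tilingDist_lt` applies.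
  set δ := min (min (r / 2) (1 / (1 / r + |t| + 1))) (1 / √2) with hδ
  have h1 : δ ≤ r / 2 := (min_le_left _ _).trans (min_le_left _ _)
  have h2 : δ ≤ 1 / (1 / r + |t| + 1) := (min_le_left _ _).trans (min_le_right _ _)
  have hδ0 : 0 < δ := by positivity
  filter_upwards [prod_mem_nhds (Metric.ball_mem_nhds S hδ0)
    (Metric.ball_mem_nhds t (show 0 < min (r / 2) 1 by positivity))]
  rintro ⟨S', t'⟩ ⟨hS, ht⟩
  rw [Metric.mem_ball'] at hS
  rw [Metric.mem_ball, Real.dist_eq, lt_min_iff] at ht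
  obtain ⟨ε, τ, h0, hε, hτ, h⟩ :=
    exists_of_tilingDist_lt ((tilingDist_le_dist S S').trans_lt hS) (min_le_right _ _)
  refine tilingDist_le (t := τ + (t - t')) ((abs_add_le _ _).trans_lt ?_) ?_
  · rw [abs_sub_comm]; linarith [ht.1]
  · simp only [flow]
    rw [translateTiles_translateTiles,
      show -t + (τ + (t - t')) = τ + -t' by ring, ← translateTiles_translateTiles]
    refine h.translate ?_
    have h3 : 1 / r + |t| + 1 ≤ 1 / ε := by
      rw [le_one_div (by positivity) h0]; linarith
    have h4 : |t'| ≤ |t| + |t' - t| := by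
      have := abs_add_le t (t' - t)
      rwa [add_sub_cancel] at this
    rw [abs_neg]; linarith [ht.2]

theorem continuous_flow (t : ℝ) : Continuous (flow t : TilingSpace 𝒯 → TilingSpace 𝒯) :=
  continuous_flow_uncurry.comp (continuous_id.prodMk continuous_const)

theorem continuous_flow_left (S : TilingSpace 𝒯) : Continuous fun t => flow t S :=
  continuous_flow_uncurry.comp (continuous_const.prodMk continuous_id)

/-- Bounded continuous functions that up to a small error only depend on a bounded part of the
tiling. -/
structure IsLocal (f : TilingSpace 𝒯 → ℝ) : Prop where
  continuous : Continuous f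
  bounded : ∃ M, ∀ S, |f S| ≤ M
  approx : ∀ ε > 0, ∃ R > 0, ∀ S S' : TilingSpace 𝒯,
    AgreeOn S.tiles S'.tiles (Metric.ball 0 R) → |f S - f S'| ≤ ε

theorem IsLocal.comp_flow {f : TilingSpace 𝒯 → ℝ} (hf : IsLocal f) (t : ℝ) :
    IsLocal fun S => f (flow t S) where
  continuous := hf.continuous.comp (continuous_flow t)
  bounded := hf.bounded.imp fun M h S => h _
  approx ε hε := by
    obtain ⟨R, hR, h⟩ := hf.approx ε hε
    exact ⟨R + |t|, by positivity, fun S S' hS => h _ _ (hS.translate (by rw [abs_neg]))⟩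

theorem IsLocal.mul {f g : TilingSpace 𝒯 → ℝ} (hf : IsLocal f) (hg : IsLocal g) :
    IsLocal fun S => f S * g S := by
  obtain ⟨M, hM⟩ := hf.bounded
  obtain ⟨N, hN⟩ := hg.bounded
  refine ⟨hf.continuous.mul hg.continuous, ⟨M * N, fun S => ?_⟩, fun ε hε => ?_⟩
  · rw [abs_mul]
    exact mul_le_mul (hM S) (hN S) (abs_nonneg _) ((abs_nonneg _).trans (hM S))
  · have hM' : 0 < |M| + 1 := by positivity
    have hN' : 0 < |N| + 1 := by positivity
    obtain ⟨R, hR, h⟩ := hf.approx (ε / 2 / (|N| + 1)) (by positivity)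
    obtain ⟨R', hR', h'⟩ := hg.approx (ε / 2 / (|M| + 1)) (by positivity)
    refine ⟨max R R', lt_max_of_lt_left hR, fun S S' hS => ?_⟩
    have h1 := h S S' (hS.ball_mono (le_max_left _ _))
    have h2 := h' S S' (hS.ball_mono (le_max_right _ _))
    calc |f S * g S - f S' * g S'| = |(f S - f S') * g S + f S' * (g S - g S')| := by ring_nf
      _ ≤ |f S - f S'| * |g S| + |f S'| * |g S - g S'| := by
        rw [← abs_mul, ← abs_mul]; exact abs_add_le _ _
      _ ≤ ε / 2 / (|N| + 1) * (|N| + 1) + (|M| + 1) * (ε / 2 / (|M| + 1)) := by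
        have := hN S; have := hM S'; have := le_abs_self M; have := le_abs_self N
        gcongr <;> linarith
      _ = ε := by field_simp; ring

/-- Local functions are dense in `L¹`. -/
theorem exists_isLocal_approx (ν : Measure (TilingSpace 𝒯)) [IsFiniteMeasure ν]
    {A : Set (TilingSpace 𝒯)} (hA : MeasurableSet A) {ε : ℝ} (hε : 0 < ε) :
    ∃ f : TilingSpace 𝒯 → ℝ, IsLocal f ∧ ∫ S, |f S - A.indicator 1 S| ∂ν ≤ ε := by
  obtain ⟨F, hFA, hF, hF'⟩ := hA.exists_isClosed_sdiff_lt (μ := ν) (measure_ne_top _ _)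
    (ε := ENNReal.ofReal (ε / 2)) (by simpa using hε)
  have hlim := tendsto_integral_thickenedIndicator_of_isClosed ν hF
    (δs := fun n => 1 / (n + 1 : ℝ)) (fun n => by positivity)
    tendsto_one_div_add_atTop_nhds_zero_nat
  obtain ⟨n, hn⟩ := (hlim.eventually (gt_mem_nhds (show ν.real F < ν.real F + ε / 2 by linarith))).exists
  set δ : ℝ := 1 / (n + 1 : ℝ) with hδ
  have hδ0 : 0 < δ := by positivity
  set g := thickenedIndicator hδ0 F with hg
  have hg1 : ∀ S, (g S : ℝ) ≤ 1 := fun S => thickenedIndicator_le_one hδ0 F S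
  have hcont : Continuous fun S => (g S : ℝ) := NNReal.continuous_coe.comp g.continuous
  have hint : Integrable (fun S => (g S : ℝ)) ν := integrable_thickenedIndicator F hδ0
  have hiF : Integrable (F.indicator (1 : TilingSpace 𝒯 → ℝ)) ν :=
    (integrable_const (1 : ℝ)).indicator hF.measurableSet
  have hiA : Integrable (A.indicator (1 : TilingSpace 𝒯 → ℝ)) ν :=
    (integrable_const (1 : ℝ)).indicator hA
  refine ⟨fun S => g S, ⟨hcont, ⟨1, fun S => ?_⟩, fun η hη => ?_⟩, ?_⟩
  · rw [NNReal.abs_eq]; exact hg1 S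
  -- Agreement on this ball forces distance at most `η * δ`, and the thickened indicator has
  -- Lipschitz constant `δ⁻¹`.
  · refine ⟨1 / (η * δ), by positivity, fun S S' h => ?_⟩
    have h1 := (lipschitzWith_thickenedIndicator hδ0 F).dist_le_mul S S'
    have h2 := dist_le_of_agreeOn (by positivity) h
    rw [NNReal.dist_eq] at h1
    refine h1.trans ?_
    rw [NNReal.coe_inv, Real.coe_toNNReal _ hδ0.le]
    calc δ⁻¹ * dist S S' ≤ δ⁻¹ * (1 / (1 / (η * δ))) := by gcongr
      _ = η := by field_simp
  · have hadd := integral_add (hint.sub hiF) (hiA.sub hiF)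
    simp only [Pi.sub_apply] at hadd
    have hle : ∀ S, |(g S : ℝ) - A.indicator 1 S| ≤
        ((g S : ℝ) - F.indicator 1 S) + (A.indicator 1 S - F.indicator 1 S) := by
      intro S
      have hFg : F.indicator (1 : TilingSpace 𝒯 → ℝ) S ≤ g S := by
        by_cases hS : S ∈ F
        · have : g S = 1 := thickenedIndicator_one hδ0 F hS
          simp [hS, this]
        · simp [hS]
      have hFA' : F.indicator (1 : TilingSpace 𝒯 → ℝ) S ≤ A.indicator 1 S :=
        Set.indicator_le_indicator_of_subset hFA (fun _ => zero_le_one) S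
      rw [abs_le]; constructor <;> linarith
    refine (integral_mono ?_ ((hint.sub hiF).add (hiA.sub hiF)) hle).trans ?_
    · exact (hint.sub hiA).abs
    · simp only [Pi.add_apply, Pi.sub_apply]
      rw [hadd, integral_sub hint hiF, integral_sub hiA hiF,
        integral_indicator_one hF.measurableSet, integral_indicator_one hA]
      have h3 : ν.real (A \ F) ≤ ε / 2 := by
        rw [measureReal_def]
        exact ENNReal.toReal_le_of_le_ofReal (by linarith) hF'.le
      rw [measureReal_sdiff hFA hF.measurableSet] at h3
      linarith

/-- Local functions determine a finite measure. -/
theorem measure_ext_of_isLocal {ν ν' : Measure (TilingSpace 𝒯)} [IsFiniteMeasure ν]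
    [IsFiniteMeasure ν'] (h : ∀ f, IsLocal f → ∫ S, f S ∂ν = ∫ S, f S ∂ν') : ν = ν' := by
  refine Measure.ext fun A hA => ?_
  rw [← measureReal_eq_measureReal_iff]
  refine eq_of_forall_dist_le fun ε hε => ?_
  -- Approximating with respect to the sum gives one `f` that serves both measures.
  obtain ⟨f, hf, hfA⟩ := exists_isLocal_approx (ν + ν') hA hε
  have key : ∀ (μ : Measure (TilingSpace 𝒯)) [IsFiniteMeasure μ],
      Integrable (fun S => |f S - A.indicator 1 S|) μ ∧
      |∫ S, f S ∂μ - μ.real A| ≤ ∫ S, |f S - A.indicator 1 S| ∂μ := by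
    intro μ _
    obtain ⟨M, hM⟩ := hf.bounded
    have h1 : Integrable f μ := .of_bound hf.continuous.aestronglyMeasurable M (ae_of_all _ hM)
    have h2 : Integrable (A.indicator (1 : TilingSpace 𝒯 → ℝ)) μ :=
      (integrable_const (1 : ℝ)).indicator hA
    refine ⟨(h1.sub h2).abs, ?_⟩
    rw [← integral_indicator_one hA, ← integral_sub h1 h2]
    exact abs_integral_le_integral_abs
  rw [integral_add_measure (key ν).1 (key ν').1] at hfA
  have h1 := (key ν).2
  have h2 := (key ν').2
  rw [h f hf] at h1
  rw [Real.dist_eq]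
  calc |ν.real A - ν'.real A| = |(∫ S, f S ∂ν' - ν'.real A) - (∫ S, f S ∂ν' - ν.real A)| := by ring_nf
    _ ≤ _ := (abs_sub _ _).trans (by linarith)

end TilingSpace

end TilingMetric

/-- The tiling space of the tiling of the sequence `x`. -/
abbrev Hull (J : Fin 2 → Tile) (x : ℤ → Fin 2) := TilingSpace (seqTiling J x)

namespace Hull

open TilingSpace

/-! ### From integrals along blocks to means over the hull -/

section Orbits

variable {J : Fin 2 → Tile} {x : ℤ → Fin 2} {G : Hull J x → ℝ} {M : ℝ}

theorem intervalIntegrable_orbit (hG : Continuous G) (S : Hull J x) (a b : ℝ) :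
    IntervalIntegrable (fun u => G (flow u S)) volume a b :=
  (hG.comp (continuous_flow_left S)).intervalIntegrable _ _

theorem integral_orbit_shift (G : Hull J x → ℝ) (S : Hull J x) (a b e : ℝ) :
    ∫ u in (e + a)..(e + b), G (flow u S) = ∫ u in a..b, G (flow u (flow e S)) := by
  simp only [← flow_add]
  rw [intervalIntegral.integral_comp_add_right (fun u => G (flow u S)), add_comm e, add_comm e]

theorem abs_integral_orbit_le (hM : ∀ S, |G S| ≤ M) (S : Hull J x) {a b : ℝ} (hab : a ≤ b) :
    |∫ u in a..b, G (flow u S)| ≤ M * (b - a) := by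
  have := intervalIntegral.norm_integral_le_of_norm_le_const (a := a) (b := b)
    (f := fun u => G (flow u S)) (C := M) fun u _ => hM _
  rwa [abs_of_nonneg (sub_nonneg.2 hab)] at this

theorem integral_orbit_add (hG : Continuous G) (S : Hull J x) (a b c : ℝ) :
    ∫ u in a..c, G (flow u S) = (∫ u in a..b, G (flow u S)) + ∫ u in b..c, G (flow u S) :=
  (intervalIntegral.integral_add_adjacent_intervals (intervalIntegrable_orbit hG S _ _)
    (intervalIntegrable_orbit hG S _ _)).symm

theorem wordTiles_flow {S : Hull J x} {w : List (Fin 2)} {d : ℝ} (h : wordTiles J w d ⊆ S.tiles)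
    (e : ℝ) : wordTiles J w (d - e) ⊆ (flow e S).tiles :=
  wordTiles_subset_translate (t := -e) h

theorem wordTiles_flow_self {S : Hull J x} {w : List (Fin 2)} {d : ℝ}
    (h : wordTiles J w d ⊆ S.tiles) : wordTiles J w 0 ⊆ (flow d S).tiles := by
  simpa using wordTiles_flow h d

/-- A spacer after a block costs at most `M * (J 1).length` in the integral and as much again in the
prediction `α / blockLength J n * c`; hence the term `2 * M * (J 1).length` per block. -/
theorem chain_estimate (hG : Continuous G) (hM : ∀ S, |G S| ≤ M) {n : ℕ} {α β : ℝ}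
    (hα : |α| ≤ M * blockLength J n) (hβ : 0 ≤ β)
    (H : ∀ S : Hull J x, wordTiles J (jrBlock n) 0 ⊆ S.tiles →
      |(∫ u in 0..blockLength J n, G (flow u S)) - α| ≤ β)
    (S : Hull J x) {d e : ℝ} (hc : BlockChain J n S.tiles d e) :
    |(∫ u in d..e, G (flow u S)) - α / blockLength J n * (e - d)| ≤
      (β + 2 * M * (J 1).length) / blockLength J n * (e - d) := by
  have hs := (J 1).length_pos
  have hh := blockLength_pos (J := J) n
  have hM0 : 0 ≤ M := (abs_nonneg _).trans (hM S)
  induction hc with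
  | refl => simp
  | step hch hb hc ih =>
    rename_i e c
    have hc0 : 0 ≤ c := by rcases hc with rfl | rfl <;> linarith
    have hcs : c ≤ (J 1).length := by rcases hc with rfl | rfl <;> linarith
    have h1 := H _ (wordTiles_flow_self hb)
    rw [← integral_orbit_shift, add_zero] at h1
    have h2 := abs_integral_orbit_le hM S (a := e + blockLength J n)
      (b := e + blockLength J n + c) (by linarith)
    have h3 : |α / blockLength J n * c| ≤ M * c := by
      rw [abs_mul, abs_div, abs_of_pos hh, abs_of_nonneg hc0]
      gcongr
      rwa [div_le_iff₀ hh]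
    rw [integral_orbit_add hG S d e, integral_orbit_add hG S e (e + blockLength J n)]
    have h4 : α / blockLength J n * (e + blockLength J n + c - d) =
        α / blockLength J n * (e - d) + α + α / blockLength J n * c := by field_simp; ring
    have h5 : (β + 2 * M * (J 1).length) / blockLength J n * (e + blockLength J n + c - d) =
        (β + 2 * M * (J 1).length) / blockLength J n * (e - d) + (β + 2 * M * (J 1).length) +
        (β + 2 * M * (J 1).length) / blockLength J n * c := by field_simp; ring
    have h6 : 0 ≤ (β + 2 * M * (J 1).length) / blockLength J n * c := by positivity
    have h7 : M * c ≤ M * (J 1).length := by gcongr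
    rw [h4, h5]
    rw [abs_le] at *
    constructor <;> linarith

/-- A chain fills the window except for two ends, each no longer than a block and a spacer. They are
counted in the integral and in the prediction, which gives the factor `4`. -/
theorem window_estimate (hJ : Function.Injective fun a => (J a).length) (hx : x ∈ jrSubshift)
    (hG : Continuous G) (hM : ∀ S, |G S| ≤ M) {n : ℕ} {α β : ℝ}
    (hα : |α| ≤ M * blockLength J n) (hβ : 0 ≤ β)
    (H : ∀ S : Hull J x, wordTiles J (jrBlock n) 0 ⊆ S.tiles →
      |(∫ u in 0..blockLength J n, G (flow u S)) - α| ≤ β)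
    (S : Hull J x) {L : ℝ} (hL : 2 * (blockLength J n + (J 1).length) ≤ L) :
    |(∫ u in 0..L, G (flow u S)) - α / blockLength J n * L| ≤
      (β + 2 * M * (J 1).length) / blockLength J n * L +
        4 * M * (blockLength J n + (J 1).length) := by
  have hs := (J 1).length_pos
  have hh := blockLength_pos (J := J) n
  have hM0 : 0 ≤ M := (abs_nonneg _).trans (hM S)
  obtain ⟨q, r, hq, hq', hr, hr', hch⟩ :=
    TilingSpace.exists_blockChain hJ hx S n (a := 0) (b := L) (by linarith)
  have h1 := chain_estimate hG hM hα hβ H S hch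
  have h2 := abs_integral_orbit_le hM S hq
  have h3 := abs_integral_orbit_le hM S hr'
  have hqr := hch.le
  rw [integral_orbit_add hG S 0 q, integral_orbit_add hG S q r]
  have h4 : |α / blockLength J n| ≤ M := by
    rw [abs_div, abs_of_pos hh]
    rwa [div_le_iff₀ hh]
  have h5 : |α / blockLength J n * (q + (L - r))| ≤ M * (q + (L - r)) := by
    rw [abs_mul, abs_of_nonneg (show 0 ≤ q + (L - r) by linarith)]
    exact mul_le_mul_of_nonneg_right h4 (by linarith)
  have h6 : α / blockLength J n * L =
    α / blockLength J n * (r - q) + α / blockLength J n * (q + (L - r)) := by ring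
  have h7 : M * (q + (L - r)) ≤ M * (2 * (blockLength J n + (J 1).length)) := by
    gcongr; linarith
  have h8 : (β + 2 * M * (J 1).length) / blockLength J n * (r - q) ≤
      (β + 2 * M * (J 1).length) / blockLength J n * L := by
    gcongr; linarith
  rw [h6]
  rw [abs_le] at *
  constructor <;> linarith

/-- Fubini and invariance of `ν` turn orbit integrals into the mean of `G`. -/
theorem integral_window (hG : Continuous G) (hM : ∀ S, |G S| ≤ M) (ν : Measure (Hull J x))
    [IsProbabilityMeasure ν] (hν : ∀ t, MeasurePreserving (flow t) ν ν) {L : ℝ} (hL : 0 ≤ L) :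
    Integrable (fun S => ∫ u in 0..L, G (flow u S)) ν ∧
      ∫ S, (∫ u in 0..L, G (flow u S)) ∂ν = L * ∫ S, G S ∂ν := by
  have hint : Integrable (Function.uncurry fun (S : Hull J x) (u : ℝ) => G (flow u S))
      (ν.prod (volume.restrict (Set.Ioc 0 L))) :=
    .of_bound (hG.comp continuous_flow_uncurry).aestronglyMeasurable M (ae_of_all _ fun p => hM _)
  simp only [intervalIntegral.integral_of_le hL]
  refine ⟨hint.integral_prod_left, ?_⟩
  rw [integral_integral_swap hint]
  have : ∀ u, ∫ S, G (flow u S) ∂ν = ∫ S, G S ∂ν := fun u => by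
    have h := (hν u).map_eq
    conv_rhs => rw [← h]
    rw [integral_map (hν u).measurable.aemeasurable hG.aestronglyMeasurable]
  simp [this, hL]

/-- If the integrals of `G` along the blocks of level `n` are close to `α`, then the mean of `G`
is close to `α` divided by the length of the block. -/
theorem abs_integral_sub_le (hJ : Function.Injective fun a => (J a).length) (hx : x ∈ jrSubshift)
    (ν : Measure (Hull J x)) [IsProbabilityMeasure ν] (hν : ∀ t, MeasurePreserving (flow t) ν ν)
    (hG : Continuous G) (hM : ∀ S, |G S| ≤ M) {n : ℕ} {α β : ℝ}
    (hα : |α| ≤ M * blockLength J n) (hβ : 0 ≤ β)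
    (H : ∀ S : Hull J x, wordTiles J (jrBlock n) 0 ⊆ S.tiles →
      |(∫ u in 0..blockLength J n, G (flow u S)) - α| ≤ β) :
    |∫ S, G S ∂ν - α / blockLength J n| ≤ (β + 2 * M * (J 1).length) / blockLength J n := by
  have hs := (J 1).length_pos
  have hh := blockLength_pos (J := J) n
  obtain ⟨S₀⟩ : Nonempty (Hull J x) := nonempty_of_isProbabilityMeasure ν
  have hM0 : 0 ≤ M := (abs_nonneg _).trans (hM S₀)
  refine le_of_forall_pos_le_add fun ε hε => ?_
  set C := 4 * M * (blockLength J n + (J 1).length) with hC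
  have hC0 : 0 ≤ C := by positivity
  -- The window is so long that the error `C` from its ends is at most `ε * L`.
  set L := 2 * (blockLength J n + (J 1).length) + C / ε with hL
  have hL0 : 0 < L := by positivity
  obtain ⟨h1, h2⟩ := integral_window hG hM ν hν hL0.le
  have h3 : |∫ S, ((∫ u in 0..L, G (flow u S)) - α / blockLength J n * L) ∂ν| ≤
      (β + 2 * M * (J 1).length) / blockLength J n * L + C := by
    have := norm_integral_le_of_norm_le_const (μ := ν)
      (f := fun S => (∫ u in 0..L, G (flow u S)) - α / blockLength J n * L) (ae_of_all _ fun S =>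
      window_estimate hJ hx hG hM hα hβ H S (L := L) (le_add_of_nonneg_right (by positivity)))
    simpa using this
  rw [integral_sub h1 (integrable_const _), h2] at h3
  simp only [integral_const, probReal_univ, one_smul] at h3
  rw [show L * ∫ S, G S ∂ν - α / blockLength J n * L =
    (∫ S, G S ∂ν - α / blockLength J n) * L by ring, abs_mul, abs_of_pos hL0] at h3
  have h4 : C ≤ ε * L := by
    rw [hL, mul_add, mul_div_cancel₀ _ hε.ne']
    have : 0 ≤ ε * (2 * (blockLength J n + (J 1).length)) := by positivity
    linarith
  refine le_of_mul_le_mul_right (h3.trans ?_) hL0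
  linarith

/-- The last block of a run need not be followed directly by another, so `H` may fail for it. It
costs at most `M * blockLength J n` in the integral and the same through `α`. -/
theorem run_estimate (hG : Continuous G) (hM : ∀ S, |G S| ≤ M) {n : ℕ} {α β : ℝ}
    (hα : |α| ≤ M * blockLength J n) (hβ : 0 ≤ β)
    (H : ∀ S : Hull J x, wordTiles J (jrBlock n) 0 ⊆ S.tiles →
      wordTiles J (jrBlock n) (blockLength J n) ⊆ S.tiles →
      |(∫ u in 0..blockLength J n, G (flow u S)) - α| ≤ β) (k : ℕ) (S : Hull J x) (d : ℝ)
    (hS : wordTiles J (List.replicate k (jrBlock n)).flatten d ⊆ S.tiles) :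
    |(∫ u in d..(d + k * blockLength J n), G (flow u S)) - k * α| ≤
      k * β + 2 * M * blockLength J n := by
  have hh := blockLength_pos (J := J) n
  have hM0 : 0 ≤ M := (abs_nonneg _).trans (hM S)
  induction k generalizing d with
  | zero => simp; positivity
  | succ k ih =>
    rw [List.replicate_succ, List.flatten_cons, wordTiles_append, Set.union_subset_iff] at hS
    have h1 := ih _ hS.2
    rcases k with _ | k
    · have := abs_integral_orbit_le hM S (a := d) (b := d + blockLength J n) (by linarith)
      simp only [zero_add, Nat.cast_one, one_mul] at *
      rw [abs_le] at *
      constructor <;> linarith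
    · have h2 := H (flow d S) (wordTiles_flow_self hS.1) (by
        have h3 := hS.2
        rw [List.replicate_succ, List.flatten_cons, wordTiles_append, Set.union_subset_iff] at h3
        have := wordTiles_flow h3.1 d
        rwa [add_sub_cancel_left] at this)
      rw [← integral_orbit_shift, add_zero] at h2
      rw [integral_orbit_add hG S d (d + blockLength J n)]
      change |(∫ u in (d + blockLength J n)..(d + blockLength J n + (k + 1 : ℕ) * blockLength J n),
        G (flow u S)) - _| ≤ _ at h1
      rw [show d + ((k + 1 + 1 : ℕ) : ℝ) * blockLength J n =
        d + blockLength J n + (k + 1 : ℕ) * blockLength J n by push_cast; ring]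
      push_cast at *
      rw [abs_le] at *
      constructor <;> linarith

theorem length_one_le_blockLength (n : ℕ) : (J 1).length ≤ blockLength J n := by
  cases n with
  | zero =>
    have := (J 0).length_pos
    simp [blockLength, jrBlock]; linarith
  | succ n =>
    rw [blockLength_succ]
    have := blockLength_pos (J := J) n
    have : 0 ≤ 2 ^ (n + 2) * blockLength J n := by positivity
    linarith

theorem two_pow_mul_blockLength_le (n : ℕ) :
    2 ^ (n + 2) * blockLength J n ≤ blockLength J (n + 1) := by
  rw [blockLength_succ]; linarith [(J 1).length_pos]

/-- The mean of `G` can be computed from the blocks of level `n` that are followed directly by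
another block. -/
theorem abs_integral_sub_le_of_pair (hJ : Function.Injective fun a => (J a).length)
    (hx : x ∈ jrSubshift) (ν : Measure (Hull J x)) [IsProbabilityMeasure ν]
    (hν : ∀ t, MeasurePreserving (flow t) ν ν)
    (hG : Continuous G) (hM : ∀ S, |G S| ≤ M) {n : ℕ} {α β : ℝ}
    (hα : |α| ≤ M * blockLength J n) (hβ : 0 ≤ β)
    (H : ∀ S : Hull J x, wordTiles J (jrBlock n) 0 ⊆ S.tiles →
      wordTiles J (jrBlock n) (blockLength J n) ⊆ S.tiles →
      |(∫ u in 0..blockLength J n, G (flow u S)) - α| ≤ β) :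
    |∫ S, G S ∂ν - α / blockLength J n| ≤ β / blockLength J n + 2 * M / 2 ^ n := by
  have hs := (J 1).length_pos
  have hh := blockLength_pos (J := J) n
  have hh' := blockLength_pos (J := J) (n + 1)
  have hsh := length_one_le_blockLength (J := J) n
  obtain ⟨S₀⟩ : Nonempty (Hull J x) := nonempty_of_isProbabilityMeasure ν
  have hM0 : 0 ≤ M := (abs_nonneg _).trans (hM S₀)
  set K : ℝ := 2 ^ (n + 1) with hK
  have hK0 : 0 < K := by positivity
  have hlen : blockLength J (n + 1) = 2 * K * blockLength J n + (J 1).length := by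
    rw [blockLength_succ, hK]; ring
  -- In a block of level `n + 1` each of the two runs loses its last block, which gives `4 * M *
  -- blockLength J n`; the spacer between them gives the remaining term.
  have key := abs_integral_sub_le hJ hx ν hν hG hM (n := n + 1) (α := 2 * K * α)
    (β := 2 * K * β + 4 * M * blockLength J n + M * (J 1).length) ?_ (by positivity) ?_
  · have h1 : |2 * K * α / blockLength J (n + 1) - α / blockLength J n| ≤
        M * (J 1).length / blockLength J (n + 1) := by
      rw [show 2 * K * α / blockLength J (n + 1) - α / blockLength J n =
        -(α / blockLength J n) * (J 1).length / blockLength J (n + 1) by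
          rw [hlen] at hh' ⊢; field_simp; ring]
      rw [abs_div, abs_mul, abs_neg, abs_div, abs_of_pos hh, abs_of_pos hs, abs_of_pos hh']
      gcongr
      rwa [div_le_iff₀ hh]
    refine (abs_sub_le _ _ _).trans ((add_le_add key h1).trans ?_)
    rw [← add_div, div_le_iff₀ hh', add_mul]
    have h2 : 2 * K * β ≤ β / blockLength J n * blockLength J (n + 1) := by
      rw [hlen, mul_add, div_mul_eq_mul_div]
      have : β * (2 * K * blockLength J n) / blockLength J n = 2 * K * β := by field_simp
      rw [this]
      have : 0 ≤ β / blockLength J n * (J 1).length := by positivity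
      linarith
    -- Besides the terms in `β`, the errors add up to `4 * M * (blockLength J n + (J 1).length)`,
    -- and a spacer is no longer than a block.
    have h3 : 8 * M * blockLength J n ≤ 2 * M / 2 ^ n * blockLength J (n + 1) := by
      calc 8 * M * blockLength J n = 2 * M / 2 ^ n * (2 ^ (n + 2) * blockLength J n) := by
            field_simp; ring
        _ ≤ _ := by
          have := two_pow_mul_blockLength_le (J := J) n
          gcongr
    have h4 : M * (J 1).length ≤ M * blockLength J n := by gcongr
    linarith
  · rw [abs_mul, abs_of_pos (by positivity), hlen]
    calc 2 * K * |α| ≤ 2 * K * (M * blockLength J n) := by gcongr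
      _ ≤ _ := by
        have : 0 ≤ M * (J 1).length := by positivity
        linarith
  · intro S hS
    simp only [jrBlock, wordTiles_append, Set.union_subset_iff, wordLength_append,
      wordLength_flatten_replicate, wordLength_cons, wordLength_nil, add_zero, zero_add] at hS
    have h1 := run_estimate hG hM hα hβ H _ _ _ hS.1.1
    have h2 := run_estimate hG hM hα hβ H _ _ _ hS.2
    rw [← blockLength] at h2
    push_cast at h1 h2
    rw [← hK, zero_add] at h1
    rw [← hK] at h2
    have h3 := abs_integral_orbit_le hM S (a := K * blockLength J n)
      (b := K * blockLength J n + (J 1).length) (by linarith)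
    rw [integral_orbit_add hG S 0 (K * blockLength J n), integral_orbit_add hG S
      (K * blockLength J n) (K * blockLength J n + (J 1).length),
      show blockLength J (n + 1) = K * blockLength J n + (J 1).length + K * blockLength J n by
        rw [hlen]; ring]
    rw [abs_le] at *
    constructor <;> linarith

end Orbits

/-! ### Local functions along blocks and unique ergodicity -/

section Local

variable {J : Fin 2 → Tile} {x : ℤ → Fin 2} {f : Hull J x → ℝ}

/-- Along two copies of a long block a local function takes almost the same values. -/
theorem eventually_compare (hf : IsLocal f) {ε : ℝ} (hε : 0 < ε) : ∀ᶠ n in atTop,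
    ∀ S S' : Hull J x, wordTiles J (jrBlock n) 0 ⊆ S.tiles → wordTiles J (jrBlock n) 0 ⊆ S'.tiles →
      ∫ u in 0..blockLength J n, |f (flow u S) - f (flow u S')| ≤ ε * blockLength J n := by
  obtain ⟨M, hM⟩ := hf.bounded
  obtain ⟨R, hR, h⟩ := hf.approx (ε / 2) (by linarith)
  -- Away from ends of length `R` the two tilings agree on the ball of radius `R`. The ends
  -- contribute at most `4 * R * |M|`, which this bound makes at most half of the allowed error.
  filter_upwards [tendsto_blockLength.eventually_ge_atTop (2 * R + 8 * R * |M| / ε)] with n hn S S' hS hS'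
  have hh := blockLength_pos (J := J) n
  have hcont : Continuous fun u => |f (flow u S) - f (flow u S')| :=
    ((hf.continuous.comp (continuous_flow_left S)).sub
      (hf.continuous.comp (continuous_flow_left S'))).abs
  have h8 : 0 ≤ 8 * R * |M| / ε := by positivity
  have hb : ∀ a b, a ≤ b → ∫ u in a..b, |f (flow u S) - f (flow u S')| ≤ 2 * |M| * (b - a) := by
    intro a b hab
    have := intervalIntegral.norm_integral_le_of_norm_le_const (a := a) (b := b)
      (f := fun u => |f (flow u S) - f (flow u S')|) (C := 2 * |M|) fun u _ => by
        rw [Real.norm_eq_abs, abs_abs]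
        refine (abs_sub _ _).trans ?_
        have := hM (flow u S); have := hM (flow u S'); have := le_abs_self M
        linarith
    rw [abs_of_nonneg (sub_nonneg.2 hab)] at this
    exact (le_abs_self _).trans this
  have hmid : ∫ u in R..(blockLength J n - R), |f (flow u S) - f (flow u S')| ≤
      ε / 2 * (blockLength J n - R - R) := by
    have := intervalIntegral.norm_integral_le_of_norm_le_const (a := R) (b := blockLength J n - R)
      (f := fun u => |f (flow u S) - f (flow u S')|) (C := ε / 2) fun u hu => by
        rw [Set.uIoc_of_le (by linarith)] at hu
        rw [Real.norm_eq_abs, abs_abs]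
        refine h _ _ (agreeOn_of_wordTiles (innerDisjoint _) (innerDisjoint _)
          (wordTiles_flow hS u) (wordTiles_flow hS' u) (by linarith [hu.1]) ?_)
        have := hu.2
        rw [← blockLength]; linarith
    rw [abs_of_nonneg (by linarith)] at this
    exact (le_abs_self _).trans this
  have h1 := hb 0 R hR.le
  have h2 := hb (blockLength J n - R) (blockLength J n) (by linarith)
  rw [← intervalIntegral.integral_add_adjacent_intervals (b := R) (hcont.intervalIntegrable _ _)
      (hcont.intervalIntegrable _ _),
    ← intervalIntegral.integral_add_adjacent_intervals (a := R) (b := blockLength J n - R)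
      (hcont.intervalIntegrable _ _) (hcont.intervalIntegrable _ _)]
  have h9 : 8 * R * |M| ≤ ε * blockLength J n := by
    rw [← div_le_iff₀' hε]; linarith
  nlinarith

/-- The form used for rigidity and correlations: two copies of a block in one tiling, at an
arbitrary distance `e`. -/
theorem eventually_compare_shift (hf : IsLocal f) {ε : ℝ} (hε : 0 < ε) : ∀ᶠ n in atTop,
    ∀ (S : Hull J x) (d e : ℝ), wordTiles J (jrBlock n) d ⊆ S.tiles →
      wordTiles J (jrBlock n) (d + e) ⊆ S.tiles →
      ∫ u in d..(d + blockLength J n), |f (flow (u + e) S) - f (flow u S)| ≤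
        ε * blockLength J n := by
  filter_upwards [eventually_compare hf hε] with n hn S d e h h'
  have := hn _ _ (wordTiles_flow_self h') (wordTiles_flow_self h)
  simp only [← flow_add] at this
  have h2 := intervalIntegral.integral_comp_add_right (a := 0) (b := blockLength J n)
    (fun u => |f (flow (u + e) S) - f (flow u S)|) d
  rw [zero_add, add_comm (blockLength J n)] at h2
  rw [← h2]
  simpa only [add_assoc] using this

/-- Along every long block the mean of a local function is close to its integral. -/
theorem eventually_block_mean (hJ : Function.Injective fun a => (J a).length) (hx : x ∈ jrSubshift)
    (ν : Measure (Hull J x)) [IsProbabilityMeasure ν] (hν : ∀ t, MeasurePreserving (flow t) ν ν)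
    (hf : IsLocal f) {ε : ℝ} (hε : 0 < ε) : ∀ᶠ n in atTop, ∀ (S : Hull J x) (d : ℝ),
    wordTiles J (jrBlock n) d ⊆ S.tiles →
      |(∫ u in d..(d + blockLength J n), f (flow u S)) - blockLength J n * ∫ S, f S ∂ν| ≤
        ε * blockLength J n := by
  obtain ⟨M, hM⟩ := hf.bounded
  have hs := (J 1).length_pos
  filter_upwards [eventually_compare hf (half_pos hε),
    tendsto_blockLength.eventually_ge_atTop (4 * M * (J 1).length / ε)] with n hn hn' S d hS
  have hh := blockLength_pos (J := J) n
  have hM0 : 0 ≤ M := (abs_nonneg _).trans (hM S)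
  have hS' := wordTiles_flow_self hS
  -- The integral along the given block itself plays the role of `α`; `hn` compares every other copy
  -- with it, and `hn'` absorbs the spacers.
  have key := abs_integral_sub_le hJ hx ν hν hf.continuous hM (n := n)
    (α := ∫ u in d..(d + blockLength J n), f (flow u S)) (β := ε / 2 * blockLength J n) ?_
    (by positivity) ?_
  · rw [div_le_iff₀ hε] at hn'
    rw [abs_sub_comm, le_div_iff₀ hh] at key
    rw [show (∫ u in d..(d + blockLength J n), f (flow u S)) - blockLength J n * ∫ S, f S ∂ν =
      ((∫ u in d..(d + blockLength J n), f (flow u S)) / blockLength J n - ∫ S, f S ∂ν) *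
        blockLength J n by field_simp, abs_mul, abs_of_pos hh]
    linarith
  · exact (abs_integral_orbit_le hM S (by linarith)).trans (by rw [add_sub_cancel_left])
  · intro S' hS''
    have h1 := integral_orbit_shift f S 0 (blockLength J n) d
    rw [add_zero] at h1
    rw [h1, ← intervalIntegral.integral_sub (intervalIntegrable_orbit hf.continuous _ _ _)
      (intervalIntegrable_orbit hf.continuous _ _ _)]
    exact (intervalIntegral.abs_integral_le_integral_abs hh.le).trans (hn _ _ hS'' hS')

/-- Both means are close to the average along one and the same block of one tiling, a quantity that
involves no measure. -/
theorem invariant_unique (hJ : Function.Injective fun a => (J a).length) (hx : x ∈ jrSubshift)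
    (ν ν' : Measure (Hull J x)) [IsProbabilityMeasure ν] [IsProbabilityMeasure ν']
    (hν : ∀ t, MeasurePreserving (flow t) ν ν) (hν' : ∀ t, MeasurePreserving (flow t) ν' ν') :
    ν = ν' := by
  refine measure_ext_of_isLocal fun f hf => eq_of_forall_dist_le fun ε hε => ?_
  obtain ⟨n, h1, h2⟩ := ((eventually_block_mean hJ hx ν hν hf (half_pos hε)).and
    (eventually_block_mean hJ hx ν' hν' hf (half_pos hε))).exists
  obtain ⟨S, hS⟩ := exists_block_at_zero (J := J) hx n
  have hh := blockLength_pos (J := J) n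
  have h3 := h1 S 0 hS
  have h4 := h2 S 0 hS
  rw [Real.dist_eq]
  refine le_of_mul_le_mul_left ?_ hh
  rw [← abs_of_pos hh, ← abs_mul, abs_of_pos hh]
  rw [abs_le] at *
  constructor <;> linarith

end Local

end Hull

namespace Hull

open TilingSpace

/-! ### Existence of an invariant measure -/

section Existence

variable {J : Fin 2 → Tile} {x : ℤ → Fin 2}

theorem isClosed_jrSubshift : IsClosed jrSubshift := by
  have : jrSubshift = ⋂ (i : ℤ) (m : ℕ), (fun (y : ℤ → Fin 2) (k : Fin m) => y (i + (k : ℕ))) ⁻¹'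
      {w | ∃ n, List.ofFn w <:+: jrBlock n} := by
    ext y
    simp [jrSubshift]
  rw [this]
  refine isClosed_iInter fun i => isClosed_iInter fun m => ?_
  exact (isClosed_discrete _).preimage (continuous_pi fun k => continuous_apply _)

instance : CompactSpace jrSubshift := isCompact_iff_compactSpace.1 isClosed_jrSubshift.isCompact

theorem shift_mem_jrSubshift {y : ℤ → Fin 2} (hy : y ∈ jrSubshift) (i : ℤ) :
    (fun j => y (i + j)) ∈ jrSubshift := fun j m => by
  simpa only [add_assoc] using hy (i + j) m

theorem tilePos_shift (y : ℤ → Fin 2) (i j : ℤ) :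
    tilePos J (fun k => y (i + k)) j = tilePos J y (i + j) - tilePos J y i := by
  induction j using Int.induction_on with
  | zero => simp [tilePos_zero]
  | succ j ih => rw [tilePos_add_one, ih, ← add_assoc, tilePos_add_one]; ring
  | pred j ih =>
    have h1 := tilePos_add_one (J := J) (fun k => y (i + k)) (-j - 1)
    have h2 := tilePos_add_one (J := J) y (i + (-j - 1))
    rw [show (-(j : ℤ) - 1 + 1) = -j by ring] at h1
    rw [show i + (-(j : ℤ) - 1) + 1 = i + -j by ring] at h2
    linarith

theorem seqTiling_shift (y : ℤ → Fin 2) (i : ℤ) :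
    seqTiling J (fun k => y (i + k)) = translateTiles (seqTiling J y) (-tilePos J y i) := by
  have key : ∀ j, seqTile J (fun k => y (i + k)) j =
      (seqTile J y (i + j)).translate (-tilePos J y i) := fun j => by
    rw [seqTile_eq, seqTile_eq, tileAt_translate, tilePos_shift, sub_eq_add_neg]
  ext I
  constructor
  · rintro ⟨j, rfl⟩
    exact ⟨_, ⟨i + j, rfl⟩, (key j).symm⟩
  · rintro ⟨_, ⟨j, rfl⟩, rfl⟩
    exact ⟨j - i, by rw [key]; congr 2; ring⟩

/-- Tile number `0` starts at the origin, so sequences that agree on a long range of indices around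
`0` give the same tiles there. -/
theorem continuous_tilingOf (hx : x ∈ jrSubshift) :
    Continuous fun y : jrSubshift => tilingOf (J := J) hx y y.2 := by
  refine continuous_iff_continuousAt.2 fun y => tendsto_of_tilingDist fun r hr => ?_
  obtain ⟨m, hm⟩ := exists_tilePos_lt (J := J) y (-(1 / r))
  obtain ⟨k, hk⟩ := exists_lt_tilePos (J := J) y (1 / r)
  have hev : ∀ᶠ y' : jrSubshift in 𝓝 y, ∀ i ∈ Finset.Ico (-(m : ℤ)) k, y'.1 i = y.1 i := by
    refine (Filter.eventually_all_finset _).2 fun i _ => ?_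
    exact ((continuous_apply i).comp continuous_subtype_val).continuousAt.eventually_mem
      ((isOpen_discrete {y.1 i}).mem_nhds rfl)
  filter_upwards [hev] with y' hy'
  have hfac : ∀ l : ℕ, l ≤ m + k → factor y'.1 (-m) l = factor y.1 (-m) l := by
    intro l hl
    simp only [factor]
    congr 1
    ext1 j
    exact hy' _ (Finset.mem_Ico.2 ⟨by omega, by have := j.2; omega⟩)
  have hpos : tilePos J y'.1 (-m) = tilePos J y.1 (-m) := by
    have h1 := wordLength_factor (J := J) y'.1 (-m) m
    have h2 := wordLength_factor (J := J) y.1 (-m) m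
    rw [neg_add_cancel, tilePos_zero] at h1 h2
    rw [hfac m (by omega)] at h1
    linarith
  have hlen := wordLength_factor (J := J) y.1 (-m) (m + k)
  rw [Nat.cast_add, neg_add_cancel_left] at hlen
  have h1 := wordTiles_factor_subset (J := J) y.1 (-m) (m + k)
  have h2 := wordTiles_factor_subset (J := J) y'.1 (-m) (m + k)
  rw [hfac _ le_rfl, hpos] at h2
  have := tilingDist_le_of_agreeOn (R := 1 / r) (by positivity)
    (agreeOn_of_wordTiles (innerDisjoint_seqTiling (J := J) y.1) (innerDisjoint_seqTiling y'.1) h1 h2 hm.le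
      (by linarith))
  rwa [one_div_one_div] at this

/-- The number of the tile that covers a given point. -/
noncomputable def tileIndex (J : Fin 2 → Tile) (x : ℤ → Fin 2) (u : ℝ) : ℤ :=
  (exists_tilePos_le_lt (J := J) x u).choose

theorem tilePos_tileIndex_le (u : ℝ) : tilePos J x (tileIndex J x u) ≤ u :=
  (exists_tilePos_le_lt (J := J) x u).choose_spec.1

theorem lt_tilePos_tileIndex (u : ℝ) : u < tilePos J x (tileIndex J x u + 1) :=
  (exists_tilePos_le_lt (J := J) x u).choose_spec.2

theorem measurable_tileIndex : Measurable (tileIndex J x) := by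
  refine Monotone.measurable fun u v huv => ?_
  have := (tilePos_strictMono (J := J) x).lt_iff_lt.1
    ((tilePos_tileIndex_le (x := x) u).trans_lt (huv.trans_lt (lt_tilePos_tileIndex v)))
  omega

/-- Pairs of a sequence and a position relative to its tile number `0`. -/
abbrev Suspension (J : Fin 2 → Tile) : Type :=
  jrSubshift × Set.Icc (0 : ℝ) (max (J 0).length (J 1).length)

/-- The tiling that a point of the suspension gives. -/
noncomputable def ofSuspension (hx : x ∈ jrSubshift) (p : Suspension J) : Hull J x :=
  flow (p.2 : ℝ) (tilingOf hx p.1 p.1.2)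

theorem continuous_ofSuspension (hx : x ∈ jrSubshift) :
    Continuous (ofSuspension (J := J) hx) :=
  continuous_flow_uncurry.comp (((continuous_tilingOf hx).comp continuous_fst).prodMk
    (continuous_subtype_val.comp continuous_snd))

/-- The lift to the suspension of the orbit of the tiling of `x`. -/
noncomputable def orbitLift (J : Fin 2 → Tile) (hx : x ∈ jrSubshift) (u : ℝ) : Suspension J :=
  (⟨fun j => x (tileIndex J x u + j), shift_mem_jrSubshift hx _⟩,
    ⟨u - tilePos J x (tileIndex J x u), sub_nonneg.2 (tilePos_tileIndex_le u), by
      have h1 := lt_tilePos_tileIndex (J := J) (x := x) u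
      rw [tilePos_add_one] at h1
      have h2 : (J (x (tileIndex J x u))).length ≤ max (J 0).length (J 1).length := by
        generalize x (tileIndex J x u) = a
        fin_cases a
        · exact le_max_left _ _
        · exact le_max_right _ _
      linarith⟩)

/-- The lift jumps at the ends of tiles, but measurability suffices to push orbit segments forward
to the suspension. -/
theorem measurable_orbitLift (hx : x ∈ jrSubshift) : Measurable (orbitLift J hx) := by
  refine Measurable.prodMk (Measurable.subtype_mk ?_) (Measurable.subtype_mk ?_)
  · exact measurable_pi_lambda _ fun j =>
      (Measurable.of_discrete (f := fun i => x (i + j))).comp measurable_tileIndex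
  · exact measurable_id.sub
      ((Measurable.of_discrete (f := fun i => tilePos J x i)).comp measurable_tileIndex)

theorem ofSuspension_orbitLift (hx : x ∈ jrSubshift) (u : ℝ) :
    ofSuspension hx (orbitLift J hx u) = flow u (tilingOf hx x hx) := by
  refine ext_tiles ?_
  simp only [ofSuspension, orbitLift, flow, tilingOf]
  rw [seqTiling_shift, translateTiles_translateTiles]
  congr 1; ring

/-- The empirical measure of an orbit segment on the suspension. -/
noncomputable def empirical (J : Fin 2 → Tile) (hx : x ∈ jrSubshift) (N : ℕ) :
    ProbabilityMeasure (Suspension J) :=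
  ⟨(ProbabilityTheory.cond volume (Set.Ioc (0 : ℝ) (N + 1))).map (orbitLift J hx), by
    have : IsProbabilityMeasure (ProbabilityTheory.cond volume (Set.Ioc (0 : ℝ) (N + 1))) := by
      refine ProbabilityTheory.cond_isProbabilityMeasure_of_finite ?_ ?_
      · simp; positivity
      · simp
    exact Measure.isProbabilityMeasure_map (measurable_orbitLift hx).aemeasurable⟩

theorem integral_empirical (hx : x ∈ jrSubshift) (N : ℕ) {F : Hull J x → ℝ} (hF : Continuous F) :
    ∫ p, F (ofSuspension hx p) ∂(empirical J hx N : Measure (Suspension J)) =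
      (N + 1 : ℝ)⁻¹ * ∫ u in 0..(N + 1 : ℝ), F (flow u (tilingOf hx x hx)) := by
  have hN : (0 : ℝ) ≤ N + 1 := by positivity
  simp only [empirical, ProbabilityMeasure.coe_mk]
  rw [integral_map (f := fun p => F (ofSuspension hx p)) (measurable_orbitLift hx).aemeasurable
    (hF.comp (continuous_ofSuspension hx)).aestronglyMeasurable]
  simp only [ofSuspension_orbitLift]
  rw [ProbabilityTheory.cond, integral_smul_measure, intervalIntegral.integral_of_le hN]
  simp [hN]

/-- Krylov–Bogolyubov. Limits are taken on the suspension, a compact space, and pushed to the hull;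
invariance only has to be tested on local functions. -/
theorem exists_invariant (hx : x ∈ jrSubshift) : ∃ ν : Measure (Hull J x),
    IsProbabilityMeasure ν ∧ ∀ t, MeasurePreserving (flow t) ν ν := by
  obtain ⟨μ, -, hμ⟩ := isCompact_univ.ultrafilter_le_nhds'
    ((hyperfilter ℕ).map (empirical J hx)) univ_mem
  have hμ' : Tendsto (empirical J hx) (hyperfilter ℕ) (𝓝 μ) := hμ
  rw [ProbabilityMeasure.tendsto_iff_forall_integral_tendsto] at hμ'
  have hφ := continuous_ofSuspension (J := J) hx
  have key : ∀ F : Hull J x → ℝ, IsLocal F → Tendsto (fun N : ℕ => (N + 1 : ℝ)⁻¹ *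
      ∫ u in 0..(N + 1 : ℝ), F (flow u (tilingOf hx x hx))) (hyperfilter ℕ)
      (𝓝 (∫ S, F S ∂((μ : Measure (Suspension J)).map (ofSuspension hx)))) := by
    intro F hF
    obtain ⟨M, hM⟩ := hF.bounded
    rw [integral_map hφ.measurable.aemeasurable hF.continuous.aestronglyMeasurable]
    have := hμ' (BoundedContinuousFunction.ofNormedAddCommGroup (fun p => F (ofSuspension hx p))
      (hF.continuous.comp hφ) M fun p => hM _)
    refine this.congr fun N => ?_
    exact integral_empirical hx N hF.continuous
  refine ⟨(μ : Measure (Suspension J)).map (ofSuspension hx),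
    Measure.isProbabilityMeasure_map hφ.measurable.aemeasurable, fun t => ?_⟩
  have hprob : IsProbabilityMeasure ((μ : Measure (Suspension J)).map (ofSuspension hx)) :=
    Measure.isProbabilityMeasure_map hφ.measurable.aemeasurable
  have hflow := continuous_flow (𝒯 := seqTiling J x) t
  refine ⟨hflow.measurable, ?_⟩
  have hprob' := Measure.isProbabilityMeasure_map
    (μ := (μ : Measure (Suspension J)).map (ofSuspension hx)) hflow.measurable.aemeasurable
  refine measure_ext_of_isLocal fun F hF => ?_
  rw [integral_map hflow.measurable.aemeasurable hF.continuous.aestronglyMeasurable]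
  refine tendsto_nhds_unique (key _ (hF.comp_flow t)) ?_
  obtain ⟨M, hM⟩ := hF.bounded
  -- Moving an orbit segment by `t` changes its integral only by two end pieces of length `|t|`.
  have hlim : Tendsto (fun N : ℕ => (N + 1 : ℝ)⁻¹ * (2 * M * |t|)) (hyperfilter ℕ) (𝓝 0) := by
    have h := (tendsto_one_div_add_atTop_nhds_zero_nat (𝕜 := ℝ)).mul_const (2 * M * |t|)
    simp only [one_div, zero_mul] at h
    exact h.mono_left Nat.hyperfilter_le_atTop
  refine (tendsto_iff_of_dist (squeeze_zero (fun _ => dist_nonneg) (fun N => ?_) hlim)).1 (key F hF)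
  rw [Real.dist_eq, ← mul_sub, abs_mul, abs_of_pos (by positivity : (0 : ℝ) < (N + 1 : ℝ)⁻¹)]
  refine mul_le_mul_of_nonneg_left ?_ (by positivity)
  set X := tilingOf (J := J) hx x hx
  have hcomm : ∀ u, flow t (flow u X) = flow u (flow t X) := fun u => by
    rw [← flow_add, ← flow_add, add_comm]
  simp only [hcomm]
  have hsh := integral_orbit_shift F X 0 (N + 1) t
  have h1 := integral_orbit_add hF.continuous X 0 t (t + (N + 1))
  have h2 := integral_orbit_add hF.continuous X 0 (N + 1) (t + (N + 1))
  rw [add_zero] at hsh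
  have hb : ∀ a b, b - a = t → |∫ u in a..b, F (flow u X)| ≤ M * |t| := fun a b hab => by
    rw [← hab]
    exact intervalIntegral.norm_integral_le_of_norm_le_const
      (f := fun u => F (flow u X)) fun u _ => hM _
  have h3 := hb 0 t (by ring)
  have h4 := hb (N + 1) (t + (N + 1)) (by ring)
  rw [← hsh]
  rw [abs_le] at *
  constructor <;> linarith

end Existence

end Hull

/-! ### Subadditive functions with small values along the block lengths -/

section Subadditive

/-- A continuous subadditive even function `p ≥ 0` on the line that vanishes at `s` vanishes
identically if it is uniformly small on the multiples `k * h n`, `k ≤ m n`, where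
`h (n + 1) = m n * h n + s` and `h n / s` is irrational. -/
theorem subadditive_eq_zero {p : ℝ → ℝ} (h0 : p 0 = 0) (hnn : ∀ t, 0 ≤ p t)
    (hadd : ∀ a b, p (a + b) ≤ p a + p b) (hneg : ∀ a, p (-a) = p a) (hcont : Continuous p)
    {s : ℝ} (hs : p s = 0) {h : ℕ → ℝ} {m : ℕ → ℕ} (hm : ∀ n, 2 ≤ m n)
    (hh : ∀ n, h (n + 1) = m n * h n + s) (hirr : ∀ n, Irrational (h n / s))
    (hsmall : ∀ ε > 0, ∀ᶠ n in atTop, ∀ k ≤ m n, p (k * h n) ≤ ε) (t : ℝ) : p t = 0 := by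
  let H : AddSubgroup ℝ :=
    { carrier := {t | p t = 0}
      zero_mem' := h0
      add_mem' := fun {a b} ha hb => le_antisymm
        ((hadd a b).trans (by rw [show p a = 0 from ha, show p b = 0 from hb, add_zero])) (hnn _)
      neg_mem' := fun {a} ha => (hneg a).trans ha }
  have hclosed : IsClosed (H : Set ℝ) := isClosed_singleton.preimage hcont
  have hper : ∀ t, ∀ b ∈ H, p (t + b) = p t := fun t b hb => by
    have h1 := hadd t b
    have h2 := hadd (t + b) (-b)
    have h3 : p b = 0 := hb
    rw [hneg, add_neg_cancel_right] at h2
    linarith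
  rcases H.dense_or_cyclic with hd | ⟨a, ha⟩
  · have : t ∈ (H : Set ℝ) := by
      rw [← hclosed.closure_eq, hd.closure_eq]; trivial
    exact this
  exfalso
  have hmem : ∀ t, p t = 0 ↔ ∃ z : ℤ, z * a = t := fun t => by
    have : p t = 0 ↔ t ∈ H := Iff.rfl
    rw [this, ha, AddSubgroup.mem_closure_singleton]
    simp
  obtain ⟨z, hz⟩ := (hmem s).1 hs
  have hs0 : s ≠ 0 := fun hs0 => by
    have := hirr 0
    rw [hs0, div_zero] at this
    exact this ⟨0, by simp⟩
  have ha0 : a ≠ 0 := fun ha0 => hs0 (by rw [← hz, ha0, mul_zero])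
  have habs : 0 < |a| := abs_pos.2 ha0
  -- The zeros of `p` are now the multiples of `a`, none of which lies in this range, so compactness
  -- and evenness bound `p` below there. By periodicity `p t < c` then puts `t / a` within `1/4` of
  -- an integer.
  obtain ⟨c, hc0, hc⟩ : ∃ c > 0, ∀ r : ℝ, 1 / 4 ≤ |r| → |r| ≤ 1 / 2 → c ≤ p (r * a) := by
    obtain ⟨b, ⟨hb1, hb2⟩, hb⟩ := (isCompact_Icc (a := (1 / 4 : ℝ)) (b := 1 / 2)).exists_isMinOn
      ⟨1 / 4, by norm_num, by norm_num⟩ (f := fun r => p (r * a))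
      (hcont.comp (continuous_id.mul continuous_const)).continuousOn
    refine ⟨p (b * a), (hnn _).lt_of_ne' fun h => ?_, fun r h1 h2 => ?_⟩
    · obtain ⟨w, hw⟩ := (hmem _).1 h
      have hwb := mul_right_cancel₀ ha0 hw
      rw [← hwb] at hb1 hb2
      have h1 : (0 : ℝ) < w := by linarith
      have h2 : (w : ℝ) < 1 := by linarith
      norm_cast at h1 h2
      omega
    · have h3 := isMinOn_iff.1 hb |r| ⟨h1, h2⟩
      rcases abs_choice r with hr | hr <;> rw [hr] at h3
      · exact h3
      · rwa [neg_mul, hneg] at h3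
  have hround : ∀ t, p t < c → |t / a - round (t / a)| < 1 / 4 := fun t ht => by
    by_contra! hcon
    have h1 := hc _ hcon (abs_sub_round _)
    have h2 := hper t (-(round (t / a) * a)) (H.neg_mem ((hmem _).2 ⟨_, rfl⟩))
    rw [show (t / a - round (t / a)) * a = t + -(round (t / a) * a) by field_simp; ring, h2] at h1
    linarith
  obtain ⟨n₀, hn₀⟩ := eventually_atTop.1 (hsmall (c / 2) (by linarith))
  set δ : ℕ → ℝ := fun n => |h n / a - round (h n / a)| with hδ
  have hdist : ∀ (y : ℝ) (w : ℤ), |y - w| < 1 / 2 → round y = w := fun y w hy => by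
    rw [abs_lt] at hy
    rw [round_eq, Int.floor_eq_iff]
    constructor <;> linarith
  have hgrow : ∀ n ≥ n₀, δ (n + 1) = m n * δ n ∧ δ n < 1 / 4 := by
    intro n hn
    set r := h n / a - round (h n / a) with hr
    -- No multiple can jump to another integer: if `k * |r|` and `|r|` are below `1/4`, the next
    -- multiple is within `1/2` of the expected integer, and `hround` improves this to `1/4`.
    have hk : ∀ k ≤ m n, (k : ℝ) * |r| < 1 / 4 := by
      intro k
      induction k with
      | zero => simp
      | succ k ih =>
        intro hk
        have h1 := ih (by omega)
        have h2 := hround _ ((hn₀ n hn (k + 1) hk).trans_lt (by linarith))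
        have h3 : |r| < 1 / 4 := by
          have := hround _ ((hn₀ n hn 1 (by have := hm n; omega)).trans_lt (by linarith))
          simpa using this
        have h4 : ((k + 1 : ℕ) : ℝ) * h n / a - ((k + 1 : ℕ) * round (h n / a) : ℤ) =
            (k + 1 : ℕ) * r := by
          rw [hr]; push_cast; ring
        have h5 : |((k + 1 : ℕ) : ℝ) * r| = (k + 1 : ℕ) * |r| := by
          rw [abs_mul, Nat.abs_cast]
        rw [hdist _ _ (by rw [h4, h5]; push_cast; linarith), h4, h5] at h2
        exact h2
    refine ⟨?_, by simpa using hk 1 (by have := hm n; omega)⟩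
    -- As `s = z * a`, the spacer does not affect the residue, which is just multiplied by `m n`.
    have h4 : h (n + 1) / a - (m n * round (h n / a) + z : ℤ) = m n * r := by
      rw [hh, ← hz, hr]; push_cast; field_simp; ring
    have h5 : |(m n : ℝ) * r| = m n * |r| := by rw [abs_mul, Nat.abs_cast]
    have h6 := hk _ le_rfl
    simp only [hδ]
    rw [hdist (h (n + 1) / a) _ (by rw [h4, h5]; linarith), h4, h5]
  have hpow : ∀ j, 2 ^ j * δ n₀ ≤ δ (n₀ + j) := by
    intro j
    induction j with
    | zero => simp
    | succ j ih =>
      have h1 := (hgrow (n₀ + j) (by omega)).1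
      have h2 : (2 : ℝ) ≤ m (n₀ + j) := by exact_mod_cast hm _
      have h3 : 0 ≤ δ (n₀ + j) := abs_nonneg _
      rw [← add_assoc, h1, pow_succ]
      nlinarith
  -- A positive residue would at least double at every level, yet it stays below `1/4`.
  have hzero : δ n₀ = 0 := by
    by_contra hne
    have hpos : 0 < δ n₀ := (abs_nonneg _).lt_of_ne' hne
    obtain ⟨j, hj⟩ := pow_unbounded_of_one_lt (1 / δ n₀) (one_lt_two (α := ℝ))
    rw [div_lt_iff₀ hpos] at hj
    have := hpow j
    have := (hgrow (n₀ + j) (by omega)).2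
    linarith
  have h1 : h n₀ / a = round (h n₀ / a) := sub_eq_zero.1 (abs_eq_zero.1 hzero)
  refine hirr n₀ ⟨round (h n₀ / a) / z, ?_⟩
  push_cast
  rw [← h1, ← hz]
  have : (z : ℝ) ≠ 0 := fun h => hs0 (by rw [← hz, h, zero_mul])
  field_simp

end Subadditive

/-! ### Displacement of sets by measure preserving maps -/

section Displacement

variable {α : Type*}

theorem abs_indicator_comp_sub (A : Set α) (φ : α → α) (ω : α) :
    |A.indicator (1 : α → ℝ) (φ ω) - A.indicator 1 ω| = (A ∆ (φ ⁻¹' A)).indicator 1 ω := by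
  by_cases h1 : ω ∈ A <;> by_cases h2 : φ ω ∈ A <;> simp [Set.indicator, Set.mem_symmDiff, h1, h2]

variable [MeasurableSpace α] {μ : Measure α}

theorem integral_abs_indicator_comp_sub {A : Set α} (hA : MeasurableSet A) {φ : α → α}
    (hφ : Measurable φ) :
    ∫ ω, |A.indicator (1 : α → ℝ) (φ ω) - A.indicator 1 ω| ∂μ = μ.real (A ∆ (φ ⁻¹' A)) := by
  simp only [abs_indicator_comp_sub]
  exact integral_indicator_one (hA.symmDiff (hφ hA))

theorem integrable_indicator_one [IsFiniteMeasure μ] {A : Set α} (hA : MeasurableSet A) :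
    Integrable (A.indicator (1 : α → ℝ)) μ :=
  (integrable_const (1 : ℝ)).indicator hA

theorem MeasureTheory.MeasurePreserving.integral_comp_real {φ : α → α} (hφ : MeasurePreserving φ μ μ)
    {g : α → ℝ} (hg : AEStronglyMeasurable g μ) : ∫ ω, g (φ ω) ∂μ = ∫ ω, g ω ∂μ := by
  conv_rhs => rw [← hφ.map_eq]
  rw [integral_map hφ.measurable.aemeasurable (by rwa [hφ.map_eq])]

/-- Replacing the indicator by `f` costs the approximation error at `ω` and at `φ ω`; these have
equal integrals because `φ` preserves `μ`. -/
theorem measureReal_symmDiff_preimage_le [IsFiniteMeasure μ] {A : Set α} (hA : MeasurableSet A) {φ : α → α}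
    (hφ : MeasurePreserving φ μ μ) {f : α → ℝ} (hf : Integrable f μ) :
    μ.real (A ∆ (φ ⁻¹' A)) ≤
      ∫ ω, |f (φ ω) - f ω| ∂μ + 2 * ∫ ω, |f ω - A.indicator 1 ω| ∂μ := by
  have hi := integrable_indicator_one (μ := μ) hA
  have h1 := hφ.integral_comp_real (hf.sub hi).abs.aestronglyMeasurable
  have h2 : Integrable (fun ω => |f (φ ω) - A.indicator 1 (φ ω)|) μ :=
    hφ.integrable_comp_of_integrable (hf.sub hi).abs
  have h3 : Integrable (fun ω => |f (φ ω) - f ω|) μ :=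
    ((hφ.integrable_comp_of_integrable hf).sub hf).abs
  have h4 : Integrable (fun ω => |f ω - A.indicator 1 ω|) μ := (hf.sub hi).abs
  simp only [Pi.sub_apply] at h1
  rw [← integral_abs_indicator_comp_sub hA hφ.measurable, two_mul]
  nth_rewrite 1 [← h1]
  have h5 : Integrable (fun ω => |f (φ ω) - f ω| + |f (φ ω) - A.indicator 1 (φ ω)|) μ := h3.add h2
  rw [← add_assoc, ← integral_add h3 h2, ← integral_add h5 h4]
  refine integral_mono ((hφ.integrable_comp_of_integrable hi).sub hi).abs (h5.add h4)
    fun ω => ?_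
  simp only
  rw [abs_sub_comm (f (φ ω)) (A.indicator 1 (φ ω))]
  calc |A.indicator (1 : α → ℝ) (φ ω) - A.indicator 1 ω|
      = |(f (φ ω) - f ω) + (A.indicator 1 (φ ω) - f (φ ω)) + (f ω - A.indicator 1 ω)| := by
        ring_nf
    _ ≤ _ := abs_add_three _ _ _

end Displacement

namespace Hull

open TilingSpace

/-! ### Continuity, ergodicity and rigidity on sets -/

section Dynamics

variable {J : Fin 2 → Tile} {x : ℤ → Fin 2} {ν : Measure (Hull J x)} [IsProbabilityMeasure ν]

theorem _root_.TilingSpace.IsLocal.integrable {f : Hull J x → ℝ} (hf : IsLocal f) :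
    Integrable f ν := by
  obtain ⟨M, hM⟩ := hf.bounded
  exact .of_bound hf.continuous.aestronglyMeasurable M (ae_of_all _ hM)

/-- Displacements of measurable sets tend to `0` if those of local functions do. -/
theorem tendsto_displacement (hν : ∀ t, MeasurePreserving (flow t) ν ν) {ι : Type*} {l : Filter ι}
    {t : ι → ℝ} (h : ∀ f : Hull J x → ℝ, IsLocal f →
      Tendsto (fun i => ∫ S, |f (flow (t i) S) - f S| ∂ν) l (𝓝 0))
    {A : Set (Hull J x)} (hA : MeasurableSet A) :
    Tendsto (fun i => ν.real (A ∆ (flow (t i) ⁻¹' A))) l (𝓝 0) := by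
  refine Metric.tendsto_nhds.2 fun ε hε => ?_
  obtain ⟨f, hf, hfA⟩ := exists_isLocal_approx ν hA (show 0 < ε / 4 by linarith)
  filter_upwards [(h f hf).eventually (gt_mem_nhds (show 0 < ε / 2 by linarith))] with i hi
  rw [Real.dist_eq, sub_zero, abs_of_nonneg measureReal_nonneg]
  have := measureReal_symmDiff_preimage_le hA (hν (t i)) (hf.integrable (ν := ν))
  linarith

theorem tendsto_displacement_zero (hν : ∀ t, MeasurePreserving (flow t) ν ν) {A : Set (Hull J x)}
    (hA : MeasurableSet A) :
    Tendsto (fun t => ν.real (A ∆ (flow t ⁻¹' A))) (𝓝 0) (𝓝 0) := by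
  refine tendsto_displacement hν (fun f hf => ?_) hA
  obtain ⟨M, hM⟩ := hf.bounded
  have : (0 : ℝ) = ∫ S : Hull J x, (0 : ℝ) ∂ν := by simp
  nth_rewrite 2 [this]
  refine tendsto_integral_filter_of_dominated_convergence (fun _ => 2 * M) ?_ ?_
    (integrable_const _) ?_
  · exact Eventually.of_forall fun t =>
      ((hf.continuous.comp (continuous_flow t)).sub hf.continuous).abs.aestronglyMeasurable
  · refine Eventually.of_forall fun t => ae_of_all _ fun S => ?_
    rw [Real.norm_eq_abs, abs_abs, two_mul]
    exact (abs_sub _ _).trans (add_le_add (hM _) (hM _))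
  · refine ae_of_all _ fun S => ?_
    have hc : Continuous fun t => |f (flow t S) - f S| :=
      ((hf.continuous.comp (continuous_flow_left S)).sub continuous_const).abs
    have := hc.tendsto 0
    simpa [flow_zero] using this

theorem isMeasurePreservingFlow (hν : ∀ t, MeasurePreserving (flow t) ν ν) :
    IsMeasurePreservingFlow (flow (𝒯 := seqTiling J x)) ν where
  isProbabilityMeasure := inferInstance
  map_zero := flow_zero
  map_add := flow_add
  measurePreserving := hν
  continuous A hA ε hε := by
    have := ENNReal.tendsto_ofReal (tendsto_displacement_zero hν hA)
    rw [ENNReal.ofReal_zero] at this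
    filter_upwards [this.eventually (gt_mem_nhds hε)] with t ht
    rwa [ofReal_measureReal] at ht

/-- If `A` is invariant and not null, then `ν` conditioned on `A` is invariant, hence equals `ν`,
and it gives `A` measure `1`. -/
theorem isErgodicFlow (hJ : Function.Injective fun a => (J a).length) (hx : x ∈ jrSubshift)
    (hν : ∀ t, MeasurePreserving (flow t) ν ν) : IsErgodicFlow (flow (𝒯 := seqTiling J x)) ν := by
  intro A hA hinv
  refine or_iff_not_imp_left.2 fun hA0 => ?_
  have hprob : IsProbabilityMeasure (ProbabilityTheory.cond ν A) :=
    ProbabilityTheory.cond_isProbabilityMeasure hA0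
  have hinv' : ∀ t, MeasurePreserving (flow t) (ProbabilityTheory.cond ν A)
      (ProbabilityTheory.cond ν A) := fun t => by
    refine ⟨(hν t).measurable, Measure.ext fun B hB => ?_⟩
    rw [Measure.map_apply (hν t).measurable hB, ProbabilityTheory.cond_apply hA,
      ProbabilityTheory.cond_apply hA]
    congr 1
    have h1 : A =ᵐ[ν] flow t ⁻¹' A := measure_symmDiff_eq_zero_iff.1 (hinv t)
    calc ν (A ∩ flow t ⁻¹' B) = ν (flow t ⁻¹' A ∩ flow t ⁻¹' B) :=
          measure_congr (h1.inter (ae_eq_refl _))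
      _ = ν (A ∩ B) := (hν t).measure_preimage (hA.inter hB).nullMeasurableSet
  have := invariant_unique hJ hx ν _ hν hinv'
  calc ν A = ProbabilityTheory.cond ν A A := congrArg (fun μ => μ A) this
    _ = 1 := ProbabilityTheory.cond_apply_self hA0 (measure_ne_top _ _)

/-- On a block followed directly by another one, the translation by the block length compares two
copies of the block. All other blocks are accounted for by `abs_integral_sub_le_of_pair`. -/
theorem tendsto_rigid_local (hJ : Function.Injective fun a => (J a).length) (hx : x ∈ jrSubshift)
    (hν : ∀ t, MeasurePreserving (flow t) ν ν) {f : Hull J x → ℝ} (hf : IsLocal f) :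
    Tendsto (fun n => ∫ S, |f (flow (blockLength J n) S) - f S| ∂ν) atTop (𝓝 0) := by
  obtain ⟨M, hM⟩ := hf.bounded
  refine Metric.tendsto_nhds.2 fun ε hε => ?_
  have h2 : Tendsto (fun n : ℕ => 2 * (2 * M) / 2 ^ n) atTop (𝓝 0) :=
    tendsto_const_nhds.div_atTop (tendsto_pow_atTop_atTop_of_one_lt (by norm_num))
  filter_upwards [eventually_compare_shift hf (show 0 < ε / 2 by linarith),
    h2.eventually (gt_mem_nhds (show 0 < ε / 2 by linarith))] with n hn hn2
  have hh := blockLength_pos (J := J) n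
  have hM' : ∀ S, ‖|f (flow (blockLength J n) S) - f S|‖ ≤ 2 * M := fun S => by
    rw [Real.norm_eq_abs, abs_abs, two_mul]
    exact (abs_sub _ _).trans (add_le_add (hM _) (hM _))
  have := abs_integral_sub_le_of_pair hJ hx ν hν
    (G := fun S => |f (flow (blockLength J n) S) - f S|)
    ((hf.continuous.comp (continuous_flow _)).sub hf.continuous).abs hM' (n := n) (α := 0)
    (β := ε / 2 * blockLength J n) ?_ (by positivity) ?_
  · rw [zero_div, sub_zero, mul_div_assoc, div_self hh.ne'] at this
    rw [Real.dist_eq, sub_zero]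
    linarith
  · rw [abs_zero]
    obtain ⟨S₀⟩ : Nonempty (Hull J x) := nonempty_of_isProbabilityMeasure ν
    have := (norm_nonneg _).trans (hM' S₀)
    positivity
  · intro S h1 h2
    have h3 := hn S 0 (blockLength J n) h1 (by rwa [zero_add])
    rw [zero_add] at h3
    simp only [← flow_add, add_comm (blockLength J n)]
    rw [sub_zero, abs_of_nonneg (intervalIntegral.integral_nonneg hh.le fun u _ => abs_nonneg _)]
    exact h3

theorem tendsto_rigid (hJ : Function.Injective fun a => (J a).length) (hx : x ∈ jrSubshift)
    (hν : ∀ t, MeasurePreserving (flow t) ν ν) {A : Set (Hull J x)} (hA : MeasurableSet A) :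
    Tendsto (fun n => ν.real (A ∆ (flow (blockLength J n) ⁻¹' A))) atTop (𝓝 0) :=
  tendsto_displacement hν (fun _ hf => tendsto_rigid_local hJ hx hν hf) hA

end Dynamics

end Hull

/-- If the displacements of measurable sets tend to `0`, then so do those of the functions in
`L²`. -/
theorem tendsto_eLpNorm_comp_sub {α : Type*} [MeasurableSpace α] {μ : Measure α}
    [IsFiniteMeasure μ] {φ : ℕ → α → α} (hφ : ∀ n, MeasurePreserving (φ n) μ μ)
    (h : ∀ A, MeasurableSet A → Tendsto (fun n => μ.real (A ∆ (φ n ⁻¹' A))) atTop (𝓝 0))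
    {f : α → ℂ} (hf : MemLp f 2 μ) :
    Tendsto (fun n => eLpNorm (fun ω => f (φ n ω) - f ω) 2 μ) atTop (𝓝 0) := by
  -- For indicators the norm is `‖c‖` times the square root of the measure of the symmetric
  -- difference.
  have hstep : ∀ c : ℂ, ∀ A, MeasurableSet A → Tendsto (fun n => eLpNorm
      (fun ω => A.indicator (fun _ => c) (φ n ω) - A.indicator (fun _ => c) ω) 2 μ) atTop (𝓝 0) := by
    intro c A hA
    have heq : ∀ n, eLpNorm (fun ω => A.indicator (fun _ => c) (φ n ω) - A.indicator (fun _ => c) ω)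
        2 μ = ‖c‖ₑ * ENNReal.ofReal (μ.real (A ∆ (φ n ⁻¹' A))) ^ (1 / 2 : ℝ) := by
      intro n
      have h1 := eLpNorm_indicator_const (μ := μ) (c := c) (p := 2)
        (hA.symmDiff ((hφ n).measurable hA)) (by norm_num) (by norm_num)
      rw [ofReal_measureReal]
      simp only [ENNReal.toReal_ofNat] at h1
      rw [← h1]
      refine eLpNorm_congr_norm_ae (ae_of_all _ fun ω => ?_)
      by_cases h1 : ω ∈ A <;> by_cases h2 : φ n ω ∈ A <;>
        simp [Set.indicator, Set.mem_symmDiff, h1, h2]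
    simp only [heq]
    have h1 := ENNReal.tendsto_ofReal (h A hA)
    have h2 := ((ENNReal.continuous_rpow_const (y := (1 / 2 : ℝ))).tendsto _).comp h1
    have h3 := ENNReal.Tendsto.const_mul (a := ‖c‖ₑ) h2 (Or.inr (by simp))
    simpa using h3
  have hadd : ∀ {f g : α → ℂ}, AEStronglyMeasurable f μ → AEStronglyMeasurable g μ → ∀ n,
      eLpNorm (fun ω => (f + g) (φ n ω) - (f + g) ω) 2 μ ≤
        eLpNorm (fun ω => f (φ n ω) - f ω) 2 μ + eLpNorm (fun ω => g (φ n ω) - g ω) 2 μ := by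
    intro f g hf hg n
    have h1 : AEStronglyMeasurable (fun ω => f (φ n ω) - f ω) μ :=
      (hf.comp_measurePreserving (hφ n)).sub hf
    have h2 : AEStronglyMeasurable (fun ω => g (φ n ω) - g ω) μ :=
      (hg.comp_measurePreserving (hφ n)).sub hg
    refine le_trans (le_of_eq ?_) (eLpNorm_add_le h1 h2 (by norm_num))
    congr 1
    ext ω
    simp only [Pi.add_apply]; ring
  refine ENNReal.tendsto_nhds_zero.2 fun ε hε => ?_
  have hε3 : ε / 3 ≠ 0 := (ENNReal.div_pos hε.ne' (by norm_num)).ne'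
  obtain ⟨g, hg, hgm, hgt⟩ := hf.induction_dense (by norm_num)
    (fun g => AEStronglyMeasurable g μ ∧
      Tendsto (fun n => eLpNorm (fun ω => g (φ n ω) - g ω) 2 μ) atTop (𝓝 0))
    (fun c A hA _ {δ} _ => ⟨A.indicator fun _ => c, by simp,
      (stronglyMeasurable_const.indicator hA).aestronglyMeasurable, hstep c A hA⟩)
    (fun f g hf hg => ⟨hf.1.add hg.1, tendsto_of_tendsto_of_tendsto_of_le_of_le tendsto_const_nhds
      (by simpa using hf.2.add hg.2) (fun _ => zero_le) (hadd hf.1 hg.1)⟩)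
    (fun f hf => hf.1) hε3
  have hfg : AEStronglyMeasurable (f - g) μ := hf.1.sub hgm
  filter_upwards [ENNReal.tendsto_nhds_zero.1 hgt (ε / 3) (pos_iff_ne_zero.2 hε3)] with n hn
  have h1 := hadd hfg hgm n
  rw [sub_add_cancel] at h1
  -- As `φ n` preserves `μ`, the displacement of `f - g` is at most twice its norm.
  have h2 : eLpNorm (fun ω => (f - g) (φ n ω) - (f - g) ω) 2 μ ≤ ε / 3 + ε / 3 := by
    refine (eLpNorm_sub_le (hfg.comp_measurePreserving (hφ n)) hfg (by norm_num)).trans ?_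
    rw [eLpNorm_comp_measurePreserving hfg (hφ n)]
    exact add_le_add hg hg
  refine h1.trans ((add_le_add h2 hn).trans (le_of_eq ?_))
  exact ENNReal.add_thirds ε

namespace Hull

open TilingSpace

/-! ### Positions of blocks in two consecutive blocks of the next level -/

section Positions

variable {J : Fin 2 → Tile} {x : ℤ → Fin 2}

theorem wordTiles_replicate {V : Set Tile} {w : List (Fin 2)} {k : ℕ} {d : ℝ}
    (h : wordTiles J (List.replicate k w).flatten d ⊆ V) {i : ℕ} (hi : i < k) :
    wordTiles J w (d + i * wordLength J w) ⊆ V := by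
  induction k generalizing d i with
  | zero => omega
  | succ k ih =>
    rw [List.replicate_succ, List.flatten_cons, wordTiles_append, Set.union_subset_iff] at h
    rcases i with _ | i
    · simpa using h.1
    · convert ih h.2 (i := i) (by omega) using 2
      push_cast; ring

/-- The blocks of level `n` in a block of the next level. -/
theorem wordTiles_block_succ {V : Set Tile} {n : ℕ} {d : ℝ}
    (h : wordTiles J (jrBlock (n + 1)) d ⊆ V) {i : ℕ} (hi : i < 2 ^ (n + 1)) :
    wordTiles J (jrBlock n) (d + i * blockLength J n) ⊆ V ∧
      wordTiles J (jrBlock n)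
        (d + (2 ^ (n + 1) * blockLength J n + (J 1).length) + i * blockLength J n) ⊆ V := by
  simp only [jrBlock, wordTiles_append, Set.union_subset_iff, wordLength_append,
    wordLength_flatten_replicate, wordLength_cons, wordLength_nil, add_zero] at h
  refine ⟨wordTiles_replicate h.1.1 hi, ?_⟩
  have := wordTiles_replicate h.2 hi
  push_cast at this
  exact this

/-- The position of the block of level `n` and number `i` in a pair of consecutive blocks of the
next level. -/
noncomputable def blockPos (J : Fin 2 → Tile) (n i : ℕ) : ℝ :=
  i * blockLength J n + ((i + 2 ^ (n + 1)) / 2 ^ (n + 2) : ℕ) * (J 1).length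

/-- With `K = 2 ^ (n + 1)` the pair reads `K` blocks, spacer, `2 * K` blocks, spacer, `K` blocks. So
`(i + K) / (2 * K)` counts the spacers before block `i`. -/
theorem wordTiles_blockPos {V : Set Tile} {n : ℕ} (h1 : wordTiles J (jrBlock (n + 1)) 0 ⊆ V)
    (h2 : wordTiles J (jrBlock (n + 1)) (blockLength J (n + 1)) ⊆ V) {i : ℕ}
    (hi : i < 2 ^ (n + 3)) : wordTiles J (jrBlock n) (blockPos J n i) ⊆ V := by
  obtain ⟨K, hK⟩ : ∃ K, K = 2 ^ (n + 1) := ⟨_, rfl⟩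
  have hK2 : 2 ^ (n + 2) = 2 * K := by rw [hK]; ring
  have hK3 : 2 ^ (n + 3) = 4 * K := by rw [hK]; ring
  have hK0 : 0 < K := by rw [hK]; positivity
  have hKr : (2 : ℝ) ^ (n + 1) = K := by rw [hK]; push_cast; ring
  have hlen := blockLength_succ (J := J) n
  rw [show (2 : ℝ) ^ (n + 2) = 2 * K by rw [hK]; push_cast; ring] at hlen
  rw [hK3] at hi
  have hdiv : ∀ q, q * (2 * K) ≤ i + K → i + K < (q + 1) * (2 * K) → (i + K) / (2 * K) = q :=
    fun q h1 h2 => Nat.div_eq_of_lt_le h1 h2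
  rw [blockPos, hK2, ← hK]
  rcases lt_or_ge i K with h | h
  · rw [hdiv 0 (by omega) (by omega)]
    convert (wordTiles_block_succ h1 (hK ▸ h)).1 using 2
    push_cast; ring
  rcases lt_or_ge i (2 * K) with h' | h'
  · rw [hdiv 1 (by omega) (by omega)]
    obtain ⟨j, rfl⟩ := Nat.exists_eq_add_of_le h
    convert (wordTiles_block_succ h1 (i := j) (by omega)).2 using 2
    rw [hKr]; push_cast; ring
  rcases lt_or_ge i (3 * K) with h'' | h''
  · rw [hdiv 1 (by omega) (by omega)]
    obtain ⟨j, rfl⟩ := Nat.exists_eq_add_of_le h'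
    convert (wordTiles_block_succ h2 (i := j) (by omega)).1 using 2
    rw [hlen]; push_cast; ring
  · rw [hdiv 2 (by omega) (by omega)]
    obtain ⟨j, rfl⟩ := Nat.exists_eq_add_of_le h''
    convert (wordTiles_block_succ h2 (i := j) (by omega)).2 using 2
    rw [hlen, hKr]; push_cast; ring

theorem blockPos_of_lt {n i : ℕ} (hi : i < 2 ^ (n + 1)) : blockPos J n i = i * blockLength J n := by
  have : (i + 2 ^ (n + 1)) / 2 ^ (n + 2) = 0 := Nat.div_eq_of_lt (by rw [pow_succ _ (n + 1)]; omega)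
  rw [blockPos, this]; simp

theorem blockPos_add_half {n i : ℕ} (hi : i < 2 ^ (n + 1)) :
    blockPos J n (2 ^ (n + 1) + i) =
      2 ^ (n + 1) * blockLength J n + (J 1).length + i * blockLength J n := by
  have : (2 ^ (n + 1) + i + 2 ^ (n + 1)) / 2 ^ (n + 2) = 1 :=
    Nat.div_eq_of_lt_le (by rw [pow_succ _ (n + 1)]; omega) (by rw [pow_succ _ (n + 1)]; omega)
  rw [blockPos, this]; push_cast; ring

theorem blockPos_add_full {n i : ℕ} (hi : i < 2 ^ (n + 1)) :
    blockPos J n (2 ^ (n + 2) + i) =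
      2 ^ (n + 2) * blockLength J n + (J 1).length + i * blockLength J n := by
  have : (2 ^ (n + 2) + i + 2 ^ (n + 1)) / 2 ^ (n + 2) = 1 :=
    Nat.div_eq_of_lt_le (by rw [pow_succ _ (n + 1)]; omega) (by rw [pow_succ _ (n + 1)]; omega)
  rw [blockPos, this]; push_cast; ring

/-- Successive spacers are `2 ^ (n + 2)` blocks apart, so at most one is crossed. -/
theorem blockPos_add {n i k : ℕ} (hk : k ≤ 2 ^ (n + 2)) : ∃ e,
    blockPos J n (i + k) = blockPos J n i + e ∧
      (e = k * blockLength J n ∨ e = k * blockLength J n + (J 1).length) := by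
  have hpos : 0 < 2 ^ (n + 2) := by positivity
  have h1 : (i + 2 ^ (n + 1)) / 2 ^ (n + 2) ≤ (i + k + 2 ^ (n + 1)) / 2 ^ (n + 2) :=
    Nat.div_le_div_right (by omega)
  have h2 : (i + k + 2 ^ (n + 1)) / 2 ^ (n + 2) ≤ (i + 2 ^ (n + 1)) / 2 ^ (n + 2) + 1 := by
    rw [← Nat.add_div_right _ hpos]
    exact Nat.div_le_div_right (by omega)
  rcases (by omega : (i + k + 2 ^ (n + 1)) / 2 ^ (n + 2) = (i + 2 ^ (n + 1)) / 2 ^ (n + 2) ∨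
    (i + k + 2 ^ (n + 1)) / 2 ^ (n + 2) = (i + 2 ^ (n + 1)) / 2 ^ (n + 2) + 1) with h | h
  · exact ⟨_, by rw [blockPos, h, blockPos]; push_cast; ring, Or.inl rfl⟩
  · exact ⟨_, by rw [blockPos, h, blockPos]; push_cast; ring, Or.inr rfl⟩

variable {G : Hull J x → ℝ} {M : ℝ}

theorem run_sum_estimate (hG : Continuous G) {S : Hull J x} {h d α β : ℝ} {k : ℕ}
    (H : ∀ i < k, |(∫ u in (d + i * h)..(d + i * h + h), G (flow u S)) - α| ≤ β) :
    |(∫ u in d..(d + k * h), G (flow u S)) - k * α| ≤ k * β := by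
  induction k with
  | zero => simp
  | succ k ih =>
    have h1 := ih fun i hi => H i (by omega)
    have h2 := H k (by omega)
    rw [integral_orbit_add hG S d (d + k * h), show d + ((k + 1 : ℕ) : ℝ) * h = d + k * h + h by
      push_cast; ring]
    push_cast
    rw [abs_le] at *
    constructor <;> linarith

/-- The integral along a block, from the integrals along the blocks of the previous level in its
two halves. -/
theorem halves_estimate (hG : Continuous G) (hM : ∀ S, |G S| ≤ M) {S : Hull J x} {n : ℕ}
    {α α' β : ℝ}
    (H : ∀ i < 2 ^ (n + 1), |(∫ u in (blockPos J n i)..(blockPos J n i + blockLength J n),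
      G (flow u S)) - α| ≤ β)
    (H' : ∀ i < 2 ^ (n + 1), |(∫ u in (blockPos J n (2 ^ (n + 1) + i))..
      (blockPos J n (2 ^ (n + 1) + i) + blockLength J n), G (flow u S)) - α'| ≤ β) :
    |(∫ u in 0..blockLength J (n + 1), G (flow u S)) - 2 ^ (n + 1) * (α + α')| ≤
      2 ^ (n + 2) * β + M * (J 1).length := by
  have hs := (J 1).length_pos
  set K := 2 ^ (n + 1) * blockLength J n with hK
  have h1 := run_sum_estimate hG (S := S) (d := 0) (h := blockLength J n) (k := 2 ^ (n + 1))
    (α := α) (β := β) fun i hi => by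
      have := H i hi
      rwa [blockPos_of_lt hi, ← zero_add ((i : ℝ) * _)] at this
  have h2 := run_sum_estimate hG (S := S) (d := K + (J 1).length) (h := blockLength J n)
    (k := 2 ^ (n + 1)) (α := α') (β := β) fun i hi => by
      have := H' i hi
      rwa [blockPos_add_half hi] at this
  have h3 := abs_integral_orbit_le hM S (a := K) (b := K + (J 1).length) (by linarith)
  push_cast at h1 h2
  rw [zero_add, ← hK] at h1
  rw [← hK] at h2
  rw [integral_orbit_add hG S 0 K, integral_orbit_add hG S K (K + (J 1).length),
    show blockLength J (n + 1) = K + (J 1).length + K by rw [blockLength_succ, hK]; ring,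
    show (2 : ℝ) ^ (n + 2) = 2 * 2 ^ (n + 1) by ring]
  rw [abs_le] at *
  constructor <;> linarith

end Positions

/-! ### Ergodicity of the translation by the spacer -/

section Spacer

variable {J : Fin 2 → Tile} {x : ℤ → Fin 2} {ν : Measure (Hull J x)} [IsProbabilityMeasure ν]

theorem tendsto_const_div_two_pow (C : ℝ) : Tendsto (fun n : ℕ => C / 2 ^ (n + 1)) atTop (𝓝 0) :=
  (tendsto_const_nhds.div_atTop (tendsto_pow_atTop_atTop_of_one_lt (by norm_num))).comp
    (tendsto_add_atTop_nat 1)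

theorem tendsto_const_div_blockLength (C : ℝ) :
    Tendsto (fun n : ℕ => C / blockLength J (n + 1)) atTop (𝓝 0) :=
  (tendsto_const_nhds.div_atTop tendsto_blockLength).comp (tendsto_add_atTop_nat 1)

/-- Up to the length of one spacer, the translations by multiples of the length of a block move a
local function little. -/
theorem eventually_min_displacement (hJ : Function.Injective fun a => (J a).length)
    (hx : x ∈ jrSubshift) (hν : ∀ t, MeasurePreserving (flow t) ν ν) {f : Hull J x → ℝ}
    (hf : IsLocal f) {ε : ℝ} (hε : 0 < ε) : ∀ᶠ n in atTop, ∀ k : ℕ, k ≤ 2 ^ (n + 2) →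
    ∫ S, min |f (flow (k * blockLength J n) S) - f S|
      |f (flow (k * blockLength J n + (J 1).length) S) - f S| ∂ν ≤ ε := by
  obtain ⟨M, hM⟩ := hf.bounded
  have hs := (J 1).length_pos
  obtain ⟨S₀⟩ : Nonempty (Hull J x) := nonempty_of_isProbabilityMeasure ν
  have hM0 : 0 ≤ M := (abs_nonneg _).trans (hM S₀)
  filter_upwards [eventually_compare_shift hf (show 0 < ε / 3 by linarith),
    (tendsto_const_div_two_pow (2 * (2 * M))).eventually (gt_mem_nhds (show 0 < ε / 3 by linarith)),
    (tendsto_const_div_blockLength (J := J) (2 * M * (J 1).length)).eventually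
      (gt_mem_nhds (show 0 < ε / 3 by linarith))] with n hn hn2 hn3 k hk
  have hh := blockLength_pos (J := J) n
  have hh' := blockLength_pos (J := J) (n + 1)
  -- One of the two translations carries a block onto the copy `k` places further on; the minimum
  -- spares knowing which.
  set G : Hull J x → ℝ := fun S => min |f (flow (k * blockLength J n) S) - f S|
      |f (flow (k * blockLength J n + (J 1).length) S) - f S| with hG
  have hcont : Continuous G :=
    ((hf.continuous.comp (continuous_flow _)).sub hf.continuous).abs.min
      ((hf.continuous.comp (continuous_flow _)).sub hf.continuous).abs
  have hG0 : ∀ S, 0 ≤ G S := fun S => le_min (abs_nonneg _) (abs_nonneg _)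
  have hGM : ∀ S, |G S| ≤ 2 * M := fun S => by
    rw [abs_of_nonneg (hG0 S), two_mul]
    exact (min_le_left _ _).trans ((abs_sub _ _).trans (add_le_add (hM _) (hM _)))
  have hblock : ∀ S : Hull J x, wordTiles J (jrBlock (n + 1)) 0 ⊆ S.tiles →
      wordTiles J (jrBlock (n + 1)) (blockLength J (n + 1)) ⊆ S.tiles → ∀ i < 2 ^ (n + 2),
      |(∫ u in (blockPos J n i)..(blockPos J n i + blockLength J n), G (flow u S)) - 0| ≤
        ε / 3 * blockLength J n := by
    intro S h1 h2 i hi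
    have hle : blockPos J n i ≤ blockPos J n i + blockLength J n := by linarith
    rw [sub_zero, abs_of_nonneg (intervalIntegral.integral_nonneg hle fun u _ => hG0 _)]
    obtain ⟨e, he, he'⟩ := blockPos_add (J := J) (i := i) hk
    have h3 := wordTiles_blockPos h1 h2 (i := i + k)
      (by rw [show 2 ^ (n + 3) = 2 ^ (n + 2) * 2 from pow_succ _ _]; omega)
    rw [he] at h3
    refine le_trans (intervalIntegral.integral_mono_on hle (intervalIntegrable_orbit hcont S _ _)
      ?_ fun u _ => ?_) (hn S _ e (wordTiles_blockPos h1 h2 (by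
        rw [show 2 ^ (n + 3) = 2 ^ (n + 2) * 2 from pow_succ _ _]; omega)) h3)
    · exact (((hf.continuous.comp ((continuous_flow_left S).comp (continuous_add_const e))).sub
        (hf.continuous.comp (continuous_flow_left S))).abs).intervalIntegrable _ _
    · simp only [hG, ← flow_add]
      rcases he' with rfl | rfl
      · rw [add_comm u]; exact min_le_left _ _
      · rw [add_comm u]; exact min_le_right _ _
  -- The copy may lie in the next block of level `n + 1`, so pairs of such blocks are needed.
  have key := abs_integral_sub_le_of_pair hJ hx ν hν hcont hGM (n := n + 1) (α := 0)
    (β := 2 ^ (n + 2) * (ε / 3 * blockLength J n) + 2 * M * (J 1).length)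
    (by rw [abs_zero]; positivity) (by positivity) fun S h1 h2 => by
      have hp : 2 ^ (n + 2) = 2 ^ (n + 1) + 2 ^ (n + 1) := by ring
      have := halves_estimate hcont hGM (S := S) (n := n) (fun i hi => hblock S h1 h2 i (by omega))
        (fun i hi => hblock S h1 h2 _ (by omega))
      simpa using this
  rw [zero_div, sub_zero, add_div] at key
  have h4 : 2 ^ (n + 2) * (ε / 3 * blockLength J n) / blockLength J (n + 1) ≤ ε / 3 := by
    rw [div_le_iff₀ hh']
    have := two_pow_mul_blockLength_le (J := J) n
    calc 2 ^ (n + 2) * (ε / 3 * blockLength J n) = ε / 3 * (2 ^ (n + 2) * blockLength J n) := by ring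
      _ ≤ _ := by gcongr
  have := le_abs_self (∫ S, G S ∂ν)
  linarith

/-- The displacement of a set that is invariant under the translation by the length of the spacer
is small for all multiples of the length of a block. -/
theorem eventually_displacement (hJ : Function.Injective fun a => (J a).length)
    (hx : x ∈ jrSubshift) (hν : ∀ t, MeasurePreserving (flow t) ν ν) {A : Set (Hull J x)}
    (hA : MeasurableSet A) (hinv : ν.real (A ∆ (flow (J 1).length ⁻¹' A)) = 0)
    {ε : ℝ} (hε : 0 < ε) : ∀ᶠ n in atTop, ∀ k : ℕ, k ≤ 2 ^ (n + 2) →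
    ν.real (A ∆ (flow (k * blockLength J n) ⁻¹' A)) ≤ ε := by
  obtain ⟨f, hf, hfA⟩ := exists_isLocal_approx ν hA (show 0 < ε / 4 by linarith)
  filter_upwards [eventually_min_displacement hJ hx hν hf (show 0 < ε / 4 by linarith)] with n hn k hk
  have hG := hn k hk
  set t := (k : ℝ) * blockLength J n with ht
  set s := (J 1).length with hs
  have hfi : Integrable f ν := hf.integrable
  have hAi := integrable_indicator_one (μ := ν) hA
  have i1 : Integrable (fun S => |f S - A.indicator 1 S|) ν := (hfi.sub hAi).abs
  have i2 : Integrable (fun S => |f (flow t S) - A.indicator 1 (flow t S)|) ν :=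
    (hν t).integrable_comp_of_integrable i1
  have i3 : Integrable (fun S => |f (flow (t + s) S) - A.indicator 1 (flow (t + s) S)|) ν :=
    (hν (t + s)).integrable_comp_of_integrable i1
  have i0 : Integrable (fun S => |A.indicator (1 : Hull J x → ℝ) (flow s S) - A.indicator 1 S|) ν :=
    (((hν s).integrable_comp_of_integrable hAi).sub hAi).abs
  have i4 : Integrable (fun S => |A.indicator (1 : Hull J x → ℝ) (flow s (flow t S)) -
      A.indicator 1 (flow t S)|) ν := (hν t).integrable_comp_of_integrable i0
  have i5 : Integrable (fun S => min |f (flow t S) - f S| |f (flow (t + s) S) - f S|) ν :=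
    ((hν t).integrable_comp_of_integrable hfi |>.sub hfi).abs.inf
      ((hν (t + s)).integrable_comp_of_integrable hfi |>.sub hfi).abs
  have e2 := (hν t).integral_comp_real i1.aestronglyMeasurable
  have e3 := (hν (t + s)).integral_comp_real i1.aestronglyMeasurable
  have e4 := (hν t).integral_comp_real i0.aestronglyMeasurable
  rw [integral_abs_indicator_comp_sub hA (hν s).measurable, hinv] at e4
  rw [← integral_abs_indicator_comp_sub hA (hν t).measurable]
  have hmono : ∫ S, |A.indicator (1 : Hull J x → ℝ) (flow t S) - A.indicator 1 S| ∂ν ≤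
      ∫ S, ((((min |f (flow t S) - f S| |f (flow (t + s) S) - f S|) +
        |f (flow t S) - A.indicator 1 (flow t S)|) +
        |f (flow (t + s) S) - A.indicator 1 (flow (t + s) S)|) +
        |A.indicator (1 : Hull J x → ℝ) (flow s (flow t S)) - A.indicator 1 (flow t S)|) +
        |f S - A.indicator 1 S| ∂ν := by
    refine integral_mono (((hν t).integrable_comp_of_integrable hAi).sub hAi).abs
      ((((i5.add i2).add i3).add i4).add i1) fun S => ?_
    simp only
    have hts : flow (t + s) S = flow s (flow t S) := by rw [add_comm, flow_add]
    rw [hts]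
    set a := f (flow t S)
    set b := A.indicator (1 : Hull J x → ℝ) (flow t S)
    set c := f (flow s (flow t S))
    set d := A.indicator (1 : Hull J x → ℝ) (flow s (flow t S))
    set p := f S
    set q := A.indicator (1 : Hull J x → ℝ) S
    -- If the translation with the spacer realizes the minimum, the invariance of `A` under `flow s`
    -- leads back to `flow t` at the cost of `|d - b|`, whose integral is `0`.
    rcases min_choice |a - p| |c - p| with h | h <;> rw [h]
    · have h1 : |b - q| ≤ |a - p| + |a - b| + |p - q| := by
        rw [abs_sub_comm a b]
        calc |b - q| = |(a - p) + (b - a) + (p - q)| := by ring_nf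
          _ ≤ _ := abs_add_three _ _ _
      have := abs_nonneg (c - d)
      have := abs_nonneg (d - b)
      linarith
    · have h1 : |b - q| ≤ |c - p| + |c - d| + |p - q| + |d - b| := by
        rw [abs_sub_comm c d, abs_sub_comm d b]
        calc |b - q| = |((c - p) + (d - c) + (p - q)) + (b - d)| := by ring_nf
          _ ≤ _ := (abs_add_le _ _).trans (by gcongr; exact abs_add_three _ _ _)
      have := abs_nonneg (a - b)
      linarith
  have j1 : Integrable (fun S => (min |f (flow t S) - f S| |f (flow (t + s) S) - f S|) +
        |f (flow t S) - A.indicator 1 (flow t S)|) ν := i5.add i2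
  have j2 : Integrable (fun S => ((min |f (flow t S) - f S| |f (flow (t + s) S) - f S|) +
        |f (flow t S) - A.indicator 1 (flow t S)|) +
        |f (flow (t + s) S) - A.indicator 1 (flow (t + s) S)|) ν := j1.add i3
  have j3 : Integrable (fun S => (((min |f (flow t S) - f S| |f (flow (t + s) S) - f S|) +
        |f (flow t S) - A.indicator 1 (flow t S)|) +
        |f (flow (t + s) S) - A.indicator 1 (flow (t + s) S)|) +
        |A.indicator (1 : Hull J x → ℝ) (flow s (flow t S)) - A.indicator 1 (flow t S)|) ν :=
    j2.add i4
  rw [integral_add j3 i1, integral_add j2 i4, integral_add j1 i3, integral_add i5 i2, e2, e3,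
    e4] at hmono
  linarith

theorem exists_blockLength_eq (n : ℕ) : ∃ N M : ℕ, N ≠ 0 ∧
    blockLength J n = N * (J 0).length + M * (J 1).length := by
  induction n with
  | zero => exact ⟨2, 1, by norm_num, by simp [blockLength, jrBlock]; ring⟩
  | succ n ih =>
    obtain ⟨N, M, hN, h⟩ := ih
    refine ⟨2 ^ (n + 2) * N, 2 ^ (n + 2) * M + 1, by positivity, ?_⟩
    rw [blockLength_succ, h]; push_cast; ring

/-- Every block contains tiles `J 0`, so the multiple of the irrational ratio that occurs is
nonzero. -/
theorem irrational_blockLength_div (hJ : Irrational ((J 0).length / (J 1).length)) (n : ℕ) :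
    Irrational (blockLength J n / (J 1).length) := by
  obtain ⟨N, M, hN, h⟩ := exists_blockLength_eq (J := J) n
  have hs := (J 1).length_pos.ne'
  have : blockLength J n / (J 1).length = N * ((J 0).length / (J 1).length) + M := by
    rw [h]; field_simp
  rw [this]
  exact (hJ.natCast_mul hN).add_natCast M

theorem injective_length (hJ : Irrational ((J 0).length / (J 1).length)) :
    Function.Injective fun a => (J a).length := by
  have hne : (J 0).length ≠ (J 1).length := fun h => by
    rw [h, div_self (J 1).length_pos.ne'] at hJ
    exact hJ ⟨1, by simp⟩
  intro a b hab
  fin_cases a <;> fin_cases b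
  · rfl
  · exact (hne hab).elim
  · exact (hne hab.symm).elim
  · rfl

theorem displacement_add_le (hν : ∀ t, MeasurePreserving (flow t) ν ν) {A : Set (Hull J x)}
    (hA : MeasurableSet A) (a b : ℝ) : ν.real (A ∆ (flow (a + b) ⁻¹' A)) ≤
      ν.real (A ∆ (flow a ⁻¹' A)) + ν.real (A ∆ (flow b ⁻¹' A)) := by
  have h1 : flow (a + b) ⁻¹' A = flow b ⁻¹' (flow a ⁻¹' A) := by
    ext S; simp only [Set.mem_preimage, flow_add]
  have h2 : ν.real ((flow b ⁻¹' A) ∆ (flow b ⁻¹' (flow a ⁻¹' A))) = ν.real (A ∆ (flow a ⁻¹' A)) := by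
    rw [← Set.preimage_symmDiff, measureReal_def, (hν b).measure_preimage
      (hA.symmDiff ((hν a).measurable hA)).nullMeasurableSet, measureReal_def]
  rw [h1, ← h2, add_comm]
  exact (measureReal_mono (symmDiff_triangle _ (flow b ⁻¹' A) _)).trans (measureReal_union_le _ _)

theorem displacement_neg {μ : Measure (Hull J x)} (hμ : ∀ t, MeasurePreserving (flow t) μ μ) {A : Set (Hull J x)}
    (hA : MeasurableSet A) (a : ℝ) :
    μ.real (A ∆ (flow (-a) ⁻¹' A)) = μ.real (A ∆ (flow a ⁻¹' A)) := by
  have h1 : flow a ⁻¹' (flow (-a) ⁻¹' A) = A := by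
    ext S; simp only [Set.mem_preimage, ← flow_add, neg_add_cancel, flow_zero]
  have h2 := (hμ a).measure_preimage (hA.symmDiff ((hμ (-a)).measurable hA)).nullMeasurableSet
  rw [Set.preimage_symmDiff, h1, symmDiff_comm] at h2
  rw [measureReal_def, measureReal_def, h2]

/-- The translation by the length of the spacer is ergodic. -/
theorem measure_of_spacer_invariant (hJ : Irrational ((J 0).length / (J 1).length))
    (hx : x ∈ jrSubshift) (hν : ∀ t, MeasurePreserving (flow t) ν ν) {A : Set (Hull J x)}
    (hA : MeasurableSet A) (hinv : ν.real (A ∆ (flow (J 1).length ⁻¹' A)) = 0) :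
    ν A = 0 ∨ ν A = 1 := by
  have hJ' := injective_length hJ
  have hzero : ν.real (A ∆ (flow 0 ⁻¹' A)) = 0 := by
    have : flow 0 ⁻¹' A = A := by ext S; simp only [Set.mem_preimage, flow_zero]
    rw [this]; simp
  refine isErgodicFlow hJ' hx hν A hA fun t => (measureReal_eq_zero_iff).1 ?_
  refine subadditive_eq_zero (p := fun t => ν.real (A ∆ (flow t ⁻¹' A))) hzero
    (fun _ => measureReal_nonneg) (displacement_add_le hν hA) (displacement_neg hν hA) ?_ hinv
    (h := blockLength J) (m := fun n => 2 ^ (n + 2)) (fun n => ?_) (fun n => ?_)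
    (irrational_blockLength_div hJ) (fun ε hε => eventually_displacement hJ' hx hν hA hinv hε) t
  -- Subadditivity and evenness reduce continuity everywhere to continuity at `0`.
  · refine continuous_iff_continuousAt.2 fun t => tendsto_iff_dist_tendsto_zero.2 ?_
    have h1 : Tendsto (fun t' => t' - t) (𝓝 t) (𝓝 0) := by
      have : Continuous fun t' : ℝ => t' - t := continuous_id.sub continuous_const
      simpa using this.tendsto t
    refine squeeze_zero (fun _ => dist_nonneg) (fun t' => ?_)
      ((tendsto_displacement_zero hν hA).comp h1)
    have h2 := displacement_add_le hν hA (t' - t) t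
    have h3 := displacement_add_le hν hA (t - t') t'
    rw [sub_add_cancel] at h2 h3
    rw [← neg_sub, displacement_neg hν hA] at h3
    rw [Real.dist_eq, abs_le, Function.comp]
    constructor <;> linarith
  · calc 2 = 2 ^ 1 := by norm_num
      _ ≤ _ := Nat.pow_le_pow_right (by norm_num) (by omega)
  · push_cast; exact blockLength_succ n

end Spacer

end Hull

/-! ### Weak convergence of maps and its passage to the square -/

section SetwiseConvergence

variable {α : Type*} {mα : MeasurableSpace α}

theorem hasSum_measureReal_iUnion {μ : Measure α} [IsFiniteMeasure μ] {f : ℕ → Set α}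
    (hd : Pairwise (Function.onFun Disjoint f)) (hf : ∀ i, MeasurableSet (f i)) :
    HasSum (fun i => μ.real (f i)) (μ.real (⋃ i, f i)) := by
  have h := measure_iUnion (μ := μ) hd hf
  rw [measureReal_def, h, ENNReal.tsum_toReal_eq fun i => measure_ne_top _ _]
  refine (ENNReal.summable_toReal ?_).hasSum
  rw [← h]; exact measure_ne_top _ _

/-- Setwise convergence of dominated measures to a linear combination of measures extends from
a π-system to the σ-algebra that it generates. -/
theorem tendsto_measureReal_of_piSystem {ι : Type*} [Fintype ι] {m : ℕ → Measure α}
    {m' : ι → Measure α} {w : ι → ℝ} {d : Measure α} [IsFiniteMeasure d]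
    (hm : ∀ n, m n ≤ d) (hm' : ∀ j, m' j ≤ d) {C : Set (Set α)}
    (hgen : mα = MeasurableSpace.generateFrom C) (hC : IsPiSystem C)
    (huniv : Tendsto (fun n => (m n).real Set.univ) atTop
      (𝓝 (∑ j, w j * (m' j).real Set.univ)))
    (h : ∀ A ∈ C, Tendsto (fun n => (m n).real A) atTop (𝓝 (∑ j, w j * (m' j).real A)))
    {A : Set α} (hA : MeasurableSet A) :
    Tendsto (fun n => (m n).real A) atTop (𝓝 (∑ j, w j * (m' j).real A)) := by
  have hfin : ∀ n, IsFiniteMeasure (m n) := fun n => isFiniteMeasure_of_le d (hm n)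
  have hfin' : ∀ j, IsFiniteMeasure (m' j) := fun j => isFiniteMeasure_of_le d (hm' j)
  induction A, hA using MeasurableSpace.induction_on_inter hgen hC with
  | empty => simp
  | basic A hA => exact h A hA
  | compl A hA ih =>
    simp only [measureReal_compl hA, mul_sub, Finset.sum_sub_distrib]
    exact huniv.sub ih
  | iUnion f hd hf ih =>
    have h1 : ∀ n, (m n).real (⋃ i, f i) = ∑' i, (m n).real (f i) := fun n =>
      (hasSum_measureReal_iUnion hd hf).tsum_eq.symm
    have h2 : ∑ j, w j * (m' j).real (⋃ i, f i) = ∑' i, ∑ j, w j * (m' j).real (f i) :=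
      (hasSum_sum fun j _ => (hasSum_measureReal_iUnion (μ := m' j) hd hf).mul_left (w j)).tsum_eq.symm
    simp only [h1, h2]
    -- The common dominating measure `d` allows the limit to be exchanged with the countable sum.
    refine tendsto_tsum_of_dominated_convergence (bound := fun i => d.real (f i))
      (hasSum_measureReal_iUnion hd hf).summable ih (Eventually.of_forall fun n i => ?_)
    rw [Real.norm_eq_abs, abs_of_nonneg measureReal_nonneg]
    exact ENNReal.toReal_mono (measure_ne_top _ _) (hm n _)

/-- The maps `φ n` converge weakly to the combination of the maps `ψ j` with weights `w j`. -/
def WeaklyTendsTo {ι : Type*} [Fintype ι] (μ : Measure α) (φ : ℕ → α → α) (ψ : ι → α → α)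
    (w : ι → ℝ) (A B : Set α) : Prop :=
  Tendsto (fun n => μ.real (A ∩ φ n ⁻¹' B)) atTop (𝓝 (∑ j, w j * μ.real (A ∩ ψ j ⁻¹' B)))

/-- The sets are freed one at a time: first `A`, through the restrictions of `μ` to the preimages of
`B`, then `B`, through the images of `μ` restricted to `A`. All these measures are dominated by `μ`.
-/
theorem weaklyTendsTo_of_piSystem {ι : Type*} [Fintype ι] {μ : Measure α} [IsFiniteMeasure μ]
    {φ : ℕ → α → α} {ψ : ι → α → α} {w : ι → ℝ} (hφ : ∀ n, MeasurePreserving (φ n) μ μ)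
    (hψ : ∀ j, MeasurePreserving (ψ j) μ μ) (hw : ∑ j, w j = 1) {C : Set (Set α)}
    (hgen : mα = MeasurableSpace.generateFrom C) (hC : IsPiSystem C)
    (h : ∀ A ∈ C, ∀ B ∈ C, WeaklyTendsTo μ φ ψ w A B) {A B : Set α} (hA : MeasurableSet A)
    (hB : MeasurableSet B) : WeaklyTendsTo μ φ ψ w A B := by
  have hCm : ∀ B ∈ C, MeasurableSet B := fun B hB => by
    rw [hgen]; exact MeasurableSpace.measurableSet_generateFrom hB
  have hpre : ∀ {χ : α → α}, MeasurePreserving χ μ μ → ∀ B, MeasurableSet B →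
      μ.real (χ ⁻¹' B) = μ.real B := fun hχ B hB => by
    rw [measureReal_def, hχ.measure_preimage hB.nullMeasurableSet, measureReal_def]
  have step : ∀ B ∈ C, ∀ A, MeasurableSet A → WeaklyTendsTo μ φ ψ w A B := by
    intro B hB A hA
    have hBm := hCm B hB
    have hr : ∀ {χ : α → α}, MeasurePreserving χ μ μ → ∀ A,
        (μ.restrict (χ ⁻¹' B)).real A = μ.real (A ∩ χ ⁻¹' B) := fun hχ A => by
      rw [measureReal_restrict_apply' (hχ.measurable hBm)]
    have := tendsto_measureReal_of_piSystem (m := fun n => μ.restrict (φ n ⁻¹' B))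
      (m' := fun j => μ.restrict (ψ j ⁻¹' B)) (w := w) (d := μ) (fun n => Measure.restrict_le_self)
      (fun j => Measure.restrict_le_self) hgen hC ?_ ?_ hA
    · simp only [hr (hφ _), hr (hψ _)] at this
      exact this
    · simp only [hr (hφ _), hr (hψ _), Set.univ_inter, hpre (hφ _) _ hBm, hpre (hψ _) _ hBm,
        ← Finset.sum_mul, hw, one_mul]
      exact tendsto_const_nhds
    · simp only [hr (hφ _), hr (hψ _)]
      exact fun A hA => h A hA B hB
  have hr : ∀ {χ : α → α}, MeasurePreserving χ μ μ → ∀ B, MeasurableSet B →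
      ((μ.restrict A).map χ).real B = μ.real (A ∩ χ ⁻¹' B) := fun hχ B hB => by
    rw [measureReal_def, Measure.map_apply hχ.measurable hB,
      Measure.restrict_apply (hχ.measurable hB), Set.inter_comm, measureReal_def]
  have hle : ∀ {χ : α → α}, MeasurePreserving χ μ μ → (μ.restrict A).map χ ≤ μ := fun hχ => by
    refine (Measure.map_mono Measure.restrict_le_self hχ.measurable).trans_eq hχ.map_eq
  have := tendsto_measureReal_of_piSystem (m := fun n => (μ.restrict A).map (φ n))
    (m' := fun j => (μ.restrict A).map (ψ j)) (w := w) (d := μ) (fun n => hle (hφ n))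
    (fun j => hle (hψ j)) hgen hC ?_ ?_ hB
  · simp only [hr (hφ _) B hB, hr (hψ _) B hB] at this
    exact this
  · simp only [hr (hφ _) _ .univ, hr (hψ _) _ .univ, Set.preimage_univ, Set.inter_univ,
      ← Finset.sum_mul, hw, one_mul]
    exact tendsto_const_nhds
  · intro B hB
    simp only [hr (hφ _) B (hCm B hB), hr (hψ _) B (hCm B hB)]
    exact step B hB A hA

/-- Weak convergence passes to the cartesian square. -/
theorem WeaklyTendsTo.prod {ι : Type*} [Fintype ι] {μ : Measure α} [IsProbabilityMeasure μ]
    {φ : ℕ → α → α} {ψ : ι → α → α} {w : ι → ℝ} (hφ : ∀ n, MeasurePreserving (φ n) μ μ)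
    (hψ : ∀ j, MeasurePreserving (ψ j) μ μ) (hw : ∑ j, w j = 1)
    (h : ∀ A B, MeasurableSet A → MeasurableSet B → WeaklyTendsTo μ φ ψ w A B) {A B : Set (α × α)}
    (hA : MeasurableSet A) (hB : MeasurableSet B) :
    WeaklyTendsTo (μ.prod μ) (fun n => Prod.map (φ n) (φ n))
      (fun j : ι × ι => Prod.map (ψ j.1) (ψ j.2)) (fun j => w j.1 * w j.2) A B := by
  have h1 : ∑ j : ι × ι, w j.1 * w j.2 = 1 := by
    rw [Fintype.sum_prod_type]
    simp only [← Finset.mul_sum, hw, mul_one]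
  refine weaklyTendsTo_of_piSystem (μ := μ.prod μ) (φ := fun n => Prod.map (φ n) (φ n))
    (ψ := fun j : ι × ι => Prod.map (ψ j.1) (ψ j.2)) (fun n => (hφ n).prod (hφ n))
    (fun j => (hψ j.1).prod (hψ j.2)) h1 generateFrom_prod.symm isPiSystem_prod ?_ hA hB
  rintro _ ⟨A, hA, A', hA', rfl⟩ _ ⟨B, hB, B', hB', rfl⟩
  -- On rectangles correlations factor, and a product of two weighted sums expands over pairs of
  -- indices.
  have hr : ∀ χ χ' : α → α, (μ.prod μ).real (A ×ˢ A' ∩ Prod.map χ χ' ⁻¹' (B ×ˢ B')) =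
      μ.real (A ∩ χ ⁻¹' B) * μ.real (A' ∩ χ' ⁻¹' B') := fun χ χ' => by
    have h1 : A ×ˢ A' ∩ Prod.map χ χ' ⁻¹' (B ×ˢ B') = (A ∩ χ ⁻¹' B) ×ˢ (A' ∩ χ' ⁻¹' B') := by
      ext ⟨a, b⟩
      simp only [Set.mem_inter_iff, Set.mem_prod, Set.mem_preimage, Prod.map_fst, Prod.map_snd]
      tauto
    rw [h1, measureReal_prod_prod]
  have h2 : Tendsto (fun n => μ.real (A ∩ φ n ⁻¹' B) * μ.real (A' ∩ φ n ⁻¹' B')) atTop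
      (𝓝 ((∑ j, w j * μ.real (A ∩ ψ j ⁻¹' B)) * ∑ j, w j * μ.real (A' ∩ ψ j ⁻¹' B'))) :=
    Tendsto.mul (h A B hA hB) (h A' B' hA' hB')
  simp only [WeaklyTendsTo, hr]
  convert h2 using 2
  rw [Finset.sum_mul_sum, Fintype.sum_prod_type]
  exact Finset.sum_congr rfl fun i _ => Finset.sum_congr rfl fun j _ => by ring

end SetwiseConvergence

namespace Hull

open TilingSpace

/-! ### The weak limit and weak mixing -/

section WeakLimit

variable {J : Fin 2 → Tile} {x : ℤ → Fin 2} {ν : Measure (Hull J x)} [IsProbabilityMeasure ν]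

/-- Between two copies of a block the shift by `e` hardly changes `g`, so the integral is nearly
that of `f * g` along one block, and `eventually_block_mean` applies. -/
theorem eventually_correlation (hJ : Function.Injective fun a => (J a).length)
    (hx : x ∈ jrSubshift) (hν : ∀ t, MeasurePreserving (flow t) ν ν) {f g : Hull J x → ℝ}
    (hf : IsLocal f) (hg : IsLocal g) {ε : ℝ} (hε : 0 < ε) : ∀ᶠ n in atTop,
    ∀ (S : Hull J x) (d e : ℝ), wordTiles J (jrBlock n) d ⊆ S.tiles →
      wordTiles J (jrBlock n) (d + e) ⊆ S.tiles →
      |(∫ u in d..(d + blockLength J n), f (flow u S) * g (flow (u + e) S)) -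
        blockLength J n * ∫ S, f S * g S ∂ν| ≤ ε * blockLength J n := by
  obtain ⟨M, hM⟩ := hf.bounded
  obtain ⟨S₀⟩ : Nonempty (Hull J x) := nonempty_of_isProbabilityMeasure ν
  have hM0 : 0 ≤ M := (abs_nonneg _).trans (hM S₀)
  filter_upwards [eventually_compare_shift hg (show 0 < ε / 2 / (M + 1) by positivity),
    eventually_block_mean hJ hx ν hν (hf.mul hg) (half_pos hε)] with n hn hn' S d e h1 h2
  have hh := blockLength_pos (J := J) n
  have hle : d ≤ d + blockLength J n := by linarith
  have c1 : Continuous fun u => f (flow u S) := hf.continuous.comp (continuous_flow_left S)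
  have c2 : Continuous fun u => g (flow u S) := hg.continuous.comp (continuous_flow_left S)
  have c3 : Continuous fun u => g (flow (u + e) S) := c2.comp (continuous_add_const e)
  have c12 : Continuous fun u => f (flow u S) * g (flow u S) := c1.mul c2
  have c13 : Continuous fun u => f (flow u S) * g (flow (u + e) S) := c1.mul c3
  have h3 := hn' S d h1
  have h4 : |(∫ u in d..(d + blockLength J n), f (flow u S) * g (flow (u + e) S)) -
      ∫ u in d..(d + blockLength J n), f (flow u S) * g (flow u S)| ≤
        ε / 2 * blockLength J n := by
    rw [← intervalIntegral.integral_sub (c13.intervalIntegrable _ _)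
      (c12.intervalIntegrable _ _)]
    refine (intervalIntegral.abs_integral_le_integral_abs hle).trans ?_
    refine (intervalIntegral.integral_mono_on hle
      ((c13.sub c12).abs.intervalIntegrable _ _)
      (g := fun u => (M + 1) * |g (flow (u + e) S) - g (flow u S)|)
      ((continuous_const.mul (c3.sub c2).abs).intervalIntegrable _ _) fun u _ => ?_).trans ?_
    · change |f (flow u S) * g (flow (u + e) S) - f (flow u S) * g (flow u S)| ≤ _
      rw [← mul_sub, abs_mul]
      have := hM (flow u S)
      gcongr
      linarith
    · rw [intervalIntegral.integral_const_mul]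
      calc (M + 1) * _ ≤ (M + 1) * (ε / 2 / (M + 1) * blockLength J n) := by
            gcongr; exact hn S d e h1 h2
        _ = _ := by field_simp
  refine (abs_sub_le _ _ _).trans ((add_le_add h4 h3).trans (le_of_eq ?_))
  ring

/-- The translations by `2 ^ (n + 1)` times the length of the block of level `n` converge weakly to
the mean of the identity and the translation back by the length of the spacer. -/
theorem tendsto_correlation (hJ : Function.Injective fun a => (J a).length)
    (hx : x ∈ jrSubshift) (hν : ∀ t, MeasurePreserving (flow t) ν ν) {f g : Hull J x → ℝ}
    (hf : IsLocal f) (hg : IsLocal g) :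
    Tendsto (fun n => ∫ S, f S * g (flow (2 ^ (n + 1) * blockLength J n) S) ∂ν) atTop
      (𝓝 (1 / 2 * (∫ S, f S * g (flow (-(J 1).length) S) ∂ν) + 1 / 2 * ∫ S, f S * g S ∂ν)) := by
  obtain ⟨M, hM⟩ := hf.bounded
  obtain ⟨N, hN⟩ := hg.bounded
  have hs := (J 1).length_pos
  obtain ⟨S₀⟩ : Nonempty (Hull J x) := nonempty_of_isProbabilityMeasure ν
  have hM0 : 0 ≤ M := (abs_nonneg _).trans (hM S₀)
  have hN0 : 0 ≤ N := (abs_nonneg _).trans (hN S₀)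
  have hg' := hg.comp_flow (-(J 1).length)
  set a := ∫ S, f S * g (flow (-(J 1).length) S) ∂ν with ha
  set b := ∫ S, f S * g S ∂ν with hb
  have hbound : ∀ t, |∫ S, f S * g (flow t S) ∂ν| ≤ M * N := fun t => by
    have := norm_integral_le_of_norm_le_const (μ := ν) (f := fun S => f S * g (flow t S))
      (C := M * N) (ae_of_all _ fun S => by
        rw [norm_mul]
        exact mul_le_mul (hM _) (hN _) (norm_nonneg _) hM0)
    simpa using this
  have hab : |a + b| ≤ 2 * (M * N) := by
    have h1 := hbound (-(J 1).length)
    have h2 := hbound 0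
    simp only [flow_zero] at h2
    exact (abs_add_le _ _).trans (by linarith)
  refine Metric.tendsto_nhds.2 fun ε hε => ?_
  filter_upwards [eventually_correlation hJ hx hν hf hg (show 0 < ε / 4 by linarith),
    eventually_correlation hJ hx hν hf hg' (show 0 < ε / 4 by linarith),
    (tendsto_const_div_two_pow (2 * (M * N))).eventually (gt_mem_nhds (show 0 < ε / 4 by linarith)),
    (tendsto_const_div_blockLength (J := J) (2 * (M * N) * (J 1).length)).eventually
      (gt_mem_nhds (show 0 < ε / 4 by linarith))] with n hn hn' hn2 hn3
  have hh := blockLength_pos (J := J) n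
  have hh' := blockLength_pos (J := J) (n + 1)
  set q := 2 ^ (n + 1) * blockLength J n with hq
  have hlen : blockLength J (n + 1) = 2 * q + (J 1).length := by rw [blockLength_succ, hq]; ring
  have hq0 : 0 < q := by positivity
  set G : Hull J x → ℝ := fun S => f S * g (flow q S) with hG
  have hcont : Continuous G := hf.continuous.mul (hg.continuous.comp (continuous_flow _))
  have hGM : ∀ S, |G S| ≤ M * N := fun S => by
    rw [abs_mul]
    exact mul_le_mul (hM _) (hN _) (abs_nonneg _) hM0
  have hp : 2 ^ (n + 2) = 2 ^ (n + 1) + 2 ^ (n + 1) := by ring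
  have hp3 : 2 ^ (n + 3) = 2 * 2 ^ (n + 2) := by ring
  have key := abs_integral_sub_le_of_pair hJ hx ν hν hcont hGM (n := n + 1)
    (α := 2 ^ (n + 1) * (blockLength J n * a + blockLength J n * b))
    (β := 2 ^ (n + 2) * (ε / 4 * blockLength J n) + M * N * (J 1).length)
    ?_ (by positivity) fun S h1 h2 => by
      refine halves_estimate hcont hGM (S := S) (n := n) (fun i hi => ?_) (fun i hi => ?_)
      -- From the first half, the copy `2 ^ (n + 1)` places on lies beyond the spacer, so the
      -- translation by `q` falls short of it by the spacer length.
      · have e1 : blockPos J n (2 ^ (n + 1) + i) = blockPos J n i + (q + (J 1).length) := by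
          rw [blockPos_add_half hi, blockPos_of_lt hi, hq]; ring
        have h3 := wordTiles_blockPos h1 h2 (i := 2 ^ (n + 1) + i) (by omega)
        rw [e1] at h3
        have := hn' S _ _ (wordTiles_blockPos h1 h2 (i := i) (by omega)) h3
        have e2 : ∀ u, flow (-(J 1).length) (flow (u + (q + (J 1).length)) S) =
            flow q (flow u S) := fun u => by
          rw [← flow_add, ← flow_add]; congr 1; ring
        simp only [e2] at this
        exact this
      -- From the second half, the copy lies in the adjoining block of level `n + 1`, with no spacer
      -- in between.
      · have e1 : blockPos J n (2 ^ (n + 2) + i) = blockPos J n (2 ^ (n + 1) + i) + q := by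
          rw [blockPos_add_half hi, blockPos_add_full hi, hq]; ring
        have h3 := wordTiles_blockPos h1 h2 (i := 2 ^ (n + 2) + i) (by omega)
        rw [e1] at h3
        have := hn S _ _ (wordTiles_blockPos h1 h2 (i := 2 ^ (n + 1) + i) (by omega)) h3
        simp only [add_comm _ q, flow_add] at this
        exact this
  · have h4 : |2 ^ (n + 1) * (blockLength J n * a + blockLength J n * b) / blockLength J (n + 1) -
        (1 / 2 * a + 1 / 2 * b)| ≤ ε / 4 := by
      have : 2 ^ (n + 1) * (blockLength J n * a + blockLength J n * b) / blockLength J (n + 1) -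
        (1 / 2 * a + 1 / 2 * b) = -((a + b) * (J 1).length / 2 / blockLength J (n + 1)) := by
        rw [show 2 ^ (n + 1) * (blockLength J n * a + blockLength J n * b) = q * (a + b) by
          rw [hq]; ring]
        rw [hlen] at hh' ⊢
        field_simp
        ring
      rw [this, abs_neg, abs_div, abs_div, abs_mul, abs_of_pos hs, abs_of_pos hh', abs_two]
      refine le_trans ?_ hn3.le
      gcongr
      have : 0 ≤ |a + b| * (J 1).length := by positivity
      calc |a + b| * (J 1).length / 2 ≤ |a + b| * (J 1).length := by linarith
        _ ≤ _ := by gcongr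
    rw [add_div] at key
    have h5 : 2 ^ (n + 2) * (ε / 4 * blockLength J n) / blockLength J (n + 1) ≤ ε / 4 := by
      rw [div_le_iff₀ hh']
      have := two_pow_mul_blockLength_le (J := J) n
      calc 2 ^ (n + 2) * (ε / 4 * blockLength J n) = ε / 4 * (2 ^ (n + 2) * blockLength J n) := by ring
        _ ≤ _ := by gcongr
    have h6 : M * N * (J 1).length / blockLength J (n + 1) ≤
        2 * (M * N) * (J 1).length / blockLength J (n + 1) := by
      have : 0 ≤ M * N * (J 1).length := by positivity
      exact div_le_div_of_nonneg_right (by linarith) hh'.le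
    rw [Real.dist_eq]
    refine (abs_sub_le _ _ _).trans_lt ((add_le_add key h4).trans_lt ?_)
    linarith
  · rw [← mul_add, ← mul_assoc, abs_mul, ← hq, abs_of_pos hq0, hlen]
    calc q * |a + b| ≤ q * (2 * (M * N)) := by gcongr
      _ ≤ _ := by
        have : 0 ≤ M * N * (J 1).length := by positivity
        linarith

theorem abs_measureReal_inter_sub_le {A B : Set (Hull J x)} (hA : MeasurableSet A)
    (hB : MeasurableSet B) {f g : Hull J x → ℝ} (hf : Integrable f ν) (hg : Integrable g ν)
    {M : ℝ} (hfm : AEStronglyMeasurable f ν) (hM : ∀ S, |f S| ≤ M)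
    {φ : Hull J x → Hull J x} (hφ : MeasurePreserving φ ν ν) :
    |∫ S, f S * g (φ S) ∂ν - ν.real (A ∩ φ ⁻¹' B)| ≤
      ∫ S, |f S - A.indicator 1 S| ∂ν + M * ∫ S, |g S - B.indicator 1 S| ∂ν := by
  have hAi := integrable_indicator_one (μ := ν) hA
  have hBi := integrable_indicator_one (μ := ν) hB
  have hgφ := hφ.integrable_comp_of_integrable hg
  have hfg : Integrable (fun S => f S * g (φ S)) ν := hgφ.bdd_mul hfm (ae_of_all _ hM)
  have hm := hA.inter (hφ.measurable hB)
  have i1 : Integrable (fun S => |f S - A.indicator 1 S|) ν := (hf.sub hAi).abs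
  have i2 : Integrable (fun S => |g S - B.indicator 1 S|) ν := (hg.sub hBi).abs
  have i3 : Integrable (fun S => M * |g (φ S) - B.indicator 1 (φ S)|) ν :=
    (hφ.integrable_comp_of_integrable i2).const_mul M
  rw [← hφ.integral_comp_real i2.aestronglyMeasurable, ← integral_const_mul, ← integral_add i1 i3,
    ← integral_indicator_one hm, ← integral_sub hfg (integrable_indicator_one hm)]
  refine abs_integral_le_integral_abs.trans (integral_mono
    (hfg.sub (integrable_indicator_one hm)).abs (i1.add i3) fun S => ?_)
  simp only
  have h1 : (A ∩ φ ⁻¹' B).indicator (1 : Hull J x → ℝ) S =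
      A.indicator 1 S * B.indicator 1 (φ S) := by
    by_cases h1 : S ∈ A <;> by_cases h2 : φ S ∈ B <;> simp [Set.indicator, h1, h2]
  have h2 : |B.indicator (1 : Hull J x → ℝ) (φ S)| ≤ 1 := by
    by_cases h2 : φ S ∈ B <;> simp [Set.indicator, h2]
  rw [h1]
  calc |f S * g (φ S) - A.indicator 1 S * B.indicator 1 (φ S)|
      = |(f S - A.indicator 1 S) * B.indicator 1 (φ S) +
          f S * (g (φ S) - B.indicator 1 (φ S))| := by ring_nf
    _ ≤ |f S - A.indicator 1 S| * |B.indicator 1 (φ S)| +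
          |f S| * |g (φ S) - B.indicator 1 (φ S)| := by
        rw [← abs_mul, ← abs_mul]; exact abs_add_le _ _
    _ ≤ |f S - A.indicator 1 S| * 1 + M * |g (φ S) - B.indicator 1 (φ S)| := by
        have := hM S
        gcongr
    _ = _ := by rw [mul_one]

/-- The translation by `-s`, where `s` is the length of the spacer, and the identity. -/
noncomputable def spacerShift (b : Bool) : Hull J x → Hull J x :=
  flow (if b then -(J 1).length else 0)

theorem measurePreserving_spacerShift {μ : Measure (Hull J x)}
    (hμ : ∀ t, MeasurePreserving (flow t) μ μ) (b : Bool) :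
    MeasurePreserving (spacerShift (J := J) (x := x) b) μ μ :=
  hμ _

theorem weaklyTendsTo_spacerShift (hJ : Function.Injective fun a => (J a).length)
    (hx : x ∈ jrSubshift) (hν : ∀ t, MeasurePreserving (flow t) ν ν) {A B : Set (Hull J x)}
    (hA : MeasurableSet A) (hB : MeasurableSet B) :
    WeaklyTendsTo ν (fun n => flow (2 ^ (n + 1) * blockLength J n)) spacerShift (fun _ => 1 / 2)
      A B := by
  refine Metric.tendsto_nhds.2 fun ε hε => ?_
  obtain ⟨f, hf, hfA⟩ := exists_isLocal_approx ν hA (show 0 < ε / 6 by linarith)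
  obtain ⟨M, hM⟩ := hf.bounded
  obtain ⟨S₀⟩ : Nonempty (Hull J x) := nonempty_of_isProbabilityMeasure ν
  have hM0 : 0 ≤ M := (abs_nonneg _).trans (hM S₀)
  -- The divisor `M + 1` offsets the factor `M` that bounds `f`.
  obtain ⟨g, hg, hgB⟩ := exists_isLocal_approx ν hB (show 0 < ε / 6 / (M + 1) by positivity)
  have hclose : ∀ t, |∫ S, f S * g (flow t S) ∂ν - ν.real (A ∩ flow t ⁻¹' B)| ≤ ε / 3 := by
    intro t
    refine (abs_measureReal_inter_sub_le hA hB hf.integrable hg.integrable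
      hf.continuous.aestronglyMeasurable hM (hν t)).trans ?_
    have : M * ∫ S, |g S - B.indicator 1 S| ∂ν ≤ (M + 1) * (ε / 6 / (M + 1)) := by
      gcongr
      linarith
    rw [mul_div_cancel₀ _ (by positivity)] at this
    linarith
  have h0 := hclose 0
  have h1 := hclose (-(J 1).length)
  filter_upwards [(tendsto_correlation hJ hx hν hf hg).eventually
    (Metric.ball_mem_nhds _ (show 0 < ε / 3 by linarith))] with n hn
  have h2 := hclose (2 ^ (n + 1) * blockLength J n)
  rw [Real.dist_eq] at hn
  simp only [flow_zero] at h0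
  rw [Fintype.sum_bool, Real.dist_eq]
  simp only [spacerShift, if_true, Bool.false_eq_true, if_false]
  rw [abs_lt] at *
  rw [abs_le] at *
  constructor <;> linarith

/-- Sets that are invariant under the diagonal flow are invariant under the translation of one of
the coordinates by the length of the spacer. -/
theorem prod_spacer_invariant (hJ : Function.Injective fun a => (J a).length)
    (hx : x ∈ jrSubshift) (hν : ∀ t, MeasurePreserving (flow t) ν ν) {A : Set (Hull J x × Hull J x)}
    (hA : MeasurableSet A)
    (hinv : ∀ t, (ν.prod ν) (A ∆ (Prod.map (flow t) (flow t) ⁻¹' A)) = 0) :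
    (ν.prod ν) (A ∆ (Prod.map (spacerShift false) (spacerShift true) ⁻¹' A)) = 0 := by
  have hlim := WeaklyTendsTo.prod (μ := ν) (φ := fun n => flow (2 ^ (n + 1) * blockLength J n))
    (ψ := spacerShift) (w := fun _ => 1 / 2) (fun n => hν _) (measurePreserving_spacerShift hν)
    (by simp) (fun A B hA hB => weaklyTendsTo_spacerShift hJ hx hν hA hB) hA hA
  have hconst : ∀ n : ℕ, (ν.prod ν).real (A ∩ Prod.map (flow (2 ^ (n + 1) * blockLength J n))
      (flow (2 ^ (n + 1) * blockLength J n)) ⁻¹' A) = (ν.prod ν).real A := fun n => by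
    have h1 := measure_symmDiff_eq_zero_iff.1 (hinv (2 ^ (n + 1) * blockLength J n))
    have h2 := measure_congr ((ae_eq_refl A).inter h1.symm)
    rw [Set.inter_self] at h2
    rw [measureReal_def, h2, measureReal_def]
  simp only [WeaklyTendsTo, hconst] at hlim
  have heq := tendsto_nhds_unique hlim tendsto_const_nhds
  rw [Fintype.sum_prod_type] at heq
  simp only [Fintype.sum_bool] at heq
  have hle : ∀ b c : Bool, (ν.prod ν).real (A ∩ Prod.map (spacerShift b) (spacerShift c) ⁻¹' A) ≤
      (ν.prod ν).real A := fun b c => measureReal_mono Set.inter_subset_left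
  have h1 := hle true true
  have h2 := hle true false
  have h3 := hle false true
  have h4 := hle false false
  have hmp : MeasurePreserving (Prod.map (spacerShift (J := J) (x := x) false) (spacerShift true))
      (ν.prod ν) (ν.prod ν) :=
    (measurePreserving_spacerShift hν _).prod (measurePreserving_spacerShift hν _)
  -- Four numbers bounded by the measure of `A` average to it, so each equals it.
  have h5 : (ν.prod ν).real (A ∩ Prod.map (spacerShift false) (spacerShift true) ⁻¹' A) =
      (ν.prod ν).real A := by linarith
  have h6 : (ν.prod ν).real (Prod.map (spacerShift false) (spacerShift true) ⁻¹' A) =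
      (ν.prod ν).real A := by
    rw [measureReal_def, hmp.measure_preimage hA.nullMeasurableSet, measureReal_def]
  have hB := hmp.measurable hA
  rw [← measureReal_eq_zero_iff, measureReal_symmDiff_eq hA hB]
  have h7 := measureReal_sdiff_add_inter (μ := ν.prod ν) (s := A) hB
  have h8 := measureReal_sdiff_add_inter (μ := ν.prod ν)
    (s := Prod.map (spacerShift false) (spacerShift true) ⁻¹' A) hA
  rw [Set.inter_comm] at h8
  linarith

theorem isWeaklyMixingFlow (hJ : Irrational ((J 0).length / (J 1).length))
    (hx : x ∈ jrSubshift) (hν : ∀ t, MeasurePreserving (flow t) ν ν) :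
    IsWeaklyMixingFlow (flow (𝒯 := seqTiling J x)) ν := by
  intro A hA hinv
  have hJ' := injective_length hJ
  have hsec : ∀ S, MeasurableSet (Prod.mk S ⁻¹' A) := fun S => measurable_prodMk_left hA
  have h01 : ∀ᵐ S ∂ν, ν (Prod.mk S ⁻¹' A) = 0 ∨ ν (Prod.mk S ⁻¹' A) = 1 := by
    have h1 := prod_spacer_invariant hJ' hx hν hA hinv
    have hmeas : MeasurableSet
        (A ∆ (Prod.map (spacerShift (J := J) (x := x) false) (spacerShift true) ⁻¹' A)) :=
      hA.symmDiff (((measurePreserving_spacerShift hν _).prod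
        (measurePreserving_spacerShift hν _)).measurable hA)
    rw [Measure.measure_prod_null hmeas] at h1
    filter_upwards [h1] with S hS
    refine measure_of_spacer_invariant hJ hx hν (hsec S) ?_
    -- The sections are known to be invariant under the backward translation by the spacer length;
    -- the ergodicity lemma asks for the forward one.
    rw [← displacement_neg hν (hsec S), measureReal_eq_zero_iff, ← nonpos_iff_eq_zero]
    refine le_trans (le_of_eq ?_) (le_of_eq hS)
    congr 1
    rw [Set.preimage_symmDiff]
    congr 1
    ext S'
    simp [spacerShift, flow_zero]
  set B : Set (Hull J x) := {S | ν (Prod.mk S ⁻¹' A) = 1} with hBdef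
  have hmeasB : Measurable fun S => ν (Prod.mk S ⁻¹' A) := measurable_measure_prodMk_left hA
  have hB : MeasurableSet B := hmeasB (measurableSet_singleton 1)
  have hAB : (ν.prod ν) A = ν B := by
    rw [Measure.prod_apply hA, ← lintegral_indicator_one hB]
    refine lintegral_congr_ae ?_
    filter_upwards [h01] with S hS
    rcases hS with h | h
    · rw [h, Set.indicator_of_notMem]
      simp [hBdef, h]
    · rw [h, Set.indicator_of_mem (show S ∈ B from h)]; rfl
  rw [hAB]
  -- The base `B` is invariant: for almost every `S` the sections over `S` and `flow t S` correspond
  -- under `flow t` up to a null set, so they have equal measure.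
  refine isErgodicFlow hJ' hx hν B hB fun t => ?_
  have h1 := hinv t
  rw [Measure.measure_prod_null (hA.symmDiff (((hν t).prod (hν t)).measurable hA))] at h1
  refine measure_mono_null (fun S hS => ?_) (ae_iff.1 h1)
  contrapose! hS
  rw [Set.mem_ofPred_eq, not_not] at hS
  have h2 : ν (Prod.mk S ⁻¹' A) = ν (Prod.mk (flow t S) ⁻¹' A) := by
    have h3 : (Prod.mk S ⁻¹' A) =ᵐ[ν] flow t ⁻¹' (Prod.mk (flow t S) ⁻¹' A) :=
      measure_symmDiff_eq_zero_iff.1 hS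
    rw [measure_congr h3, (hν t).measure_preimage (hsec _).nullMeasurableSet]
  have h4 : S ∈ B ↔ flow t S ∈ B := by
    simp only [hBdef, Set.mem_ofPred_eq, h2]
  rw [Set.mem_symmDiff, Set.mem_preimage]
  tauto

end WeakLimit

end Hull

/-! ### Conclusion -/

theorem theorem5p1 (J : Fin 2 → Tile) (hJ : Irrational ((J 0).length / (J 1).length))
    (x : ℤ → Fin 2) (hx : x ∈ jrSubshift) :
    ∃ ν : Measure (TilingSpace (seqTiling J x)),
      IsMeasurePreservingFlow TilingSpace.flow ν ∧
      (∀ ν' : Measure (TilingSpace (seqTiling J x)), IsProbabilityMeasure ν' →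
        (∀ t, MeasurePreserving (TilingSpace.flow t) ν' ν') → ν' = ν) ∧
      IsRigidFlow TilingSpace.flow ν ∧
      IsWeaklyMixingFlow TilingSpace.flow ν := by
  have hJ' := Hull.injective_length hJ
  obtain ⟨ν, hprob, hν⟩ := Hull.exists_invariant (J := J) hx
  refine ⟨ν, Hull.isMeasurePreservingFlow hν,
    fun ν' _ hν' => Hull.invariant_unique hJ' hx ν' ν hν' hν,
    ⟨blockLength J, tendsto_blockLength.mono_right atTop_le_cocompact, fun f hf => ?_⟩,
    Hull.isWeaklyMixingFlow hJ hx hν⟩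
  exact tendsto_eLpNorm_comp_sub (fun n => hν (blockLength J n))
    (fun A hA => Hull.tendsto_rigid hJ' hx hν hA) hf
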